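/- **Notation.** Let $f(x)=\theta(x,\tau)=-\sum_{j\in\mathbb Z}e^{\pi \mathrm i(j+\frac12)^2\tau+2\pi \mathrm i(j+\frac12)(x+\frac12)}$ with $\operatorname{Im}\tau>0$ (elliptic case), or $f(x)=\sin \pi x$ (trigonometric case). Fix $\eta\in\mathbb C$ with $f(2\eta)\neq0$ and sequences $\{z_i\}_{i\ge0},\{\Lambda_i\}_{i\ge0}\subset\mathbb C$, and set $\Lambda_{[0,k)}=\sum_{i<k}\Lambda_i$, $\Lambda_{[0,k]}=\sum_{i\le k}\Lambda_i$, $$p_j=z_j+(1-\Lambda_j)\eta,\qquad q_j=z_j+(1+\Lambda_j)\eta,\qquad \psi_l(u)=\frac1{f(u-p_l)}\prod_{j=0}^{l-1}\frac{f(u-q_j)}{f(u-p_j)}.$$ **The functions $D_\nu$.** In the evaluation Verma module $V_\Lambda(z)=\mathrm{Span}(e_k)_{k\ge0}$ let $$a(\lambda,w)e_k=\tfrac{f(z-w+(\Lambda+1-2k)\eta)}{f(z-w+(\Lambda+1)\eta)}\tfrac{f(\lambda+2k\eta)}{f(\lambda)}e_k,\qquad b(\lambda,w)e_k=-\tfrac{f(-\lambda+z-w+(\Lambda-1-2k)\eta)}{f(z-w+(\Lambda+1)\eta)}\tfrac{f(2\eta)}{f(\lambda)}e_{k+1},$$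 $$c(\lambda,w)e_k=-\tfrac{f(-\lambda-z+w+(\Lambda+1-2k)\eta)}{f(z-w+(\Lambda+1)\eta)}\tfrac{f(2(\Lambda+1-k)\eta)}{f(\lambda)}\tfrac{f(2k\eta)}{f(2\eta)}e_{k-1},\qquad d(\lambda,w)e_k=\tfrac{f(z-w+(-\Lambda+1+2k)\eta)}{f(z-w+(\Lambda+1)\eta)}\tfrac{f(\lambda-2(\Lambda-k)\eta)}{f(\lambda)}e_k .$$ The vector $e_k$ has weight $\Lambda-2k$, and weights add in tensor products. On $V_1\otimes V_2$ the operators are the entries of $$\begin{bmatrix}a&b\\c&d\end{bmatrix}(\lambda,w)=\begin{bmatrix}a_2&b_2\\c_2&d_2\end{bmatrix}(\lambda-2\eta h^{(1)},w)\begin{bmatrix}a_1&b_1\\c_1&d_1\end{bmatrix}(\lambda,w),$$ where $h^{(1)}$ is the weight of the $V_1$-component after the action in $V_1$. For a signature $\nu=(\nu_1\ge\dots\ge\nu_N\ge0)=0^{n_0}1^{n_1}2^{n_2}\cdots$ (a finite weakly decreasing sequence of integers, with $n_i$ parts equal to $i$) put $E_\nu=e_{n_0}\otimes e_{n_1}\otimes\cdots\in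 V_{\Lambda_0}(z_0)\otimes V_{\Lambda_1}(z_1)\otimes\cdots$, and define $D_{\nu/\mu}(\lambda;w)$ by $$\lim_{m\to\infty}\prod_{i=0}^m\frac{f(z_i-w+(\Lambda_i+1)\eta)}{f(z_i-w+(-\Lambda_i+1)\eta)}\cdot\frac{1}{f(\lambda-2\eta(\Lambda_{[0,m]}-2N))}\,d(\lambda,w)(e_{n_0}\otimes\cdots\otimes e_{n_m})=\sum_\mu D_{\nu/\mu}(\lambda;w)E_\mu$$ (the factors $f(z_i-w+(\Lambda_i+1)\eta)$ cancel against the common denominators of $a,b,c,d$; the cancelled expression is used also where they vanish). Further put $D_{\nu/\mu}(\lambda;v_1,\dots,v_n)=\sum_\kappa D_{\kappa/\mu}(\lambda;v_1)\,D_{\nu/\kappa}(\lambda+2\eta;v_2,\dots,v_n)$ and $D_\nu=D_{\nu/0^N}$. **Admissibility.** Let $N\ge1$, and let $\mathcal D$ be a (half-open) fundamental parallelogram of $\mathbb C/(\mathbb Z+\tau\mathbb Z)$, respectively a fundamental strip of $\mathbb C/\mathbb Z$ in the trigonometric case. Assume that all $p_j$ and all $q_j$ lie in $\mathcal D$, and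 let $\gamma_1,\dots,\gamma_N\subset\mathcal D$ be positively oriented (piecewise $C^1$, simple closed) contours such that $\gamma_N$ includes all the $p_j$, each $\gamma_i$ ($1\le i<N$) includes both $\gamma_{i+1}$ and $\gamma_{i+1}+2\eta$ (so $\gamma_1$ is the outermost contour), and all the $q_j$ are outside every $\gamma_i$. **Proposition.** Let $n\ge1$, let $v_1,\dots,v_n\in\mathcal D$ lie outside $\gamma_1$, and let $\lambda\in\mathbb C$ be generic in the sense that $f(\lambda+2\eta(i-\Lambda_{[0,k)}))\ne0$ for all integers $k\ge0$ and $-n\le i\le 2N-1$. Then for every $\nu=(\nu_1\ge\dots\ge\nu_N\ge0)=0^{n_0}1^{n_1}2^{n_2}\cdots$ $$D_\nu(\lambda-2\eta n;v_1,\dots,v_n)=\frac{(-1)^N(f(2\eta))^N}{\prod_{i=-n}^{N-1}f(\lambda+2\eta i)\cdot c_\nu(\lambda)}\oint_{\gamma_1}\!\cdots\oint_{\gamma_N}\prod_{1\le i<j\le N}\frac{f(u_i-u_j)}{f(u_i-u_j-2\eta)}$$ $$\times\prod_{i=1}^N\Biggl(\psi_{\nu_i}(u_i)\,f\bigl(\lambda-u_i+p_{\nu_i}+2\eta+4\eta(N-i)-2\eta\Lambda_{[0,\nu_i)}\bigr)\frac{f(\lambda+u_i-q_0+2\eta(N-n))}{f(u_i-q_0)}\prod_{j=1}^n\frac{f(u_i-v_j+2\eta)}{f(u_i-v_j)}\Biggr)\frac{du_i}{2\pi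 \mathrm i},$$ where, with $n_{<i}=\sum_{k<i}n_k$, $$c_\nu(\lambda)=\frac{(f(2\eta))^N}{(f'(0))^N\prod_{i=0}^{N-1}f(\lambda+2\eta i)}\prod_{i\ge0}\prod_{j=0}^{n_i-1}\frac{f(\lambda+2\eta(2n_{<i}+n_i+j-\Lambda_{[0,i]}))\,f(\lambda+2\eta(2n_{<i}+1+j-\Lambda_{[0,i)}))}{f(2\eta(\Lambda_i-j))}.$$ -/

import Mathlib

namespace EllipticIRF

noncomputable section

open Complex Filter Finset

/-- The odd theta function
`θ(z,τ) = -∑_{j∈ℤ} exp(πi (j+1/2)² τ + 2πi (j+1/2)(z+1/2))`. -/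
def theta (z τ : ℂ) : ℂ :=
  -∑' j : ℤ, cexp (Real.pi * I * ((j : ℂ) + 1 / 2) ^ 2 * τ +
    2 * Real.pi * I * ((j : ℂ) + 1 / 2) * (z + 1 / 2))

/-- The two cases treated simultaneously: elliptic, with modulus `τ` in the upper half-plane, and
trigonometric. -/
inductive Regime where
  | elliptic (τ : UpperHalfPlane) : Regime
  | trigonometric : Regime

/-- The function `f`: it is `θ(·,τ)` in the elliptic case and `sin(π ·)` in the trigonometric
case. -/
def Regime.f : Regime → ℂ → ℂ
  | .elliptic τ, z => theta z τ
  | .trigonometric, z => Complex.sin (Real.pi * z)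

/-- `D` is a fundamental parallelogram of `ℂ/(ℤ+τℤ)` (spanned by any basis of the lattice), or, in
the trigonometric case, a fundamental strip of `ℂ/ℤ`; half-open, so that it contains exactly one
point of every class. -/
def Regime.IsFundamental : Regime → Set ℂ → Prop
  | .elliptic τ, D => ∃ z₀ ω₁ ω₂ : ℂ,
      AddSubgroup.closure {ω₁, ω₂} = AddSubgroup.closure {1, (τ : ℂ)} ∧
      D = {x | ∃ s ∈ Set.Ico (0 : ℝ) 1, ∃ t ∈ Set.Ico (0 : ℝ) 1, x = z₀ + s * ω₁ + t * ω₂}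
  | .trigonometric, D => ∃ z₀ ω : ℂ, ω.im ≠ 0 ∧
      D = {x | ∃ s ∈ Set.Ico (0 : ℝ) 1, ∃ t : ℝ, x = z₀ + s + t * ω}

/-! ### Evaluation Verma modules, tensor products, and the functions `D` -/

section Modules

variable (f : ℂ → ℂ) (η : ℂ)

/-- The matrix elements (coefficient of `e_l` in the image of `e_k`) of the four operators
`a, b, c, d` acting in the evaluation Verma module `V_Λ(z)`, arranged as the `2 × 2` matrix
`[a, b; c, d]`. All four operators have one common `λ`-independent denominator, which is the
argument `r`; the operators `a(λ,w), b(λ,w), c(λ,w), d(λ,w)` themselves are obtained for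
`r = f(z - w + (Λ+1)η)`. -/
def evalL (Λ z r lam w : ℂ) (k l : ℕ) : Matrix (Fin 2) (Fin 2) ℂ :=
  !![if l = k then
        f (z - w + (Λ + 1 - 2 * k) * η) / r * (f (lam + 2 * k * η) / f lam) else 0,
     if l = k + 1 then
        -(f (-lam + z - w + (Λ - 1 - 2 * k) * η) / r * (f (2 * η) / f lam)) else 0;
     if l + 1 = k then
        -(f (-lam - z + w + (Λ + 1 - 2 * k) * η) / r * (f (2 * (Λ + 1 - k) * η) / f lam) *
          (f (2 * k * η) / f (2 * η))) else 0,
     if l = k then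
        f (z - w + (-Λ + 1 + 2 * k) * η) / r * (f (lam - 2 * (Λ - k) * η) / f lam) else 0]

/-- The matrix elements of `[a, b; c, d]` in the tensor product
`V_{Λ_0}(z_0) ⊗ ⋯ ⊗ V_{Λ_{m-1}}(z_{m-1})`, namely the coefficients of `e_{y_0} ⊗ ⋯ ⊗ e_{y_{m-1}}`
in the image of `e_{x_0} ⊗ ⋯ ⊗ e_{x_{m-1}}`. The action on `V₁ ⊗ V₂` is the matrix product of
`[a₂, b₂; c₂, d₂]`, taken at `λ - 2ηh`, and `[a₁, b₁; c₁, d₁]`, taken at `λ`, with `h` the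
weight of the `V₁`-component after the action in `V₁`. The `i`-th factor is taken with the common
denominator `r i`. -/
def tensorL (Λ z r : ℕ → ℂ) (lam w : ℂ) (x y : ℕ → ℕ) : ℕ → Matrix (Fin 2) (Fin 2) ℂ
  | 0 => 1
  | m + 1 =>
      evalL f η (Λ m) (z m) (r m) (lam - 2 * η * ∑ i ∈ range m, (Λ i - 2 * (y i : ℂ))) w
        (x m) (y m) * tensorL Λ z r lam w x y m

theorem evalL_rescale (Λ z r s lam w : ℂ) (k l : ℕ) (hr : r ≠ 0) :
    (r / s) • evalL f η Λ z r lam w k l = evalL f η Λ z s lam w k l := by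
  have key : ∀ t : ℂ, r / s * (t / r) = t / s := fun t => by
    rw [div_mul_div_comm, mul_comm r t, mul_div_mul_right _ _ hr]
  ext i j
  fin_cases i <;> fin_cases j <;> simp [evalL, ← mul_assoc, key]

theorem tensorL_rescale (Λ z r s : ℕ → ℂ) (lam w : ℂ) (x y : ℕ → ℕ) (m : ℕ)
    (hr : ∀ i < m, r i ≠ 0) :
    (∏ i ∈ range m, r i / s i) • tensorL f η Λ z r lam w x y m =
      tensorL f η Λ z s lam w x y m := by
  induction m with
  | zero => simp [tensorL]
  | succ m ih =>
    rw [prod_range_succ, tensorL, tensorL, ← ih fun i hi => hr i (by omega),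
      ← evalL_rescale f η (Λ m) (z m) (r m) (s m) _ w (x m) (y m) (hr m (by omega)),
      smul_mul_smul_comm, mul_comm]

/-- Signatures `ν = (ν_1 ≥ ν_2 ≥ ⋯ ≥ 0) = 0^{n_0} 1^{n_1} 2^{n_2} ⋯` with nonnegative parts are
encoded as finite multisets of natural numbers, `n_i = ν.count i`. This is the coefficient of
`e_{m_0} ⊗ ⋯ ⊗ e_{m_m}` (`m_i = μ.count i`) in `d(λ,w) (e_{n_0} ⊗ ⋯ ⊗ e_{n_m})`. -/
def dFinite (Λ z : ℕ → ℂ) (ν μ : Multiset ℕ) (lam w : ℂ) (m : ℕ) : ℂ :=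
  tensorL f η Λ z (fun i => f (z i - w + (Λ i + 1) * η)) lam w
    (fun i => ν.count i) (fun i => μ.count i) (m + 1) 1 1

/-- The same coefficient, normalized by the factor
`∏_{i≤m} f(z_i - w + (Λ_i+1)η) / f(z_i - w + (-Λ_i+1)η) · 1 / f(λ - 2η(Λ_{[0,m]} - 2ℓ(ν)))`.
The numerators `f(z_i - w + (Λ_i+1)η)` are cancelled against the common denominators of
`a, b, c, d` (see `dNormalized_eq`), so that no singularity remains at their zeros. -/
def dNormalized (Λ z : ℕ → ℂ) (ν μ : Multiset ℕ) (lam w : ℂ) (m : ℕ) : ℂ :=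
  1 / f (lam - 2 * η * (∑ i ∈ range (m + 1), Λ i - 2 * (ν.card : ℂ))) *
    tensorL f η Λ z (fun i => f (z i - w + (-Λ i + 1) * η)) lam w
      (fun i => ν.count i) (fun i => μ.count i) (m + 1) 1 1

theorem dNormalized_eq (Λ z : ℕ → ℂ) (ν μ : Multiset ℕ) (lam w : ℂ) (m : ℕ)
    (h : ∀ i ≤ m, f (z i - w + (Λ i + 1) * η) ≠ 0) :
    dNormalized f η Λ z ν μ lam w m =
      (∏ i ∈ range (m + 1), f (z i - w + (Λ i + 1) * η) / f (z i - w + (-Λ i + 1) * η)) *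
        (1 / f (lam - 2 * η * (∑ i ∈ range (m + 1), Λ i - 2 * (ν.card : ℂ)))) *
        dFinite f η Λ z ν μ lam w m := by
  rw [dNormalized, dFinite, ← tensorL_rescale f η Λ z
    (fun i => f (z i - w + (Λ i + 1) * η)) (fun i => f (z i - w + (-Λ i + 1) * η)) lam w _ _ _
    (fun i hi => h i (by omega))]
  simp only [Matrix.smul_apply, smul_eq_mul]
  ring

/-- The coefficient `D_{ν/μ}(λ;w)` of `E_μ` in the infinite volume limit of the normalized
operator `d(λ,w)` applied to `E_ν`. -/
def D₁ (Λ z : ℕ → ℂ) (ν μ : Multiset ℕ) (lam w : ℂ) : ℂ :=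
  limUnder atTop (dNormalized f η Λ z ν μ lam w)

/-- The functions `D_{ν/μ}(λ;v_1,…,v_n)`, by the branching rule
`D_{ν/μ}(λ;v_1,…,v_n) = ∑_κ D_{κ/μ}(λ;v_1) D_{ν/κ}(λ+2η;v_2,…,v_n)`. -/
def DSkew (Λ z : ℕ → ℂ) (ν : Multiset ℕ) : (n : ℕ) → Multiset ℕ → ℂ → (Fin n → ℂ) → ℂ
  | 0, μ, _, _ => if ν = μ then 1 else 0
  | n + 1, μ, lam, v =>
      ∑ᶠ κ : Multiset ℕ, D₁ f η Λ z κ μ lam (v 0) * DSkew Λ z ν n κ (lam + 2 * η) (Fin.tail v)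

/-- `D_ν(λ;v_1,…,v_n) = D_{ν/0^N}(λ;v_1,…,v_n)`, where `N` is the number of parts of `ν`. -/
def DFun (Λ z : ℕ → ℂ) (ν : Multiset ℕ) (lam : ℂ) {n : ℕ} (v : Fin n → ℂ) : ℂ :=
  DSkew f η Λ z ν n (Multiset.replicate ν.card 0) lam v

/-! ### The ingredients of the integral representation -/

/-- `p_j = z_j + (1 - Λ_j) η`. -/
def pPt (Λ z : ℕ → ℂ) (j : ℕ) : ℂ := z j + (1 - Λ j) * η

/-- `q_j = z_j + (1 + Λ_j) η`. -/
def qPt (Λ z : ℕ → ℂ) (j : ℕ) : ℂ := z j + (1 + Λ j) * η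

/-- `Λ_{[0,k)} = Λ_0 + ⋯ + Λ_{k-1}`. -/
def sumΛ (Λ : ℕ → ℂ) (k : ℕ) : ℂ := ∑ i ∈ range k, Λ i

/-- `ψ_l(v) = 1/f(v - p_l) ∏_{j<l} f(v - q_j)/f(v - p_j)`. -/
def psi (Λ z : ℕ → ℂ) (l : ℕ) (v : ℂ) : ℂ :=
  1 / f (v - pPt η Λ z l) * ∏ j ∈ range l, f (v - qPt η Λ z j) / f (v - pPt η Λ z j)

/-- The squared norm `c_ν(λ)`. In the notation `ν = 0^{n_0} 1^{n_1} ⋯`, the product over the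
`i` with `n_i = 0` is empty, so that only the parts of `ν` contribute; `n_{<i}` is the number of
parts smaller than `i`. -/
def cNorm (Λ : ℕ → ℂ) (ν : Multiset ℕ) (lam : ℂ) : ℂ :=
  f (2 * η) ^ ν.card /
      (deriv f 0 ^ ν.card * ∏ i ∈ range ν.card, f (lam + 2 * η * i)) *
    ∏ i ∈ ν.toFinset, ∏ j ∈ range (ν.count i),
      f (lam + 2 * η * (2 * (ν.countP (· < i) : ℂ) + ν.count i + j - sumΛ Λ (i + 1))) *
        f (lam + 2 * η * (2 * (ν.countP (· < i) : ℂ) + 1 + j - sumΛ Λ i)) /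
        f (2 * η * (Λ i - j))

end Modules

/-! ### Contours -/

/-- `∮_γ F(u) du` for a curve parametrized by `[0,1]`. -/
def contourIntegral (γ : ℝ → ℂ) (F : ℂ → ℂ) : ℂ :=
  ∫ t in (0 : ℝ)..1, F (γ t) * deriv γ t

/-- The winding number of the closed curve `γ` around the point `w`. -/
def winding (γ : ℝ → ℂ) (w : ℂ) : ℂ :=
  (2 * Real.pi * I)⁻¹ * contourIntegral γ fun u => 1 / (u - w)

/-- A positively oriented contour: a piecewise continuously differentiable simple closed curve
which winds around every point off the curve either zero times (points outside) or once, in the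
positive direction (points inside). -/
structure Contour where
  toFun : ℝ → ℂ
  piecewise_C1 : ∃ (k : ℕ) (t : Fin (k + 1) → ℝ), Monotone t ∧ t 0 = 0 ∧ t (Fin.last k) = 1 ∧
    ∀ i : Fin k, ContDiffOn ℝ 1 toFun (Set.Icc (t i.castSucc) (t i.succ))
  closed : toFun 0 = toFun 1
  simple : Set.InjOn toFun (Set.Ico 0 1)
  positive : ∀ w ∉ toFun '' Set.Icc 0 1, winding toFun w = 0 ∨ winding toFun w = 1

/-- The points of the contour. -/
def Contour.trace (γ : Contour) : Set ℂ := γ.toFun '' Set.Icc 0 1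

/-- The region inside the contour. -/
def Contour.inside (γ : Contour) : Set ℂ := {w | w ∉ γ.trace ∧ winding γ.toFun w = 1}

/-- The region outside the contour. -/
def Contour.outside (γ : Contour) : Set ℂ := {w | w ∉ γ.trace ∧ winding γ.toFun w = 0}

/-- The iterated integral `∮_{γ_1} ⋯ ∮_{γ_N} F(u_1,…,u_N) ∏_i du_i/(2πi)`. -/
def iteratedIntegral : (N : ℕ) → (Fin N → Contour) → ((Fin N → ℂ) → ℂ) → ℂ
  | 0, _, F => F Fin.elim0
  | N + 1, γ, F => (2 * Real.pi * I)⁻¹ * contourIntegral (γ 0).toFun fun u =>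
      iteratedIntegral N (Fin.tail γ) fun u' => F (Fin.cons u u')

/-- Admissibility of the parameters, witnessed by the fundamental region `D` and the contours
`γ_1,…,γ_M` (`γ_{i+1}` is `γ i`): the points `p_j`, `q_j` and the contours lie in `D`, the
innermost contour `γ_M` includes all the `p_j`, each `γ_i` includes `γ_{i+1}` and
`γ_{i+1} + 2η`, and no `γ_i` includes any of the `q_j`. -/
structure Admissible (R : Regime) (η : ℂ) (Λ z : ℕ → ℂ) (D : Set ℂ) {M : ℕ}
    (γ : Fin M → Contour) : Prop where
  fundamental : R.IsFundamental D
  p_mem : ∀ j, pPt η Λ z j ∈ D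
  q_mem : ∀ j, qPt η Λ z j ∈ D
  trace_subset : ∀ i, (γ i).trace ⊆ D
  p_inside : ∀ i : Fin M, (i : ℕ) + 1 = M → ∀ j, pPt η Λ z j ∈ (γ i).inside
  nested : ∀ i i' : Fin M, (i : ℕ) + 1 = i' → ∀ u ∈ (γ i').trace,
    u ∈ (γ i).inside ∧ u + 2 * η ∈ (γ i).inside
  q_outside : ∀ i j, qPt η Λ z j ∈ (γ i).outside

end

end EllipticIRF

open EllipticIRF

/-! Put h = 2η. To a configuration κ of particles attach W_κ(x;φ), `weightIntegral`: the nested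
contour integral of the two-body factors f(u_i-u_j)/f(u_i-u_j-h), one letter per particle and ∏
φ(u_i), times the inverse norm of κ. Here x is the dynamical parameter and φ is any one-particle
function with poles outside the contours. The formula follows from two facts about W.

(1) The transfer operator d acts on weight functions by multiplication (`sum_D₁_mul`): ∑_μ
D_{κ/μ}(x;v) W_μ(x;φ) = f(x)⁻¹ W_κ(x+h; φ(u) f(u-v+h)/f(u-v)). Iterating along the branching rule
gives `sum_DSkew_mul`, the same statement for v_1,…,v_n with x moved to x+hn.

(2) For φ(u) = f(x+u-q_0+hN)/f(u-q_0) the integral W_μ(x;φ) vanishes unless μ = 0^N, and there it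
equals (-1/f'(0))^N. With this φ the left side of the iterated identity has the single term
D_ν(x;v_1,…,v_n), and x = λ-hn gives the assertion.

Fact (1) is proved one site at a time, for the entries d and b of the monodromy matrix together
(`transfer_relations`). The tool is a family of letters Z_c at each site (`siteLetter`): Z_v is the
weight function, Z_{v-h} is the weight function at parameter ℓ+h times f(u-v+h)/f(u-v), and Z_{q_m}
at site m is Z_{p_{m+1}} at site m+1. The three-term identity gives a one-body relation (Z_c is a
combination of Z_v and Z_{p_m}) and a two-body relation (a difference of two products of letters is
f(u-w-h) times a symmetric function). By the latter the two-body pole cancels, both contours can be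
made equal, and the antisymmetric remainder integrates to zero; hence Z_c can be moved through a row
of letters (`nestedIntegral_exchange`). The resulting coefficients are the matrix elements of a, b,
c, d, up to the recursions of the norms.

Fact (2) is an elliptic residue theorem (`integral_balanced`): for a balanced quotient of values of
f whose poles are all inside the contour except one at c, the integral is minus the contribution of
c. It is applied to the outermost variable. If the outermost letter is not at site 0, its numerator
cancels the pole q_0 and the integral is zero; otherwise the residue lowers N by one and moves q_0
to q_0-h.

Of f only oddness, entireness, f'(0) ≠ 0 and the three-term identity are used (`SigmaLike`), and of
the fundamental region only that it is convex and contains no two points differing by a zero of f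
(`IsCell`). Contour deformation then reduces to partial fractions and winding numbers. -/

namespace EllipticIRF
open Complex Filter

/-! ### The three-term identity and the sine -/

/-- The properties shared by the odd theta function and the sine: an odd entire function with a
simple zero at the origin, satisfying the three-term (Weierstrass) identity. -/
structure SigmaLike (f : ℂ → ℂ) : Prop where
  odd : ∀ x, f (-x) = -f x
  diff : Differentiable ℂ f
  deriv_zero : deriv f 0 ≠ 0
  three_term : ∀ x y z w, f (x + y) * f (x - y) * (f (z + w) * f (z - w)) -
    f (x + z) * f (x - z) * (f (y + w) * f (y - w)) +
    f (x + w) * f (x - w) * (f (y + z) * f (y - z)) = 0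

/-- The products f(x+y) f(x-y) are the 2×2 minors of the matrix with columns (A, B) at the four
points, and the identity is the Plücker relation between the minors. -/
theorem three_term_of_factor {f A B : ℂ → ℂ}
    (h : ∀ x y, f (x + y) * f (x - y) = A x * B y - B x * A y) (x y z w : ℂ) :
    f (x + y) * f (x - y) * (f (z + w) * f (z - w)) -
    f (x + z) * f (x - z) * (f (y + w) * f (y - w)) +
    f (x + w) * f (x - w) * (f (y + z) * f (y - z)) = 0 := by
  simp only [h]; ring

theorem sigmaLike_sin : SigmaLike fun z : ℂ => Complex.sin (Real.pi * z) where
  odd x := by simp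
  diff := by fun_prop
  deriv_zero := by
    have : HasDerivAt (fun z : ℂ => Complex.sin (Real.pi * z))
        (Complex.cos (Real.pi * 0) * (Real.pi * 1)) 0 :=
      ((hasDerivAt_id (0 : ℂ)).const_mul (Real.pi : ℂ)).csin
    rw [this.deriv]
    simp [Real.pi_ne_zero]
  three_term := by
    -- sin(a+b) sin(a-b) = sin² a - sin² b.
    refine three_term_of_factor (f := fun z : ℂ => Complex.sin (Real.pi * z)) (A := fun x => Complex.sin (Real.pi * x) ^ 2) (B := fun _ => 1) ?_
    intro x y
    have h1 := Complex.sin_sq_add_cos_sq (Real.pi * x)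
    have h2 := Complex.sin_sq_add_cos_sq (Real.pi * y)
    rw [mul_add, mul_sub, Complex.sin_add, Complex.sin_sub]
    linear_combination -(Complex.sin (Real.pi * y) ^ 2) * h1 + Complex.sin (Real.pi * x) ^ 2 * h2

/-! ### Theta functions: the product formula -/

section Theta

variable {τ : ℂ}

/-- The even-index theta constant family: `∑ e^{2πiτ j² + 4πi j x}`. -/
noncomputable def thetaE (τ x : ℂ) : ℂ := jacobiTheta₂ (2 * x) (2 * τ)

/-- The odd-index theta family: `∑ e^{πiτ (2j+1)²/2 + 2πi (2j+1) x}`. -/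
noncomputable def thetaO (τ x : ℂ) : ℂ :=
  cexp (Real.pi * I * τ / 2 + 2 * Real.pi * I * x) * jacobiTheta₂ (2 * x + τ) (2 * τ)

theorem two_mul_im_pos (hτ : 0 < τ.im) : 0 < (2 * τ).im := by
  simpa using hτ

theorem theta_eq (x τ : ℂ) : theta x τ =
    -(cexp (Real.pi * I * τ / 4 + Real.pi * I * (x + 1 / 2)) *
      jacobiTheta₂ (x + 1 / 2 + τ / 2) τ) := by
  rw [theta, jacobiTheta₂, ← tsum_mul_left]
  congr 1
  refine tsum_congr fun j => ?_
  rw [jacobiTheta₂_term, ← Complex.exp_add]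
  congr 1
  ring

theorem differentiable_theta (hτ : 0 < τ.im) : Differentiable ℂ fun x => theta x τ := by
  have h : Differentiable ℂ fun z => jacobiTheta₂ z τ :=
    fun z => differentiableAt_jacobiTheta₂_fst z hτ
  have h2 : Differentiable ℂ fun x => jacobiTheta₂ (x + 1 / 2 + τ / 2) τ :=
    h.comp (g := fun z => jacobiTheta₂ z τ) (f := fun x : ℂ => x + 1 / 2 + τ / 2) (by fun_prop)
  simp only [theta_eq]
  fun_prop

theorem differentiable_thetaE (hτ : 0 < τ.im) : Differentiable ℂ (thetaE τ) := by
  have h : Differentiable ℂ fun z => jacobiTheta₂ z (2 * τ) :=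
    fun z => differentiableAt_jacobiTheta₂_fst z (two_mul_im_pos hτ)
  exact h.comp (g := fun z => jacobiTheta₂ z (2 * τ)) (f := fun x : ℂ => 2 * x) (by fun_prop)

theorem differentiable_thetaO (hτ : 0 < τ.im) : Differentiable ℂ (thetaO τ) := by
  have h : Differentiable ℂ fun z => jacobiTheta₂ z (2 * τ) :=
    fun z => differentiableAt_jacobiTheta₂_fst z (two_mul_im_pos hτ)
  have h2 : Differentiable ℂ fun x => jacobiTheta₂ (2 * x + τ) (2 * τ) :=
    h.comp (g := fun z => jacobiTheta₂ z (2 * τ)) (f := fun x : ℂ => 2 * x + τ) (by fun_prop)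
  unfold thetaO
  fun_prop

theorem exp_pi_mul_odd (r : ℤ) : cexp (Real.pi * I * (2 * r + 1)) = -1 := by
  rw [show (Real.pi * I * (2 * r + 1) : ℂ) = r * (2 * Real.pi * I) + Real.pi * I by ring,
    Complex.exp_add, Complex.exp_int_mul_two_pi_mul_I, Complex.exp_pi_mul_I, one_mul]

theorem thetaE_add_half (x : ℂ) : thetaE τ (x + 1 / 2) = thetaE τ x := by
  rw [thetaE, thetaE, show 2 * (x + 1 / 2) = 2 * x + 1 by ring, jacobiTheta₂_add_left]

theorem thetaO_add_half (x : ℂ) : thetaO τ (x + 1 / 2) = -thetaO τ x := by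
  rw [thetaO, thetaO, show 2 * (x + 1 / 2) + τ = 2 * x + τ + 1 by ring, jacobiTheta₂_add_left,
    show Real.pi * I * τ / 2 + 2 * Real.pi * I * (x + 1 / 2) =
      Real.pi * I * τ / 2 + 2 * Real.pi * I * x + Real.pi * I by ring, Complex.exp_add _ (_ * I),
    Complex.exp_pi_mul_I]
  ring

/-- Translation by τ/2 interchanges the even and odd families with one and the same factor, and
translation by 1/2 changes only the sign of the odd one. This is what later makes a common
multiplier of both families quasi-periodic. -/
theorem thetaE_add_half_tau (x : ℂ) : thetaE τ (x + τ / 2) =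
    cexp (-(Real.pi * I * τ / 2) - 2 * Real.pi * I * x) * thetaO τ x := by
  rw [thetaE, thetaO, ← mul_assoc, ← Complex.exp_add]
  ring_nf
  simp

theorem thetaO_add_half_tau (x : ℂ) : thetaO τ (x + τ / 2) =
    cexp (-(Real.pi * I * τ / 2) - 2 * Real.pi * I * x) * thetaE τ x := by
  rw [thetaE, thetaO, show 2 * (x + τ / 2) + τ = 2 * x + 2 * τ by ring, jacobiTheta₂_add_left',
    ← mul_assoc, ← Complex.exp_add]
  congr 2
  ring

/-- In the product of the two series put s = j+k+1 and d = j-k. Then (j+1/2)²+(k+1/2)² = (s²+d²)/2,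
the variable x is paired with s and y with d, and the shift by 1/2 contributes the sign (-1)^s.
Since s and d have opposite parity, the double sum splits into an even-odd and an odd-even product.
-/
theorem theta_factor (hτ : 0 < τ.im) (x y : ℂ) :
    theta (x + y) τ * theta (x - y) τ =
      thetaE τ x * thetaO τ y - thetaO τ x * thetaE τ y := by
  set t : ℂ → ℤ → ℂ := fun x j => cexp (Real.pi * I * ((j : ℂ) + 1 / 2) ^ 2 * τ +
    2 * Real.pi * I * ((j : ℂ) + 1 / 2) * (x + 1 / 2)) with ht
  have hts : ∀ x, Summable fun j => ‖t x j‖ := by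
    intro x
    have h1 := (hasSum_jacobiTheta₂_term (x + 1 / 2 + τ / 2) hτ).summable.norm
    refine (h1.mul_left ‖cexp (Real.pi * I * τ / 4 + Real.pi * I * (x + 1 / 2))‖).congr ?_
    intro j
    rw [← norm_mul, jacobiTheta₂_term, ← Complex.exp_add, ht]
    congr 2
    ring
  have hth : ∀ x, theta x τ = -∑' j, t x j := fun x => rfl
  rw [hth, hth, neg_mul_neg, tsum_mul_tsum_of_summable_norm (hts _) (hts _)]
  have h2τ := two_mul_im_pos hτ
  have hE : ∀ x, HasSum (fun j : ℤ => jacobiTheta₂_term j (2 * x) (2 * τ)) (thetaE τ x) :=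
    fun x => hasSum_jacobiTheta₂_term _ h2τ
  have hO : ∀ x, HasSum (fun j : ℤ => cexp (Real.pi * I * τ / 2 + 2 * Real.pi * I * x) *
      jacobiTheta₂_term j (2 * x + τ) (2 * τ)) (thetaO τ x) :=
    fun x => (hasSum_jacobiTheta₂_term _ h2τ).mul_left _
  have hEO : ∀ x y, HasSum (fun p : ℤ × ℤ => jacobiTheta₂_term p.1 (2 * x) (2 * τ) *
      (cexp (Real.pi * I * τ / 2 + 2 * Real.pi * I * y) *
        jacobiTheta₂_term p.2 (2 * y + τ) (2 * τ))) (thetaE τ x * thetaO τ y) := by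
    intro x y
    have h := tsum_mul_tsum_of_summable_norm (hE x).summable.norm (hO y).summable.norm
    rw [(hE x).tsum_eq, (hO y).tsum_eq] at h
    rw [h]
    exact (summable_mul_of_summable_norm (hE x).summable.norm (hO y).summable.norm).hasSum
  -- `i0` parametrizes the pairs with even sum, `i1` those with odd sum.
  let i0 : ℤ × ℤ → ℤ × ℤ := fun p => (p.2 + p.1, p.2 - p.1)
  let i1 : ℤ × ℤ → ℤ × ℤ := fun p => (p.1 + p.2, p.1 - p.2 - 1)
  have hi0 : Function.Injective i0 := by
    rintro ⟨a, b⟩ ⟨c, d⟩ h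
    simp only [i0, Prod.mk.injEq] at h
    ext <;> simp <;> omega
  have hi1 : Function.Injective i1 := by
    rintro ⟨a, b⟩ ⟨c, d⟩ h
    simp only [i1, Prod.mk.injEq] at h
    ext <;> simp <;> omega
  have hcompl : IsCompl (Set.range i0) (Set.range i1) := by
    constructor
    · rw [Set.disjoint_iff_forall_ne]
      rintro _ ⟨⟨a, b⟩, rfl⟩ _ ⟨⟨c, d⟩, rfl⟩ h
      simp only [i0, i1, Prod.mk.injEq] at h
      omega
    · refine codisjoint_iff.2 (Set.eq_univ_iff_forall.2 ?_)
      rintro ⟨a, b⟩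
      rcases Int.emod_two_eq_zero_or_one (a + b) with h | h
      · left
        exact ⟨((a - b) / 2, (a + b) / 2), by simp only [i0, Prod.mk.injEq]; omega⟩
      · right
        exact ⟨((a + b + 1) / 2, (a - b - 1) / 2), by simp only [i1, Prod.mk.injEq]; omega⟩
  have h0 : HasSum ((fun p : ℤ × ℤ => t (x + y) p.1 * t (x - y) p.2) ∘ i0)
      (-(thetaO τ x * thetaE τ y)) := by
    have h := (hEO y x).neg
    rw [mul_comm]
    have e : (fun p : ℤ × ℤ => t (x + y) p.1 * t (x - y) p.2) ∘ i0 = fun p : ℤ × ℤ =>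
        -(jacobiTheta₂_term p.1 (2 * y) (2 * τ) *
          (cexp (Real.pi * I * τ / 2 + 2 * Real.pi * I * x) *
          jacobiTheta₂_term p.2 (2 * x + τ) (2 * τ))) := by
      funext p
      simp only [Function.comp_apply, i0, ht, jacobiTheta₂_term, ← Complex.exp_add]
      rw [neg_eq_neg_one_mul, ← exp_pi_mul_odd p.2, ← Complex.exp_add]
      congr 1
      push_cast
      ring
    rw [e]
    exact h
  have h1 : HasSum ((fun p : ℤ × ℤ => t (x + y) p.1 * t (x - y) p.2) ∘ i1)
      (thetaE τ x * thetaO τ y) := by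
    have h := hEO x y
    have e : (fun p : ℤ × ℤ => t (x + y) p.1 * t (x - y) p.2) ∘ i1 = fun p : ℤ × ℤ =>
        jacobiTheta₂_term p.1 (2 * x) (2 * τ) *
          (cexp (Real.pi * I * τ / 2 + 2 * Real.pi * I * y) *
          jacobiTheta₂_term p.2 (2 * y + τ) (2 * τ)) := by
      funext p
      simp only [Function.comp_apply, i1, ht, jacobiTheta₂_term, ← Complex.exp_add]
      exact Complex.exp_eq_exp_iff_exists_int.2 ⟨p.1, by push_cast; ring⟩
    rw [e]
    exact h
  have h := HasSum.add_isCompl (f := fun p : ℤ × ℤ => t (x + y) p.1 * t (x - y) p.2) hcompl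
    (hi0.hasSum_range_iff.2 h0) (hi1.hasSum_range_iff.2 h1)
  rw [h.tsum_eq]
  ring
end Theta
section Theta
variable {τ : ℂ}

/-- The series is a Fourier series in x; its zeroth coefficient, the integral over [0,1], is 1. -/
theorem exists_jacobiTheta₂_ne_zero (hτ : 0 < τ.im) : ∃ x, jacobiTheta₂ x τ ≠ 0 := by
  by_contra! h
  have hs : Summable fun n : ℤ => ‖jacobiTheta₂_term n 0 τ‖ :=
    (hasSum_jacobiTheta₂_term 0 hτ).summable.norm
  have hnorm : ∀ (n : ℤ) (x : ℝ), ‖jacobiTheta₂_term n x τ‖ = ‖jacobiTheta₂_term n 0 τ‖ := by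
    intro n x
    simp [norm_jacobiTheta₂_term]
  have hc : ∀ n : ℤ, Continuous fun x : ℝ => jacobiTheta₂_term n x τ := by
    intro n
    unfold jacobiTheta₂_term
    fun_prop
  have H := intervalIntegral.hasSum_integral_of_dominated_convergence
    (F := fun (n : ℤ) (x : ℝ) => jacobiTheta₂_term n x τ) (f := fun x : ℝ => jacobiTheta₂ x τ)
    (μ := MeasureTheory.volume) (a := 0) (b := 1) (fun n _ => ‖jacobiTheta₂_term n 0 τ‖)
    (fun n => (hc n).aestronglyMeasurable) (fun n => .of_forall fun x _ => (hnorm n x).le)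
    (.of_forall fun x _ => hs) (by simp) (.of_forall fun x _ => hasSum_jacobiTheta₂_term _ hτ)
  have hterm : ∀ n : ℤ, n ≠ 0 → ∫ x in (0 : ℝ)..1, jacobiTheta₂_term n x τ = 0 := by
    intro n hn
    have hn' : (2 * Real.pi * I * n : ℂ) ≠ 0 := by
      simp [Real.pi_ne_zero, Complex.I_ne_zero, hn]
    have : ∀ x : ℝ, jacobiTheta₂_term n x τ =
        cexp (Real.pi * I * n ^ 2 * τ) * cexp (2 * Real.pi * I * n * x) := by
      intro x
      rw [jacobiTheta₂_term, Complex.exp_add, mul_comm]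
    simp only [this]
    rw [intervalIntegral.integral_const_mul, integral_exp_mul_complex hn']
    rw [show (2 * Real.pi * I * n * ((1 : ℝ) : ℂ) : ℂ) = n * (2 * Real.pi * I) by push_cast; ring,
      Complex.exp_int_mul_two_pi_mul_I]
    simp
  have h0 : ∫ x in (0 : ℝ)..1, jacobiTheta₂_term 0 x τ = 1 := by
    simp [jacobiTheta₂_term]
  have H2 := H.unique (hasSum_single 0 hterm)
  rw [h0] at H2
  simp [h] at H2

theorem exists_theta_ne_zero (hτ : 0 < τ.im) : ∃ x, theta x τ ≠ 0 := by
  obtain ⟨x, hx⟩ := exists_jacobiTheta₂_ne_zero hτ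
  refine ⟨x - 1 / 2 - τ / 2, ?_⟩
  rw [theta_eq, show x - 1 / 2 - τ / 2 + 1 / 2 + τ / 2 = x by ring]
  simp [hx, Complex.exp_ne_zero]

end Theta

theorem eventually_ne_zero_of_entire {f : ℂ → ℂ} (hf : Differentiable ℂ f) (h : ∃ x, f x ≠ 0)
    (a : ℂ) : ∀ᶠ x in nhdsWithin a {a}ᶜ, f x ≠ 0 := by
  by_contra hcon
  obtain ⟨x, hx⟩ := h
  refine hx (AnalyticOnNhd.eqOn_zero_of_preconnected_of_frequently_eq_zero (U := Set.univ) (z₀ := a)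
    (fun z _ => hf.analyticAt z) isPreconnected_univ trivial ?_ (Set.mem_univ x))
  exact fun hc => hcon hc

/-! ### Oddness and zeros of the theta function -/

section Theta
variable {τ : ℂ}

/-- The right side of `theta_factor` changes sign when its two points are exchanged, while on the
left only the difference x changes sign; the sum s is kept at a point where θ does not vanish. -/
theorem theta_neg (hτ : 0 < τ.im) (x : ℂ) : theta (-x) τ = -theta x τ := by
  obtain ⟨s, hs⟩ := exists_theta_ne_zero hτ
  have h1 := theta_factor hτ ((s + x) / 2) ((s - x) / 2)
  have h2 := theta_factor hτ ((s - x) / 2) ((s + x) / 2)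
  rw [show (s + x) / 2 + (s - x) / 2 = s by ring, show (s + x) / 2 - (s - x) / 2 = x by ring] at h1
  rw [show (s - x) / 2 + (s + x) / 2 = s by ring, show (s - x) / 2 - (s + x) / 2 = -x by ring] at h2
  refine mul_left_cancel₀ hs ?_
  linear_combination h1 + h2

theorem theta_zero (hτ : 0 < τ.im) : theta 0 τ = 0 := by
  have := theta_neg hτ 0
  rw [neg_zero] at this
  exact self_eq_neg.1 this

theorem exists_theta_mul_ne_zero (hτ : 0 < τ.im) (x : ℂ) {U : Set ℂ} (hU : U ∈ nhds x) :
    ∃ y ∈ U, theta (x + y) τ * theta (x - y) τ ≠ 0 := by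
  have hne := exists_theta_ne_zero hτ
  have hd := differentiable_theta hτ
  have h1 := eventually_ne_zero_of_entire (f := fun y => theta (x + y) τ)
    (hd.comp (g := fun z => theta z τ) (f := fun y => x + y) (by fun_prop))
    (hne.imp' (fun z => z - x) fun z hz => by simpa using hz) x
  have h2 := eventually_ne_zero_of_entire (f := fun y => theta (x - y) τ)
    (hd.comp (g := fun z => theta z τ) (f := fun y => x - y) (by fun_prop))
    (hne.imp' (fun z => x - z) fun z hz => by simpa using hz) x
  obtain ⟨y, hy⟩ := (h1.and (h2.and (mem_nhdsWithin_of_mem_nhds hU))).exists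
  exact ⟨y, hy.2.2, mul_ne_zero hy.1 hy.2.1⟩

/-- At a common zero x the product θ(x+y) θ(x-y) would vanish for all y. -/
theorem thetaE_ne_zero_or (hτ : 0 < τ.im) (x : ℂ) : thetaE τ x ≠ 0 ∨ thetaO τ x ≠ 0 := by
  by_contra! h
  obtain ⟨y, -, hy⟩ := exists_theta_mul_ne_zero hτ x univ_mem
  rw [theta_factor hτ, h.1, h.2] at hy
  simp at hy

/-- If θ'(0) = 0, differentiating `theta_factor` in x at x = y shows that the Wronskian of the two
families vanishes identically. Their quotient is then locally constant, so θ(x+y) θ(x-y) vanishes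
for x, y close to each other, which is absurd. -/
theorem deriv_theta_zero (hτ : 0 < τ.im) : deriv (fun x => theta x τ) 0 ≠ 0 := by
  intro h0
  set f := fun x => theta x τ with hf
  have hd : Differentiable ℂ f := differentiable_theta hτ
  have hE := differentiable_thetaE hτ
  have hO := differentiable_thetaO hτ
  have hf0 : HasDerivAt f 0 0 := by
    have := (hd 0).hasDerivAt
    rwa [h0] at this
  have hW : ∀ y, deriv (thetaE τ) y * thetaO τ y - deriv (thetaO τ) y * thetaE τ y = 0 := by
    intro y
    have h1 : HasDerivAt (fun x => f (x + y) * f (x - y))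
        (deriv f (y + y) * f (y - y) + f (y + y) * 0) y := by
      refine HasDerivAt.fun_mul ?_ ?_
      · exact (hd (y + y)).hasDerivAt.comp_add_const y y
      · have : HasDerivAt f 0 (y - y) := by rwa [sub_self]
        exact this.comp_sub_const y y
    have h2 : HasDerivAt (fun x => f (x + y) * f (x - y))
        (deriv (thetaE τ) y * thetaO τ y - deriv (thetaO τ) y * thetaE τ y) y := by
      have : (fun x => f (x + y) * f (x - y)) =
          fun x => thetaE τ x * thetaO τ y - thetaO τ x * thetaE τ y :=
        funext fun x => theta_factor hτ x y
      rw [this]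
      exact ((hE y).hasDerivAt.mul_const _).sub ((hO y).hasDerivAt.mul_const _)
    rw [h2.unique h1, sub_self, show f 0 = 0 from theta_zero hτ]
    ring
  obtain ⟨y, -, hy⟩ := exists_theta_mul_ne_zero hτ 0 univ_mem
  have hO0 : ∃ x, thetaO τ x ≠ 0 := by
    by_contra! h
    rw [theta_factor hτ, h, h] at hy
    simp at hy
  obtain ⟨x, hx⟩ := hO0
  obtain ⟨ε, hε, hball⟩ := Metric.eventually_nhds_iff_ball.1
    ((hO.continuous.continuousAt (x := x)).eventually_ne hx)
  obtain ⟨z, hz, hne⟩ := exists_theta_mul_ne_zero hτ x (Metric.ball_mem_nhds x hε)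
  have hcst := Metric.isOpen_ball.is_const_of_deriv_eq_zero (f := fun u => thetaE τ u / thetaO τ u)
    (convex_ball x ε).isPreconnected
    (fun u hu => ((hE u).div (hO u) (hball u hu)).differentiableWithinAt)
    (fun u hu => by
      have := ((hE u).hasDerivAt.div (hO u).hasDerivAt (hball u hu)).deriv
      rw [show (fun u => thetaE τ u / thetaO τ u) = thetaE τ / thetaO τ from rfl, this]
      have := hW u
      simp only [Pi.zero_apply, div_eq_zero_iff]
      left
      linear_combination this)
    (Metric.mem_ball_self hε) hz
  rw [div_eq_div_iff (hball x (Metric.mem_ball_self hε)) (hball z hz)] at hcst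
  apply hne
  rw [theta_factor hτ]
  linear_combination hcst

theorem sigmaLike_theta (hτ : 0 < τ.im) : SigmaLike fun x => theta x τ where
  odd := theta_neg hτ
  diff := differentiable_theta hτ
  deriv_zero := deriv_theta_zero hτ
  three_term := three_term_of_factor (f := fun x => theta x τ) (theta_factor hτ)

/-- A zero of `θ` is a common quasi-period of the two functions `thetaE`, `thetaO`. -/
theorem exists_multiplier_of_theta_eq_zero (hτ : 0 < τ.im) {a : ℂ} (ha : theta a τ = 0) :
    ∃ r : ℂ → ℂ, Differentiable ℂ r ∧ ∀ x, thetaE τ (x + a) = r x * thetaE τ x ∧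
      thetaO τ (x + a) = r x * thetaO τ x := by
  have hE := differentiable_thetaE hτ
  have hO := differentiable_thetaO hτ
  have key : ∀ x, thetaE τ (x + a) * thetaO τ x = thetaO τ (x + a) * thetaE τ x := by
    intro x
    have := theta_factor hτ (x + a) x
    rw [add_sub_cancel_left, ha, mul_zero] at this
    linear_combination -this
  have hr : ∀ x, ∃ c, thetaE τ (x + a) = c * thetaE τ x ∧ thetaO τ (x + a) = c * thetaO τ x := by
    intro x
    rcases thetaE_ne_zero_or hτ x with h | h
    · exact ⟨thetaE τ (x + a) / thetaE τ x, by field_simp, by field_simp; rw [← key x]⟩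
    · exact ⟨thetaO τ (x + a) / thetaO τ x, by field_simp; rw [key x], by field_simp⟩
  choose r hr using hr
  refine ⟨r, fun x => ?_, hr⟩
  rcases thetaE_ne_zero_or hτ x with h | h
  · have : r =ᶠ[nhds x] fun y => thetaE τ (y + a) / thetaE τ y := by
      filter_upwards [(hE.continuous.continuousAt (x := x)).eventually_ne h] with y hy
      rw [(hr y).1, mul_div_cancel_right₀ _ hy]
    refine this.differentiableAt_iff.2 (DifferentiableAt.fun_div ?_ (hE x) h)
    exact (hE _).comp (g := thetaE τ) x (by fun_prop)
  · have : r =ᶠ[nhds x] fun y => thetaO τ (y + a) / thetaO τ y := by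
      filter_upwards [(hO.continuous.continuousAt (x := x)).eventually_ne h] with y hy
      rw [(hr y).2, mul_div_cancel_right₀ _ hy]
    refine this.differentiableAt_iff.2 (DifferentiableAt.fun_div ?_ (hO x) h)
    exact (hO _).comp (g := thetaO τ) x (by fun_prop)

/-- A continuous function whose modulus is invariant under two periods `1 / 2`, `τ / 2` is
bounded. -/
theorem isBounded_range_of_norm_periodic {g : ℂ → ℂ} (hg : Continuous g) (hτ : 0 < τ.im)
    (h1 : ∀ x, ‖g (x + 1 / 2)‖ = ‖g x‖) (h2 : ∀ x, ‖g (x + τ / 2)‖ = ‖g x‖) :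
    Bornology.IsBounded (Set.range g) := by
  have h1z : ∀ (n : ℤ) x, ‖g (x + n * (1 / 2))‖ = ‖g x‖ := by
    have : Function.Periodic (fun x => ‖g x‖) (1 / 2) := h1
    intro n x
    exact this.int_mul n x
  have h2z : ∀ (n : ℤ) x, ‖g (x + n * (τ / 2))‖ = ‖g x‖ := by
    have : Function.Periodic (fun x => ‖g x‖) (τ / 2) := h2
    intro n x
    exact this.int_mul n x
  have hK : IsCompact ((fun p : ℝ × ℝ => (p.1 * (1 / 2) + p.2 * (τ / 2) : ℂ)) ''
      (Set.Icc 0 1 ×ˢ Set.Icc 0 1)) :=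
    (isCompact_Icc.prod isCompact_Icc).image (by fun_prop)
  obtain ⟨C, hC⟩ := hK.exists_bound_of_continuousOn hg.continuousOn
  refine isBounded_iff_forall_norm_le.2 ⟨C, ?_⟩
  rintro _ ⟨x, rfl⟩
  set t : ℝ := 2 * x.im / τ.im with ht
  set s : ℝ := 2 * x.re - t * τ.re with hs
  have hx : x = s * (1 / 2) + t * (τ / 2) := by
    apply Complex.ext
    · simp [hs]
      ring
    · simp [ht]
      field_simp
  have hx2 : x = (Int.fract s * (1 / 2) + Int.fract t * (τ / 2)) + ⌊s⌋ * (1 / 2) +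
      ⌊t⌋ * (τ / 2) := by
    conv_lhs => rw [hx, ← Int.floor_add_fract s, ← Int.floor_add_fract t]
    push_cast
    ring
  rw [hx2, h2z, h1z]
  exact hC _ ⟨(Int.fract s, Int.fract t), ⟨⟨Int.fract_nonneg _, (Int.fract_lt_one _).le⟩,
    ⟨Int.fract_nonneg _, (Int.fract_lt_one _).le⟩⟩, rfl⟩

/-- A zero a yields a zero-free entire multiplier r for translation by a. It is invariant under 1/2
and picks up exp(-2πia) under τ/2. After multiplication by a suitable exponential it is bounded,
hence constant by Liouville, and triviality of the two remaining factors says that a is a lattice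
point. -/
theorem mem_lattice_of_theta_eq_zero (hτ : 0 < τ.im) {a : ℂ} (ha : theta a τ = 0) :
    ∃ m n : ℤ, a = m + n * τ := by
  obtain ⟨r, hrd, hr⟩ := exists_multiplier_of_theta_eq_zero hτ ha
  have huniq : ∀ x c, thetaE τ (x + a) = c * thetaE τ x → thetaO τ (x + a) = c * thetaO τ x →
      c = r x := by
    intro x c h1 h2
    rcases thetaE_ne_zero_or hτ x with h | h
    · exact mul_right_cancel₀ h (h1.symm.trans (hr x).1)
    · exact mul_right_cancel₀ h (h2.symm.trans (hr x).2)
  have hr0 : ∀ x, r x ≠ 0 := by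
    intro x h
    rcases thetaE_ne_zero_or hτ (x + a) with h' | h'
    · exact h' (by rw [(hr x).1, h, zero_mul])
    · exact h' (by rw [(hr x).2, h, zero_mul])
  have hr1 : ∀ x, r (x + 1 / 2) = r x := by
    intro x
    refine (huniq _ _ ?_ ?_).symm
    · rw [add_right_comm, thetaE_add_half, thetaE_add_half, (hr x).1]
    · rw [add_right_comm, thetaO_add_half, thetaO_add_half, (hr x).2, mul_neg]
  have hr2 : ∀ x, r (x + τ / 2) = cexp (-(2 * Real.pi * I * a)) * r x := by
    intro x
    have e : cexp (-(Real.pi * I * τ / 2) - 2 * Real.pi * I * (x + a)) =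
        cexp (-(2 * Real.pi * I * a)) * cexp (-(Real.pi * I * τ / 2) - 2 * Real.pi * I * x) := by
      rw [← Complex.exp_add]; ring_nf
    refine (huniq _ _ ?_ ?_).symm
    · rw [add_right_comm, thetaE_add_half_tau, thetaE_add_half_tau, (hr x).2, e]
      ring
    · rw [add_right_comm, thetaO_add_half_tau, thetaO_add_half_tau, (hr x).1, e]
      ring
  -- This t makes tτ - a real, so that both multipliers of g have modulus one.
  set t : ℝ := a.im / τ.im with ht
  set g : ℂ → ℂ := fun x => r x * cexp (4 * Real.pi * I * t * x) with hg
  have hgd : Differentiable ℂ g := by fun_prop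
  have hg1 : ∀ x, g (x + 1 / 2) = cexp (2 * Real.pi * I * t) * g x := by
    intro x
    simp only [hg]
    rw [hr1, show 4 * Real.pi * I * t * (x + 1 / 2) =
      2 * Real.pi * I * t + 4 * Real.pi * I * t * x by ring, Complex.exp_add]
    ring
  have hg2 : ∀ x, g (x + τ / 2) = cexp (2 * Real.pi * I * (t * τ - a)) * g x := by
    intro x
    simp only [hg]
    rw [hr2, show 4 * Real.pi * I * t * (x + τ / 2) =
      2 * Real.pi * I * t * τ + 4 * Real.pi * I * t * x by ring, Complex.exp_add,
      show 2 * Real.pi * I * (t * τ - a) = -(2 * Real.pi * I * a) + 2 * Real.pi * I * t * τ by ring,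
      Complex.exp_add (-(2 * Real.pi * I * a))]
    ring
  have hb := isBounded_range_of_norm_periodic hgd.continuous hτ (g := g)
    (fun x => by
      rw [hg1, norm_mul, Complex.norm_exp]
      simp)
    (fun x => by
      rw [hg2, norm_mul, Complex.norm_exp]
      have : (2 * Real.pi * I * (t * τ - a)).re = 0 := by
        simp [ht]
        field_simp
        ring
      rw [this, Real.exp_zero, one_mul])
  have hg0 : g 0 ≠ 0 := mul_ne_zero (hr0 0) (Complex.exp_ne_zero _)
  have e1 : cexp (2 * Real.pi * I * t) = 1 := by
    have := hg1 0
    rw [hgd.apply_eq_apply_of_bounded hb (0 + 1 / 2) 0] at this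
    exact mul_right_cancel₀ hg0 (by rw [one_mul]; exact this.symm)
  have e2 : cexp (2 * Real.pi * I * (t * τ - a)) = 1 := by
    have := hg2 0
    rw [hgd.apply_eq_apply_of_bounded hb (0 + τ / 2) 0] at this
    exact mul_right_cancel₀ hg0 (by rw [one_mul]; exact this.symm)
  obtain ⟨k, hk⟩ := Complex.exp_eq_one_iff.1 e1
  obtain ⟨l, hl⟩ := Complex.exp_eq_one_iff.1 e2
  have hpi : (2 * Real.pi * I : ℂ) ≠ 0 := Complex.two_pi_I_ne_zero
  have hk' : (t : ℂ) = k := mul_left_cancel₀ hpi (by linear_combination hk)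
  have hl' : t * τ - a = l := mul_left_cancel₀ hpi (by linear_combination hl)
  exact ⟨-l, k, by push_cast; rw [← hk']; linear_combination -hl'⟩

end Theta

/-! ### Fundamental regions -/

theorem Regime.sigmaLike (R : Regime) : SigmaLike R.f := by
  cases R with
  | elliptic τ => exact sigmaLike_theta τ.im_pos
  | trigonometric => exact sigmaLike_sin

theorem Regime.IsFundamental.convex {R : Regime} {D : Set ℂ} (h : R.IsFundamental D) :
    Convex ℝ D := by
  cases R with
  | elliptic τ =>
    obtain ⟨z₀, ω₁, ω₂, -, rfl⟩ := h
    rintro _ ⟨s, hs, t, ht, rfl⟩ _ ⟨s', hs', t', ht', rfl⟩ a b ha hb hab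
    refine ⟨a * s + b * s', ?_, a * t + b * t', ?_, ?_⟩
    · exact (convex_Ico (0 : ℝ) 1) hs hs' ha hb hab
    · exact (convex_Ico (0 : ℝ) 1) ht ht' ha hb hab
    · have : (a + b : ℂ) = 1 := by exact_mod_cast hab
      push_cast
      simp only [Complex.real_smul]
      linear_combination z₀ * this
  | trigonometric =>
    obtain ⟨z₀, ω, -, rfl⟩ := h
    rintro _ ⟨s, hs, t, rfl⟩ _ ⟨s', hs', t', rfl⟩ a b ha hb hab
    refine ⟨a * s + b * s', ?_, a * t + b * t', ?_⟩
    · exact (convex_Ico (0 : ℝ) 1) hs hs' ha hb hab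
    · have : (a + b : ℂ) = 1 := by exact_mod_cast hab
      push_cast
      simp only [Complex.real_smul]
      linear_combination z₀ * this

theorem int_eq_zero_of_eq_sub {m : ℤ} {s s' : ℝ} (hs : s ∈ Set.Ico (0 : ℝ) 1)
    (hs' : s' ∈ Set.Ico (0 : ℝ) 1) (h : (m : ℝ) = s - s') : m = 0 := by
  have h1 : (-1 : ℝ) < m := by rw [h]; linarith [hs.1, hs'.2]
  have h2 : (m : ℝ) < 1 := by rw [h]; linarith [hs.2, hs'.1]
  have h1' : -1 < m := by exact_mod_cast h1
  have h2' : m < 1 := by exact_mod_cast h2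
  omega

/-- Zeros of f are lattice points, so the coordinates of x and y differ by integers (in the strip
this concerns the coordinate in [0,1), and the other one agrees). Both coordinates lie in [0,1), so
the integers are zero. -/
theorem Regime.IsFundamental.eq_of_f_sub_eq_zero {R : Regime} {D : Set ℂ} (h : R.IsFundamental D)
    {x y : ℂ} (hx : x ∈ D) (hy : y ∈ D) (h0 : R.f (x - y) = 0) : x = y := by
  cases R with
  | elliptic τ =>
    obtain ⟨z₀, ω₁, ω₂, hω, rfl⟩ := h
    obtain ⟨s, hs, t, ht, rfl⟩ := hx
    obtain ⟨s', hs', t', ht', rfl⟩ := hy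
    obtain ⟨m, n, hmn⟩ := mem_lattice_of_theta_eq_zero τ.im_pos h0
    have hmem : (m + n * τ : ℂ) ∈ AddSubgroup.closure {ω₁, ω₂} := by
      rw [hω, AddSubgroup.mem_closure_pair]
      exact ⟨m, n, by simp⟩
    obtain ⟨k, l, hkl⟩ := AddSubgroup.mem_closure_pair.1 hmem
    have h1 : (1 : ℂ) ∈ AddSubgroup.closure {ω₁, ω₂} := by
      rw [hω]; exact AddSubgroup.subset_closure (by simp)
    have h2 : (τ : ℂ) ∈ AddSubgroup.closure {ω₁, ω₂} := by
      rw [hω]; exact AddSubgroup.subset_closure (by simp)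
    obtain ⟨a, b, hab⟩ := AddSubgroup.mem_closure_pair.1 h1
    obtain ⟨c, d, hcd⟩ := AddSubgroup.mem_closure_pair.1 h2
    simp only [zsmul_eq_mul] at hab hcd hkl
    have hτ := τ.im_pos
    have r1 := congrArg Complex.re hab
    have i1 := congrArg Complex.im hab
    have i2 := congrArg Complex.im hcd
    have r2 := congrArg Complex.re hcd
    simp at r1 i1 i2 r2
    -- Integer combinations of ω₁ and ω₂ give 1 and τ, which are linearly independent over the
    -- reals; hence so are ω₁ and ω₂.
    have hdet : ω₁.re * ω₂.im - ω₁.im * ω₂.re ≠ 0 := by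
      intro hdet
      have : (a * ω₁.re + b * ω₂.re) * (c * ω₁.im + d * ω₂.im) -
        (a * ω₁.im + b * ω₂.im) * (c * ω₁.re + d * ω₂.re) = (a * d - b * c) *
          (ω₁.re * ω₂.im - ω₁.im * ω₂.re) := by ring
      rw [r1, i1, i2, hdet] at this
      simp at this
      exact hτ.ne' this
    have heq := hmn.trans hkl.symm
    have re := congrArg Complex.re heq
    have im := congrArg Complex.im heq
    simp at re im
    have hA : (s - s' - k) * (ω₁.re * ω₂.im - ω₁.im * ω₂.re) = 0 := by
      linear_combination ω₂.im * re - ω₂.re * im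
    have hB : (t - t' - l) * (ω₁.re * ω₂.im - ω₁.im * ω₂.re) = 0 := by
      linear_combination ω₁.re * im - ω₁.im * re
    have hA' := (mul_eq_zero.1 hA).resolve_right hdet
    have hB' := (mul_eq_zero.1 hB).resolve_right hdet
    have hk := int_eq_zero_of_eq_sub hs hs' (m := k) (by linarith)
    have hl := int_eq_zero_of_eq_sub ht ht' (m := l) (by linarith)
    rw [hk, Int.cast_zero] at hA'
    rw [hl, Int.cast_zero] at hB'
    rw [show s = s' by linarith, show t = t' by linarith]
  | trigonometric =>
    obtain ⟨z₀, ω, hω, rfl⟩ := h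
    obtain ⟨s, hs, t, rfl⟩ := hx
    obtain ⟨s', hs', t', rfl⟩ := hy
    obtain ⟨k, hk⟩ := Complex.sin_eq_zero_iff.1 h0
    have hk' : (z₀ + s + t * ω - (z₀ + s' + t' * ω) : ℂ) = k := by
      have hpi : (Real.pi : ℂ) ≠ 0 := by exact_mod_cast Real.pi_ne_zero
      exact mul_left_cancel₀ hpi (by linear_combination hk)
    have re := congrArg Complex.re hk'
    have im := congrArg Complex.im hk'
    simp at re im
    have ht : t = t' := by
      have : (t - t') * ω.im = 0 := by linarith
      linarith [(mul_eq_zero.1 this).resolve_right hω]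
    subst ht
    have hk0 := int_eq_zero_of_eq_sub hs hs' (m := k) (by linarith)
    rw [hk0, Int.cast_zero] at re
    rw [show s = s' by linarith]

/-! ### Zeros of a function with the three-term identity -/

section SigmaLike
variable {f : ℂ → ℂ}

theorem SigmaLike.zero (hf : SigmaLike f) : f 0 = 0 := by
  have := hf.odd 0
  rw [neg_zero] at this
  exact self_eq_neg.1 this

theorem SigmaLike.sub_comm (hf : SigmaLike f) (x y : ℂ) : f (x - y) = -f (y - x) := by
  rw [← hf.odd, neg_sub]

theorem SigmaLike.exists_ne_zero (hf : SigmaLike f) : ∃ x, f x ≠ 0 := by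
  by_contra! h
  refine hf.deriv_zero ?_
  rw [show f = fun _ => 0 from funext h]
  simp

theorem SigmaLike.eventually_ne (hf : SigmaLike f) (a : ℂ) :
    ∀ᶠ x in nhdsWithin a {a}ᶜ, f x ≠ 0 :=
  eventually_ne_zero_of_entire hf.diff hf.exists_ne_zero a

theorem SigmaLike.continuous (hf : SigmaLike f) : Continuous f := hf.diff.continuous

/-- The consequence of the three-term identity at a zero `s`. -/
theorem SigmaLike.zero_relation (hf : SigmaLike f) {s : ℂ} (hs : f s = 0) (w y : ℂ) :
    deriv f 0 * f (2 * w) * (f (y + s - w) * f (y - s + w)) =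
      deriv f s * f (2 * w - s) * (f (y + w) * f (y - w)) := by
  -- Put z = s - w in the three-term identity: the first product drops out because f(z+w) = f(s) =
  -- 0. The other two are compared through their derivatives in x at x = w.
  have h1 : HasDerivAt (fun x => f (x + w) * f (x - w) * (f (y + (s - w)) * f (y - (s - w))))
      ((deriv f (w + w) * f (w - w) + f (w + w) * deriv f (w - w)) *
        (f (y + (s - w)) * f (y - (s - w)))) w :=
    (((hf.diff _).hasDerivAt.comp_add_const w w).mul
      ((hf.diff _).hasDerivAt.comp_sub_const w w)).mul_const _
  have h2 : HasDerivAt (fun x => f (x + (s - w)) * f (x - (s - w)) * (f (y + w) * f (y - w)))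
      ((deriv f (w + (s - w)) * f (w - (s - w)) + f (w + (s - w)) * deriv f (w - (s - w))) *
        (f (y + w) * f (y - w))) w :=
    (((hf.diff _).hasDerivAt.comp_add_const w (s - w)).mul
      ((hf.diff _).hasDerivAt.comp_sub_const w (s - w))).mul_const _
  have e : (fun x => f (x + w) * f (x - w) * (f (y + (s - w)) * f (y - (s - w)))) =
      fun x => f (x + (s - w)) * f (x - (s - w)) * (f (y + w) * f (y - w)) := by
    funext x
    have := hf.three_term x y (s - w) w
    rw [sub_add_cancel, hs, zero_mul, mul_zero] at this
    linear_combination this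
  rw [e] at h1
  have := h1.unique h2
  rw [sub_self, hf.zero, add_sub_cancel, hs] at this
  rw [show 2 * w = w + w by ring, show y + s - w = y + (s - w) by ring,
    show y - s + w = y - (s - w) by ring, show w + w - s = w - (s - w) by ring]
  linear_combination this

theorem SigmaLike.exists_ne_zero_add_sub (hf : SigmaLike f) (a b : ℂ) :
    ∃ y, f (y + a) * f (y + b) ≠ 0 := by
  obtain ⟨c, hc⟩ := hf.exists_ne_zero
  have e1 := eventually_ne_zero_of_entire (f := fun y => f (y + a))
    (hf.diff.comp (f := fun y => y + a) (by fun_prop)) ⟨c - a, by simpa using hc⟩ 0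
  have e2 := eventually_ne_zero_of_entire (f := fun y => f (y + b))
    (hf.diff.comp (f := fun y => y + b) (by fun_prop)) ⟨c - b, by simpa using hc⟩ 0
  obtain ⟨y, hy1, hy2⟩ := (e1.and e2).exists
  exact ⟨y, mul_ne_zero hy1 hy2⟩

/-- Otherwise the right side of `zero_relation` vanishes for all w and y, while the left side does
not. -/
theorem SigmaLike.deriv_ne_zero (hf : SigmaLike f) {s : ℂ} (hs : f s = 0) : deriv f s ≠ 0 := by
  intro h0
  obtain ⟨a, ha⟩ := hf.exists_ne_zero
  obtain ⟨y, hy⟩ := hf.exists_ne_zero_add_sub (s - a / 2) (-s + a / 2)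
  have := hf.zero_relation hs (a / 2) y
  rw [mul_div_cancel₀ _ two_ne_zero, h0, zero_mul, zero_mul, add_sub_assoc,
    sub_add, sub_eq_add_neg y, neg_sub, ← neg_add_eq_sub s (a / 2)] at this
  exact mul_ne_zero (mul_ne_zero hf.deriv_zero ha) hy this

/-- With 2w = t the left side of `zero_relation` vanishes, and on the right only f(t-s) can be zero
for suitable y. Thus all zeros are simple and closed under differences without any reference to
periods. -/
theorem SigmaLike.sub_eq_zero (hf : SigmaLike f) {s t : ℂ} (hs : f s = 0) (ht : f t = 0) :
    f (t - s) = 0 := by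
  obtain ⟨y, hy⟩ := hf.exists_ne_zero_add_sub (t / 2) (-(t / 2))
  have := hf.zero_relation hs (t / 2) y
  rw [mul_div_cancel₀ _ two_ne_zero, ht, mul_zero, zero_mul] at this
  have h := mul_eq_zero.1 this.symm
  rw [← sub_eq_add_neg] at hy
  exact (mul_eq_zero.1 (h.resolve_right hy)).resolve_left (hf.deriv_ne_zero hs)

end SigmaLike
end EllipticIRF

/-! ### Contours, winding numbers and Cauchy's theorem -/

namespace EllipticIRF
open Complex Filter MeasureTheory

namespace Contour
variable (γ : Contour)

theorem exists_piece {k : ℕ} {t : Fin (k + 1) → ℝ} (h0 : t 0 = 0) (h1 : t (Fin.last k) = 1)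
    {x : ℝ} (hx : x ∈ Set.Icc (0 : ℝ) 1) : ∃ i : Fin k, x ∈ Set.Icc (t i.castSucc) (t i.succ) := by
  by_contra! h
  have key : ∀ j : Fin (k + 1), t j ≤ x := by
    intro j
    induction j using Fin.induction with
    | zero => rw [h0]; exact hx.1
    | succ i ih =>
      by_contra! hlt
      exact h i ⟨ih, hlt.le⟩
  cases k with
  | zero =>
    have : (0 : ℝ) = 1 := h0.symm.trans h1
    exact zero_ne_one this
  | succ k =>
    refine h (Fin.last k) ⟨key _, ?_⟩
    rw [Fin.succ_last, h1]
    exact hx.2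

theorem continuousOn_toFun : ContinuousOn γ.toFun (Set.Icc 0 1) := by
  obtain ⟨k, t, -, h0, h1, hC⟩ := γ.piecewise_C1
  have := (locallyFinite_of_finite fun i : Fin k =>
    Set.Icc (t i.castSucc) (t i.succ)).continuousOn_iUnion (fun i => isClosed_Icc)
    (fun i => (hC i).continuousOn)
  refine this.mono fun x hx => ?_
  exact Set.mem_iUnion.2 (exists_piece h0 h1 hx)

theorem exists_finite_hasDerivAt : ∃ s : Set ℝ, s.Finite ∧
    ∀ x ∈ Set.Ioo (0 : ℝ) 1 \ s, HasDerivAt γ.toFun (deriv γ.toFun x) x := by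
  obtain ⟨k, t, -, h0, h1, hC⟩ := γ.piecewise_C1
  refine ⟨Set.range t, Set.finite_range t, ?_⟩
  rintro x ⟨hx, hxt⟩
  obtain ⟨i, hi⟩ := exists_piece h0 h1 ⟨hx.1.le, hx.2.le⟩
  have hi1 : t i.castSucc < x := lt_of_le_of_ne hi.1 fun h => hxt ⟨_, h⟩
  have hi2 : x < t i.succ := lt_of_le_of_ne hi.2 fun h => hxt ⟨_, h.symm⟩
  exact (((hC i).differentiableOn one_ne_zero).differentiableAt
    (Icc_mem_nhds hi1 hi2)).hasDerivAt

theorem integrableOn_deriv : IntegrableOn (deriv γ.toFun) (Set.Icc 0 1) := by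
  obtain ⟨k, t, hmono, h0, h1, hC⟩ := γ.piecewise_C1
  have : IntegrableOn (deriv γ.toFun) (⋃ i : Fin k, Set.Icc (t i.castSucc) (t i.succ)) := by
    refine integrableOn_finite_iUnion.2 fun i => ?_
    rcases (hmono (Fin.castSucc_lt_succ (i := i)).le).eq_or_lt with h | h
    · rw [h, Set.Icc_self]
      simp
    · rw [integrableOn_Icc_iff_integrableOn_Ioo]
      have hc := ((hC i).continuousOn_derivWithin (uniqueDiffOn_Icc h) le_rfl).integrableOn_Icc
        (μ := volume)
      refine (hc.mono_set Set.Ioo_subset_Icc_self).congr_fun (fun x hx => ?_) measurableSet_Ioo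
      exact derivWithin_of_mem_nhds (Icc_mem_nhds hx.1 hx.2)
  refine this.mono_set fun x hx => ?_
  exact Set.mem_iUnion.2 (exists_piece h0 h1 hx)

theorem intervalIntegrable_deriv : IntervalIntegrable (deriv γ.toFun) volume 0 1 :=
  (intervalIntegrable_iff_integrableOn_Icc_of_le zero_le_one).2 γ.integrableOn_deriv

theorem isCompact_trace : IsCompact γ.trace := isCompact_Icc.image_of_continuousOn γ.continuousOn_toFun

theorem mem_trace {t : ℝ} (ht : t ∈ Set.Icc (0 : ℝ) 1) : γ.toFun t ∈ γ.trace := ⟨t, ht, rfl⟩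

theorem nonempty_trace : γ.trace.Nonempty := ⟨_, γ.mem_trace ⟨le_rfl, zero_le_one⟩⟩

theorem isPreconnected_trace : IsPreconnected γ.trace :=
  isPreconnected_Icc.image _ γ.continuousOn_toFun

variable {γ}

theorem intervalIntegrable {F : ℂ → ℂ} (hF : ContinuousOn F γ.trace) :
    IntervalIntegrable (fun t => F (γ.toFun t) * deriv γ.toFun t) volume 0 1 := by
  refine γ.intervalIntegrable_deriv.continuousOn_mul ?_
  rw [Set.uIcc_of_le zero_le_one]
  exact hF.comp γ.continuousOn_toFun fun t ht => γ.mem_trace ht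

theorem integral_congr {F G : ℂ → ℂ} (h : ∀ u ∈ γ.trace, F u = G u) :
    contourIntegral γ.toFun F = contourIntegral γ.toFun G := by
  refine intervalIntegral.integral_congr fun t ht => ?_
  rw [Set.uIcc_of_le zero_le_one] at ht
  simp only [h _ (γ.mem_trace ht)]

theorem integral_const_mul (c : ℂ) (F : ℂ → ℂ) :
    contourIntegral γ.toFun (fun u => c * F u) = c * contourIntegral γ.toFun F := by
  simp only [contourIntegral, mul_assoc, intervalIntegral.integral_const_mul]

theorem integral_zero : contourIntegral γ.toFun (fun _ => 0) = 0 := by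
  simp [contourIntegral]

theorem integral_sum {ι : Type*} (s : Finset ι) {F : ι → ℂ → ℂ}
    (h : ∀ i ∈ s, ContinuousOn (F i) γ.trace) :
    contourIntegral γ.toFun (fun u => ∑ i ∈ s, F i u) =
      ∑ i ∈ s, contourIntegral γ.toFun (F i) := by
  simp only [contourIntegral, Finset.sum_mul]
  exact intervalIntegral.integral_finsetSum fun i hi => intervalIntegrable (h i hi)

theorem integral_add {F G : ℂ → ℂ} (hF : ContinuousOn F γ.trace) (hG : ContinuousOn G γ.trace) :
    contourIntegral γ.toFun (fun u => F u + G u) =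
      contourIntegral γ.toFun F + contourIntegral γ.toFun G := by
  simp only [contourIntegral, add_mul]
  exact intervalIntegral.integral_add (intervalIntegrable hF) (intervalIntegrable hG)

theorem integral_sub {F G : ℂ → ℂ} (hF : ContinuousOn F γ.trace) (hG : ContinuousOn G γ.trace) :
    contourIntegral γ.toFun (fun u => F u - G u) =
      contourIntegral γ.toFun F - contourIntegral γ.toFun G := by
  simp only [contourIntegral, sub_mul]
  exact intervalIntegral.integral_sub (intervalIntegrable hF) (intervalIntegrable hG)

/-- The trace is compact, so F(x,·) tends to F(x₀,·) uniformly on it, and γ' is integrable. -/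
theorem continuousOn_integral {X : Type*} [TopologicalSpace X] {S : Set X} {F : X → ℂ → ℂ}
    (hF : ContinuousOn (Function.uncurry F) (S ×ˢ γ.trace)) :
    ContinuousOn (fun x => contourIntegral γ.toFun (F x)) S := by
  intro x₀ hx₀
  rw [ContinuousWithinAt, Metric.tendsto_nhds]
  intro ε hε
  set C := ∫ t in (0 : ℝ)..1, ‖deriv γ.toFun t‖ with hC
  have hC0 : 0 ≤ C := intervalIntegral.integral_nonneg zero_le_one fun _ _ => norm_nonneg _
  obtain ⟨δ, hδ, hδC⟩ : ∃ δ > 0, δ * C < ε := by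
    refine ⟨ε / (C + 1), by positivity, ?_⟩
    rw [div_mul_eq_mul_div, div_lt_iff₀ (by positivity)]
    nlinarith
  obtain ⟨v, hv, hvU⟩ := γ.isCompact_trace.mem_uniformity_of_prod hF hx₀ (Metric.dist_mem_uniformity hδ)
  have hcont : ∀ x ∈ S, ContinuousOn (F x) γ.trace := fun x hx =>
    hF.comp (f := fun u => (x, u)) (by fun_prop) fun u hu => ⟨hx, hu⟩
  filter_upwards [hv, self_mem_nhdsWithin] with x hxv hxS
  rw [dist_eq_norm, ← integral_sub (hcont x hxS) (hcont x₀ hx₀)]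
  refine lt_of_le_of_lt (intervalIntegral.norm_integral_le_integral_norm zero_le_one) ?_
  refine lt_of_le_of_lt ?_ hδC
  rw [hC, ← intervalIntegral.integral_const_mul]
  refine intervalIntegral.integral_mono_on zero_le_one ?_ ?_ fun t ht => ?_
  · exact (intervalIntegrable ((hcont x hxS).sub (hcont x₀ hx₀))).norm
  · exact γ.intervalIntegrable_deriv.norm.const_mul δ
  · rw [norm_mul]
    gcongr
    have := hvU x hxv _ (γ.mem_trace ht)
    rw [Set.mem_ofPred_eq, dist_eq_norm] at this
    exact this.le

/-- Fubini: the integrand is a bounded continuous function times the integrable product of the two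
derivatives. -/
theorem integral_swap {γ δ : Contour} {F : ℂ → ℂ → ℂ}
    (hF : ContinuousOn (Function.uncurry F) (γ.trace ×ˢ δ.trace)) :
    contourIntegral γ.toFun (fun u => contourIntegral δ.toFun fun w => F u w) =
      contourIntegral δ.toFun (fun w => contourIntegral γ.toFun fun u => F u w) := by
  simp only [contourIntegral, intervalIntegral.integral_of_le (zero_le_one (α := ℝ)),
    ← MeasureTheory.integral_mul_const]
  have hsub : Set.Ioc (0 : ℝ) 1 ×ˢ Set.Ioc (0 : ℝ) 1 ⊆ Set.Icc 0 1 ×ˢ Set.Icc 0 1 :=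
    Set.prod_mono Set.Ioc_subset_Icc_self Set.Ioc_subset_Icc_self
  have hF' : ContinuousOn (fun p : ℝ × ℝ => F (γ.toFun p.1) (δ.toFun p.2))
      (Set.Icc 0 1 ×ˢ Set.Icc 0 1) := by
    refine hF.comp (f := fun p : ℝ × ℝ => (γ.toFun p.1, δ.toFun p.2)) ?_ ?_
    · exact (γ.continuousOn_toFun.comp continuousOn_fst fun p hp => hp.1).prodMk
        (δ.continuousOn_toFun.comp continuousOn_snd fun p hp => hp.2)
    · exact fun p hp => ⟨γ.mem_trace hp.1, δ.mem_trace hp.2⟩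
  obtain ⟨C, hC⟩ := (isCompact_Icc.prod isCompact_Icc).exists_bound_of_continuousOn hF'
  have hint : Integrable (Function.uncurry fun s t : ℝ =>
      F (γ.toFun s) (δ.toFun t) * (deriv δ.toFun t * deriv γ.toFun s))
      ((volume.restrict (Set.Ioc 0 1)).prod (volume.restrict (Set.Ioc 0 1))) := by
    have h1 := Integrable.mul_prod (γ.integrableOn_deriv.mono_set Set.Ioc_subset_Icc_self)
      (δ.integrableOn_deriv.mono_set Set.Ioc_subset_Icc_self)
    have h2 := h1.bdd_mul (f := fun p : ℝ × ℝ => F (γ.toFun p.1) (δ.toFun p.2)) (c := C) ?_ ?_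
    · refine h2.congr (.of_forall fun p => ?_)
      simp only [Function.uncurry]
      ring
    · rw [Measure.prod_restrict]
      exact (hF'.mono hsub).aestronglyMeasurable (measurableSet_Ioc.prod measurableSet_Ioc)
    · rw [Measure.prod_restrict]
      refine (ae_restrict_iff' (measurableSet_Ioc.prod measurableSet_Ioc)).2 (.of_forall fun p hp => ?_)
      exact hC p (hsub hp)
  have := MeasureTheory.integral_integral_swap hint
  simp only [← mul_assoc] at this ⊢
  rw [this]
  simp only [mul_right_comm]

/-- A function with a primitive along the contour has vanishing integral. -/
theorem integral_eq_zero_of_hasDerivWithinAt {E : Set ℂ} (hE : γ.trace ⊆ E) {F Φ : ℂ → ℂ}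
    (hF : ContinuousOn F γ.trace) (hΦ : ∀ u ∈ E, HasDerivWithinAt Φ (F u) E u) :
    contourIntegral γ.toFun F = 0 := by
  obtain ⟨s, hs, hd⟩ := γ.exists_finite_hasDerivAt
  have := MeasureTheory.integral_eq_of_hasDerivAt_off_countable_of_le
    (fun t => Φ (γ.toFun t)) (fun t => F (γ.toFun t) * deriv γ.toFun t) zero_le_one hs.countable
    ?_ ?_ (intervalIntegrable hF)
  · rw [contourIntegral, this, γ.closed, sub_self]
  · have hΦc : ContinuousOn Φ E := fun u hu => (hΦ u hu).continuousWithinAt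
    exact hΦc.comp γ.continuousOn_toFun fun t ht => hE (γ.mem_trace ht)
  · intro t ht
    have htI : t ∈ Set.Icc (0 : ℝ) 1 := ⟨ht.1.1.le, ht.1.2.le⟩
    refine (hΦ _ (hE (γ.mem_trace htI))).comp_hasDerivAt t (hd t ht) ?_
    filter_upwards [Icc_mem_nhds ht.1.1 ht.1.2] with x hx
    exact hE (γ.mem_trace hx)

/-- Cauchy's theorem in a convex set. -/
theorem integral_eq_zero_of_analyticOnNhd {D : Set ℂ} (hD : Convex ℝ D) (hγ : γ.trace ⊆ D)
    {G : ℂ → ℂ} (hG : AnalyticOnNhd ℂ G D) : contourIntegral γ.toFun G = 0 := by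
  have hG' : ∀ x ∈ D, HasFDerivWithinAt
      (fun x => ContinuousLinearMap.toSpanSingleton ℂ (G x))
      ((((ContinuousLinearMap.toSpanSingleton ℂ
        (ContinuousLinearMap.toSpanSingleton ℂ (deriv G x))) : ℂ →L[ℂ] ℂ →L[ℂ] ℂ)).restrictScalars ℝ)
      D x := by
    intro x hx
    have h1 := (hG x hx).differentiableAt.hasDerivAt
    have h2 : HasDerivAt (fun x => ContinuousLinearMap.toSpanSingleton ℂ (G x))
        (ContinuousLinearMap.toSpanSingleton ℂ (deriv G x)) x := by
      have h3 := h1.smul_const (ContinuousLinearMap.id ℂ ℂ)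
      refine (h3.congr_deriv ?_).congr_of_eventuallyEq (.of_forall fun y => ?_)
      · ext; simp
      · ext; simp
    exact (h2.hasFDerivAt.restrictScalars ℝ).hasFDerivWithinAt
  -- The form G du is closed because its derivative is complex linear. As D is convex but possibly
  -- not open, the primitive is differentiable only within D.
  obtain ⟨Φ, hΦ⟩ := hD.exists_forall_hasFDerivWithinAt_of_hasFDerivWithinAt_symmetric hG' (by
    intro a _ x _ y _
    simp [mul_left_comm])
  refine integral_eq_zero_of_hasDerivWithinAt hγ (hG.continuousOn.mono hγ) (Φ := Φ) fun u hu => ?_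
  have := (hΦ u hu).hasDerivWithinAt
  simpa using this

theorem integral_one_div_sub {w : ℂ} : contourIntegral γ.toFun (fun u => 1 / (u - w)) =
    2 * Real.pi * I * winding γ.toFun w := by
  rw [winding, mul_inv_cancel_left₀ Complex.two_pi_I_ne_zero]

/-- For w outside C the function 1/(u-w) is analytic on C, so Cauchy's theorem gives winding number
zero. -/
theorem mem_outside_of_convex {C : Set ℂ} (hC : Convex ℝ C) (hγ : γ.trace ⊆ C) {w : ℂ}
    (hw : w ∉ C) : w ∈ γ.outside := by
  refine ⟨fun h => hw (hγ h), ?_⟩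
  rw [winding, integral_eq_zero_of_analyticOnNhd hC hγ, mul_zero]
  intro u hu
  have : u - w ≠ 0 := sub_ne_zero.2 fun h => hw (h ▸ hu)
  fun_prop (disch := assumption)

theorem continuousOn_winding : ContinuousOn (winding γ.toFun) γ.traceᶜ := by
  refine continuousOn_const.mul (continuousOn_integral ?_)
  refine ContinuousOn.div continuousOn_const (by fun_prop) ?_
  rintro ⟨w, u⟩ ⟨hw, hu⟩
  exact sub_ne_zero.2 fun h => hw (h ▸ hu)

/-- The winding number is continuous off the trace and takes only the values 0 and 1 there, so the
inside is where it is nonzero. -/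
theorem isOpen_inside : IsOpen γ.inside := by
  have h := continuousOn_winding (γ := γ).isOpen_inter_preimage γ.isCompact_trace.isClosed.isOpen_compl
    (isOpen_compl_singleton (x := (0 : ℂ)))
  convert h using 1
  ext w
  simp only [inside, Set.mem_ofPred_eq, Set.mem_inter_iff, Set.mem_compl_iff, Set.mem_preimage,
    Set.mem_singleton_iff]
  refine and_congr_right fun hw => ⟨fun h => by rw [h]; exact one_ne_zero, fun h => ?_⟩
  exact (γ.positive w hw).resolve_left h

theorem isOpen_outside : IsOpen γ.outside := by
  have h := continuousOn_winding (γ := γ).isOpen_inter_preimage γ.isCompact_trace.isClosed.isOpen_compl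
    (isOpen_compl_singleton (x := (1 : ℂ)))
  convert h using 1
  ext w
  simp only [outside, Set.mem_ofPred_eq, Set.mem_inter_iff, Set.mem_compl_iff, Set.mem_preimage,
    Set.mem_singleton_iff]
  refine and_congr_right fun hw => ⟨fun h => by rw [h]; exact zero_ne_one, fun h => ?_⟩
  exact (γ.positive w hw).resolve_right h

theorem disjoint_inside_outside : Disjoint γ.inside γ.outside := by
  rw [Set.disjoint_left]
  rintro w ⟨-, h1⟩ ⟨-, h0⟩
  exact one_ne_zero (h1.symm.trans h0)

theorem mem_outside_of_notMem {w : ℂ} (h1 : w ∉ γ.inside) (h2 : w ∉ γ.trace) : w ∈ γ.outside :=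
  ⟨h2, (γ.positive w h2).resolve_right fun h => h1 ⟨h2, h⟩⟩

theorem subset_inside_of_isPreconnected {S : Set ℂ} (hS : IsPreconnected S)
    (hd : ∀ w ∈ S, w ∉ γ.trace) {x : ℂ} (hx : x ∈ S) (hxi : x ∈ γ.inside) : S ⊆ γ.inside := by
  refine IsPreconnected.subset_left_of_subset_union isOpen_inside isOpen_outside
    disjoint_inside_outside (fun w hw => ?_) ⟨x, hx, hxi⟩ hS
  by_cases h : w ∈ γ.inside
  · exact Or.inl h
  · exact Or.inr (mem_outside_of_notMem h (hd w hw))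

theorem inside_subset_of_convex {C : Set ℂ} (hC : Convex ℝ C) (hγ : γ.trace ⊆ C) :
    γ.inside ⊆ C := by
  intro w hw
  by_contra h
  exact Set.disjoint_left.1 disjoint_inside_outside hw (mem_outside_of_convex hC hγ h)

/-- A point of maximal modulus cannot be inside a contour. -/
theorem notMem_inside_of_forall_norm_le {x : ℂ} (h : ∀ y ∈ γ.trace, ‖y‖ ≤ ‖x‖) : x ∉ γ.inside := by
  intro hx
  -- The open half-plane bounded by the tangent at x to the circle of radius |x|. It contains the
  -- trace but not x.
  have hC : Convex ℝ {y : ℂ | x.re * y.re + x.im * y.im < x.re ^ 2 + x.im ^ 2} := by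
    refine convex_halfSpace_lt (f := fun y : ℂ => x.re * y.re + x.im * y.im) ⟨?_, ?_⟩ _
    · intro a b; simp; ring
    · intro c a; simp; ring
  refine absurd (inside_subset_of_convex hC (fun y hy => ?_) hx) ?_
  · have hne : y ≠ x := fun e => hx.1 (e ▸ hy)
    have h1 := h y hy
    have h2 : ‖y‖ ^ 2 ≤ ‖x‖ ^ 2 := by gcongr
    rw [Complex.sq_norm, Complex.sq_norm, Complex.normSq_apply, Complex.normSq_apply] at h2
    have h3 : 0 < Complex.normSq (y - x) := Complex.normSq_pos.2 (sub_ne_zero.2 hne)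
    rw [Complex.normSq_apply, Complex.sub_re, Complex.sub_im] at h3
    rw [Set.mem_ofPred_eq]
    nlinarith
  · rw [Set.mem_ofPred_eq]
    nlinarith

/-- If the contour `δ` lies inside `γ` then so do all points inside `δ`. -/
theorem inside_subset_inside {γ δ : Contour} (h : δ.trace ⊆ γ.inside) : δ.inside ⊆ γ.inside := by
  intro w hw
  by_contra hcon
  -- Let w be inside δ but not inside γ, and b a point of δ nearest to w. The segment from w to b
  -- meets δ only at b.
  obtain ⟨b, hb, hbd⟩ := δ.isCompact_trace.exists_infDist_eq_dist δ.nonempty_trace w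
  have hseg : ∀ x ∈ segment ℝ w b, x ∈ δ.trace → x = b := by
    rintro x ⟨s, t, hs, ht, hst, rfl⟩ hx
    have h1 : dist w b ≤ dist w (s • w + t • b) := hbd ▸ Metric.infDist_le_dist_of_mem hx
    have h2 : w - (s • w + t • b) = t • (w - b) := by
      have : (s : ℂ) + t = 1 := by exact_mod_cast hst
      simp only [Complex.real_smul]
      linear_combination -w * this
    rw [dist_eq_norm, dist_eq_norm, h2, norm_smul, Real.norm_of_nonneg ht] at h1
    have h3 : 0 < ‖w - b‖ := norm_pos_iff.2 (sub_ne_zero.2 fun e => hw.1 (e ▸ hb))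
    have h4 : 1 ≤ t := by
      by_contra! hlt
      nlinarith
    have ht1 : t = 1 := by linarith
    have hs0 : s = 0 := by linarith
    simp [ht1, hs0]
  -- As b is inside γ and w is not, the segment crosses γ, at a point that can still be reached from
  -- w without meeting δ.
  obtain ⟨x, hx, hxγ⟩ : ∃ x ∈ segment ℝ w b, x ∈ γ.trace := by
    by_contra! hno
    exact hcon (subset_inside_of_isPreconnected (convex_segment w b).isPreconnected hno
      (right_mem_segment ℝ w b) (h hb) (left_mem_segment ℝ w b))
  have hxb : x ≠ b := fun e => (h hb).1 (e ▸ hxγ)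
  have hxδ : x ∈ δ.inside := by
    refine subset_inside_of_isPreconnected (convex_segment w x).isPreconnected (fun y hy hyδ => ?_)
      (left_mem_segment ℝ w x) hw (right_mem_segment ℝ w x)
    have hy' : y ∈ segment ℝ w b :=
      (convex_segment w b).segment_subset (left_mem_segment ℝ w b) hx hy
    have hyb := hseg y hy' hyδ
    subst hyb
    obtain ⟨s, t, hs, ht, hst, rfl⟩ := hx
    obtain ⟨s', t', hs', ht', hst', he⟩ := hy
    have hw0 : w ≠ y := fun e => hw.1 (e ▸ hb)
    have e1 : (s : ℂ) + t = 1 := by exact_mod_cast hst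
    have e2 : (s' : ℂ) + t' = 1 := by exact_mod_cast hst'
    simp only [Complex.real_smul] at he
    have e3 : ((t' : ℂ) * t - 1) * (y - w) = 0 := by
      linear_combination he - w * e2 - t' * w * e1
    have e4 : (t' * t : ℝ) = 1 := by
      have := (mul_eq_zero.1 e3).resolve_right (sub_ne_zero.2 hw0.symm)
      have e5 : (t' : ℂ) * t = 1 := by linear_combination this
      exact_mod_cast e5
    have ht1 : t = 1 := by nlinarith
    apply hxb
    have hs0 : s = 0 := by linarith
    simp [ht1, hs0]
  -- Now each of the two contours would lie inside the other; a point of largest modulus on their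
  -- union excludes this.
  have hγδ : γ.trace ⊆ δ.inside :=
    subset_inside_of_isPreconnected γ.isPreconnected_trace (fun y hy hyδ => (h hyδ).1 hy) hxγ hxδ
  obtain ⟨m, hm, hmax⟩ := (γ.isCompact_trace.union δ.isCompact_trace).exists_isMaxOn
    (γ.nonempty_trace.mono Set.subset_union_left) continuous_norm.continuousOn
  rcases hm with hm | hm
  · exact notMem_inside_of_forall_norm_le (fun y hy => hmax (Or.inr hy)) (hγδ hm)
  · exact notMem_inside_of_forall_norm_le (fun y hy => hmax (Or.inl hy)) (h hm)

/-- The translate of a contour. -/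
noncomputable def translate (γ : Contour) (a : ℂ) : Contour where
  toFun t := γ.toFun t + a
  piecewise_C1 := by
    obtain ⟨k, t, hm, h0, h1, hC⟩ := γ.piecewise_C1
    exact ⟨k, t, hm, h0, h1, fun i => (hC i).add contDiffOn_const⟩
  closed := by rw [γ.closed]
  simple s hs t ht h := γ.simple hs ht (add_right_cancel h)
  positive w hw := by
    have : winding (fun t => γ.toFun t + a) w = winding γ.toFun (w - a) := by
      have hd : deriv (fun t => γ.toFun t + a) = deriv γ.toFun := funext fun t => deriv_add_const a
      simp only [winding, contourIntegral, hd]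
      congr 2
      funext t
      rw [show γ.toFun t + a - w = γ.toFun t - (w - a) by ring]
    rw [this]
    refine γ.positive _ fun ⟨t, ht, h⟩ => hw ⟨t, ht, ?_⟩
    simp [h]

theorem winding_translate (a w : ℂ) :
    winding (γ.translate a).toFun (w + a) = winding γ.toFun w := by
  have hd : deriv (fun t => γ.toFun t + a) = deriv γ.toFun := funext fun t => deriv_add_const a
  simp only [translate, winding, contourIntegral, hd]
  congr 2
  funext t
  rw [add_sub_add_right_eq_sub]

theorem mem_inside_translate {a w : ℂ} (hw : w ∈ γ.inside) : w + a ∈ (γ.translate a).inside := by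
  refine ⟨?_, (winding_translate a w).trans hw.2⟩
  rintro ⟨t, ht, h⟩
  exact hw.1 ⟨t, ht, add_right_cancel h⟩

/-- The closed region bounded by a contour. -/
def closedRegion (γ : Contour) : Set ℂ := γ.inside ∪ γ.trace

theorem mem_outside_iff {w : ℂ} : w ∈ γ.outside ↔ w ∉ γ.closedRegion := by
  constructor
  · rintro hw (h | h)
    · exact Set.disjoint_left.1 disjoint_inside_outside h hw
    · exact hw.1 h
  · intro h
    exact mem_outside_of_notMem (fun h' => h (Or.inl h')) fun h' => h (Or.inr h')

theorem closedRegion_subset {D : Set ℂ} (hD : Convex ℝ D) (hγ : γ.trace ⊆ D) :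
    γ.closedRegion ⊆ D :=
  Set.union_subset (inside_subset_of_convex hD hγ) hγ

/-- The contour `γ` includes `δ` and `δ + h`, together with all points inside. -/
def Nest (h : ℂ) (γ δ : Contour) : Prop :=
  ∀ u ∈ δ.closedRegion, u ∈ γ.inside ∧ u + h ∈ γ.inside

/-- A condition on the trace extends to the whole closed region by `inside_subset_inside`, applied
to δ and to its translate by h. -/
theorem nest_of_trace {h : ℂ} {γ δ : Contour}
    (H : ∀ u ∈ δ.trace, u ∈ γ.inside ∧ u + h ∈ γ.inside) : Nest h γ δ := by
  rintro u (hu | hu)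
  · refine ⟨inside_subset_inside (fun u hu => (H u hu).1) hu, ?_⟩
    refine inside_subset_inside (δ := δ.translate h) ?_ (mem_inside_translate hu)
    rintro _ ⟨t, ht, rfl⟩
    exact (H _ (δ.mem_trace ht)).2
  · exact H u hu

theorem Nest.trans {h : ℂ} {γ δ ε : Contour} (h1 : Nest h γ δ) (h2 : Nest h δ ε) : Nest h γ ε :=
  fun u hu => ⟨(h1 u (Or.inl (h2 u hu).1)).1, (h1 _ (Or.inl (h2 u hu).1)).2⟩

end Contour

/-! ### Contour deformation for functions with finitely many poles -/

theorem AnalyticAt.dslope {G : ℂ → ℂ} {a b : ℂ} (ha : AnalyticAt ℂ G a) (hb : AnalyticAt ℂ G b) :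
    AnalyticAt ℂ (dslope G a) b := by
  by_cases h : b = a
  · subst h
    obtain ⟨p, hp⟩ := hb
    exact ⟨_, hp.has_fpower_series_dslope_fslope⟩
  · have h1 : AnalyticAt ℂ (fun u => (u - a)⁻¹ * (G u - G a)) b :=
      ((analyticAt_id.sub analyticAt_const).inv (sub_ne_zero.2 h)).mul (hb.sub analyticAt_const)
    refine h1.congr ?_
    filter_upwards [isOpen_ne.mem_nhds h] with u hu
    rw [dslope_of_ne _ hu, slope_def_field, div_eq_inv_mul]

theorem sub_mul_dslope (G : ℂ → ℂ) (a u : ℂ) : G u = G a + (u - a) * dslope G a u := by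
  have := sub_smul_dslope G a u
  rw [smul_eq_mul] at this
  rw [this]; ring

/-- The polynomial with the given roots. -/
noncomputable def rootProd (M : Multiset ℂ) (u : ℂ) : ℂ := (M.map fun s => u - s).prod

theorem rootProd_cons (s : ℂ) (M : Multiset ℂ) (u : ℂ) :
    rootProd (s ::ₘ M) u = (u - s) * rootProd M u := by simp [rootProd]

theorem rootProd_zero (u : ℂ) : rootProd 0 u = 1 := by simp [rootProd]

theorem rootProd_add (M N : Multiset ℂ) (u : ℂ) :
    rootProd (M + N) u = rootProd M u * rootProd N u := by simp [rootProd]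

theorem rootProd_ne_zero {M : Multiset ℂ} {u : ℂ} (h : u ∉ M) : rootProd M u ≠ 0 := by
  refine Multiset.prod_ne_zero fun h0 => ?_
  obtain ⟨s, hs, h0⟩ := Multiset.mem_map.1 h0
  exact h (by rwa [sub_eq_zero.1 h0])

theorem differentiable_rootProd (M : Multiset ℂ) : Differentiable ℂ (rootProd M) := by
  induction M using Multiset.induction with
  | empty =>
    rw [show rootProd 0 = fun _ => 1 from funext rootProd_zero]
    fun_prop
  | cons s M ih =>
    rw [show rootProd (s ::ₘ M) = fun u => (u - s) * rootProd M u from funext (rootProd_cons s M)]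
    fun_prop

theorem continuousOn_div_rootProd {G : ℂ → ℂ} {T : Set ℂ} (hG : ContinuousOn G T)
    {M : Multiset ℂ} (hM : ∀ s ∈ M, s ∉ T) : ContinuousOn (fun u => G u / rootProd M u) T :=
  hG.div (differentiable_rootProd M).continuous.continuousOn fun u hu =>
    rootProd_ne_zero fun h => hM u h hu

section Deform
variable {γ δ : Contour} {c : ℂ}

/-- Two contours are compared on the functions `1 / ∏ (u - s)`. -/
theorem integral_one_div_rootProd {D : Set ℂ} (hD : Convex ℝ D) (hγ : γ.trace ⊆ D)
    (hδ : δ.trace ⊆ D) (n : ℕ) (M : Multiset ℂ) (hn : M.card = n)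
    (hM : ∀ s ∈ M, s ∉ γ.trace ∧ s ∉ δ.trace ∧ winding γ.toFun s = c * winding δ.toFun s) :
    contourIntegral γ.toFun (fun u => 1 / rootProd M u) =
      c * contourIntegral δ.toFun fun u => 1 / rootProd M u := by
  induction n using Nat.strong_induction_on generalizing M with
  | _ n ih =>
  rcases Multiset.empty_or_exists_mem M with rfl | ⟨s, hs⟩
  · simp only [rootProd_zero]
    have h1 : AnalyticOnNhd ℂ (fun _ : ℂ => (1 / 1 : ℂ)) D := fun _ _ => analyticAt_const
    rw [Contour.integral_eq_zero_of_analyticOnNhd hD hγ h1,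
      Contour.integral_eq_zero_of_analyticOnNhd hD hδ h1, mul_zero]
  obtain ⟨M', rfl⟩ := Multiset.exists_cons_of_mem hs
  -- With a single root, a simple pole is measured by the winding number and a higher power has a
  -- primitive off the root. With two distinct roots, partial fractions lower the degree.
  by_cases hall : ∀ s' ∈ M', s' = s
  · rw [Multiset.eq_replicate_card.2 hall] at hM ⊢
    set k := M'.card
    have hprod : ∀ u, rootProd (s ::ₘ Multiset.replicate k s) u = (u - s) ^ (k + 1) := by
      intro u
      simp [rootProd, pow_succ, mul_comm]
    simp only [hprod]
    obtain ⟨h1, h2, h3⟩ := hM s (by simp)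
    rcases Nat.eq_zero_or_pos k with hk | hk
    · simp only [hk, zero_add, pow_one]
      rw [Contour.integral_one_div_sub, Contour.integral_one_div_sub, h3]
      ring
    · have key : ∀ ε : Contour, s ∉ ε.trace →
          contourIntegral ε.toFun (fun u => 1 / (u - s) ^ (k + 1)) = 0 := by
        intro ε hε
        have hne : ∀ u ∈ ε.trace, u - s ≠ 0 := fun u hu => sub_ne_zero.2 fun e => hε (e ▸ hu)
        refine Contour.integral_eq_zero_of_hasDerivWithinAt subset_rfl
          (Φ := fun u => -(1 / (k : ℂ)) * ((u - s) ^ k)⁻¹) ?_ fun u hu => ?_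
        · exact continuousOn_const.div (by fun_prop) fun u hu => pow_ne_zero _ (hne u hu)
        · have h0 := hne u hu
          have hd := (((hasDerivAt_id u).sub_const s).fun_pow k).fun_inv (pow_ne_zero k h0)
          refine ((hd.const_mul (-(1 / (k : ℂ)))).congr_deriv ?_).hasDerivWithinAt
          have hk0 : (k : ℂ) ≠ 0 := by exact_mod_cast hk.ne'
          obtain ⟨l, hl⟩ : ∃ l, k = l + 1 := ⟨k - 1, by omega⟩
          rw [hl] at hk0 ⊢
          simp only [id_eq, Nat.add_sub_cancel]
          field_simp
          ring
      rw [key γ h1, key δ h2, mul_zero]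
  · push Not at hall
    obtain ⟨s', hs', hne⟩ := hall
    obtain ⟨M'', rfl⟩ := Multiset.exists_cons_of_mem hs'
    have hA := ih (n - 1) (by rw [← hn]; simp) (s ::ₘ M'') (by rw [← hn]; simp)
      fun x hx => hM x (by simp only [Multiset.mem_cons] at hx ⊢; tauto)
    have hB := ih (n - 1) (by rw [← hn]; simp) (s' ::ₘ M'') (by rw [← hn]; simp)
      fun x hx => hM x (by simp only [Multiset.mem_cons] at hx ⊢; tauto)
    have key : ∀ ε : Contour, (∀ x ∈ s ::ₘ s' ::ₘ M'', x ∉ ε.trace) →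
        contourIntegral ε.toFun (fun u => 1 / rootProd (s ::ₘ s' ::ₘ M'') u) =
        (1 / (s - s')) * (contourIntegral ε.toFun (fun u => 1 / rootProd (s ::ₘ M'') u) -
          contourIntegral ε.toFun fun u => 1 / rootProd (s' ::ₘ M'') u) := by
      intro ε hε
      rw [← Contour.integral_sub, ← Contour.integral_const_mul]
      · refine Contour.integral_congr fun u hu => ?_
        have h1 : u - s ≠ 0 := sub_ne_zero.2 fun e => hε s (by simp) (e ▸ hu)
        have h2 : u - s' ≠ 0 := sub_ne_zero.2 fun e => hε s' (by simp) (e ▸ hu)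
        have h3 : rootProd M'' u ≠ 0 := rootProd_ne_zero fun h => hε u (by simp [h]) hu
        have h4 : s - s' ≠ 0 := sub_ne_zero.2 fun e => hne e.symm
        simp only [rootProd_cons]
        field_simp
        ring
      · exact continuousOn_div_rootProd continuousOn_const fun x hx => hε x
          (by simp only [Multiset.mem_cons] at hx ⊢; tauto)
      · exact continuousOn_div_rootProd continuousOn_const fun x hx => hε x
          (by simp only [Multiset.mem_cons] at hx ⊢; tauto)
    rw [key γ fun x hx => (hM x hx).1, key δ fun x hx => (hM x hx).2.1, hA, hB]
    ring

/-- Writing G(u) = G(s) + (u-s) · `dslope G s u` peels off one root: the first term has a constant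
numerator, and in the second the factor u-s cancels. -/
theorem integral_div_rootProd {D : Set ℂ} (hD : Convex ℝ D) (hγ : γ.trace ⊆ D)
    (hδ : δ.trace ⊆ D) (M : Multiset ℂ)
    (hM : ∀ s ∈ M, s ∉ γ.trace ∧ s ∉ δ.trace ∧ winding γ.toFun s = c * winding δ.toFun s)
    (hMD : ∀ s ∈ M, s ∈ D) {G : ℂ → ℂ} (hG : AnalyticOnNhd ℂ G D) :
    contourIntegral γ.toFun (fun u => G u / rootProd M u) =
      c * contourIntegral δ.toFun fun u => G u / rootProd M u := by
  induction M using Multiset.induction generalizing G with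
  | empty =>
    simp only [rootProd_zero, div_one]
    rw [Contour.integral_eq_zero_of_analyticOnNhd hD hγ hG,
      Contour.integral_eq_zero_of_analyticOnNhd hD hδ hG, mul_zero]
  | cons s M ih =>
    have hsD := hMD s (by simp)
    have hdG : AnalyticOnNhd ℂ (dslope G s) D := fun u hu => AnalyticAt.dslope (hG s hsD) (hG u hu)
    have key : ∀ ε : Contour, ε.trace ⊆ D → (∀ x ∈ s ::ₘ M, x ∉ ε.trace) →
        contourIntegral ε.toFun (fun u => G u / rootProd (s ::ₘ M) u) =
        G s * contourIntegral ε.toFun (fun u => 1 / rootProd (s ::ₘ M) u) +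
          contourIntegral ε.toFun fun u => dslope G s u / rootProd M u := by
      intro ε hεD hε
      rw [← Contour.integral_const_mul, ← Contour.integral_add]
      · refine Contour.integral_congr fun u hu => ?_
        have h1 : u - s ≠ 0 := sub_ne_zero.2 fun e => hε s (by simp) (e ▸ hu)
        have h3 : rootProd M u ≠ 0 := rootProd_ne_zero fun h => hε u (by simp [h]) hu
        rw [sub_mul_dslope G s u, rootProd_cons]
        field_simp
      · exact continuousOn_const.mul (continuousOn_div_rootProd continuousOn_const hε)
      · exact continuousOn_div_rootProd (hdG.continuousOn.mono hεD) fun x hx => hε x (by simp [hx])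
    rw [key γ hγ fun x hx => (hM x hx).1, key δ hδ fun x hx => (hM x hx).2.1,
      integral_one_div_rootProd hD hγ hδ _ (s ::ₘ M) rfl hM,
      ih (fun x hx => hM x (by simp [hx])) (fun x hx => hMD x (by simp [hx])) hdG]
    ring

end Deform

/-- Functions on `D` which are meromorphic with finitely many poles, all in `S`. -/
def Mer (D S : Set ℂ) (k : ℂ → ℂ) : Prop :=
  ∃ (M : Multiset ℂ) (G : ℂ → ℂ), (∀ s ∈ M, s ∈ D ∧ s ∈ S) ∧ AnalyticOnNhd ℂ G D ∧
    ∀ u ∈ D, u ∉ M → k u = G u / rootProd M u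

section Mer
variable {D S S' : Set ℂ} {k k' : ℂ → ℂ}

theorem Mer.mono (h : Mer D S k) (hS : S ⊆ S') : Mer D S' k := by
  obtain ⟨M, G, hM, hG, hk⟩ := h
  exact ⟨M, G, fun s hs => ⟨(hM s hs).1, hS (hM s hs).2⟩, hG, hk⟩

theorem Mer.of_analytic (h : AnalyticOnNhd ℂ k D) : Mer D S k :=
  ⟨0, k, by simp, h, fun u _ _ => by rw [rootProd_zero, div_one]⟩

theorem Mer.of_differentiable (h : Differentiable ℂ k) : Mer D S k :=
  .of_analytic fun u _ => h.analyticAt u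

theorem Mer.mul (h : Mer D S k) (h' : Mer D S k') : Mer D S fun u => k u * k' u := by
  obtain ⟨M, G, hM, hG, hk⟩ := h
  obtain ⟨M', G', hM', hG', hk'⟩ := h'
  refine ⟨M + M', fun u => G u * G' u, fun s hs => ?_, hG.mul hG', fun u hu huM => ?_⟩
  · exact (Multiset.mem_add.1 hs).elim (hM s) (hM' s)
  · rw [Multiset.mem_add, not_or] at huM
    simp only [hk u hu huM.1, hk' u hu huM.2, rootProd_add, div_mul_div_comm]

theorem Mer.prod {ι : Type*} (s : Finset ι) {k : ι → ℂ → ℂ} (h : ∀ i ∈ s, Mer D S (k i)) :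
    Mer D S fun u => ∏ i ∈ s, k i u := by
  classical
  induction s using Finset.induction_on with
  | empty => simpa using Mer.of_differentiable (k := fun _ => (1 : ℂ)) (by fun_prop)
  | insert i s hi ih =>
    simp only [Finset.prod_insert hi]
    exact (h i (by simp)).mul (ih fun j hj => h j (by simp [hj]))

theorem Mer.continuousOn (h : Mer D S k) {T : Set ℂ} (hT : T ⊆ D) (hS : ∀ s ∈ S, s ∉ T) :
    ContinuousOn k T := by
  obtain ⟨M, G, hM, hG, hk⟩ := h
  refine (continuousOn_div_rootProd (hG.continuousOn.mono hT) fun s hs =>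
    hS s (hM s hs).2).congr fun u hu => ?_
  exact hk u (hT hu) fun h => hS u (hM u h).2 hu

/-- The integral depends only on the winding numbers around the poles. The factor c serves two
purposes: c = 0 gives vanishing when all poles are outside, and c = 1 gives invariance under
deformation. -/
theorem Mer.integral_eq (h : Mer D S k) (hD : Convex ℝ D) {γ δ : Contour} {c : ℂ}
    (hγ : γ.trace ⊆ D) (hδ : δ.trace ⊆ D)
    (hS : ∀ s ∈ S, s ∉ γ.trace ∧ s ∉ δ.trace ∧ winding γ.toFun s = c * winding δ.toFun s) :
    contourIntegral γ.toFun k = c * contourIntegral δ.toFun k := by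
  obtain ⟨M, G, hM, hG, hk⟩ := h
  rw [Contour.integral_congr (γ := γ) fun u hu => hk u (hγ hu) fun h => (hS u (hM u h).2).1 hu,
    Contour.integral_congr (γ := δ) fun u hu => hk u (hδ hu) fun h => (hS u (hM u h).2).2.1 hu]
  exact integral_div_rootProd hD hγ hδ M (fun s hs => hS s (hM s hs).2) (fun s hs => (hM s hs).1) hG

theorem Mer.integral_eq_zero (h : Mer D S k) (hD : Convex ℝ D) {γ : Contour}
    (hγ : γ.trace ⊆ D) (hS : S ⊆ γ.outside) : contourIntegral γ.toFun k = 0 := by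
  have := h.integral_eq hD hγ hγ (c := 0) fun s hs => ⟨(hS hs).1, (hS hs).1, by
    rw [(hS hs).2, zero_mul]⟩
  rwa [zero_mul] at this

/-- Deformation of a contour. -/
theorem Mer.integral_eq_integral (h : Mer D S k) (hD : Convex ℝ D) {γ δ : Contour}
    (hγ : γ.trace ⊆ D) (hδ : δ.trace ⊆ D)
    (hS : S ⊆ (γ.inside ∩ δ.inside) ∪ (γ.outside ∩ δ.outside)) :
    contourIntegral γ.toFun k = contourIntegral δ.toFun k := by
  have := h.integral_eq hD hγ hδ (c := 1) fun s hs => by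
    rcases hS hs with ⟨h1, h2⟩ | ⟨h1, h2⟩
    · exact ⟨h1.1, h2.1, by rw [h1.2, h2.2, one_mul]⟩
    · exact ⟨h1.1, h2.1, by rw [h1.2, h2.2, one_mul]⟩
  rwa [one_mul] at this

end Mer

/-! ### Poles of quotients of f in a cell -/

/-- `D` is convex and contains no two distinct points congruent modulo the zeros of `f`. -/
structure IsCell (f : ℂ → ℂ) (D : Set ℂ) : Prop where
  convex : Convex ℝ D
  inj : ∀ x ∈ D, ∀ y ∈ D, f (x - y) = 0 → x = y

section Cell
variable {f : ℂ → ℂ} {D S : Set ℂ}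

/-- In a cell f(u-b) has no zero other than s, and s is simple; dividing it by u-s leaves a function
without zeros on D. -/
theorem IsCell.analytic_inv_dslope (hf : SigmaLike f) (hD : IsCell f D) {b s : ℂ} (hs : s ∈ D)
    (h0 : f (s - b) = 0) :
    AnalyticOnNhd ℂ (fun u => (dslope (fun u => f (u - b)) s u)⁻¹) D := by
  have hd : Differentiable ℂ fun u => f (u - b) :=
    hf.diff.comp (f := fun u => u - b) (by fun_prop)
  intro u hu
  refine (AnalyticAt.dslope (hd.analyticAt s) (hd.analyticAt u)).inv ?_
  by_cases hus : u = s
  · subst hus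
    rw [dslope_same, ((hf.diff (u - b)).hasDerivAt.comp_sub_const u b).deriv]
    exact hf.deriv_ne_zero h0
  · rw [dslope_of_ne _ hus, slope_def_field, h0, sub_zero]
    refine div_ne_zero (fun h => hus ?_) (sub_ne_zero.2 hus)
    refine hD.inj u hu s hs ?_
    have := hf.sub_eq_zero h0 h
    rwa [sub_sub_sub_cancel_right] at this

theorem IsCell.one_div_eq (b s u : ℂ) (h0 : f (s - b) = 0) :
    1 / f (u - b) = (dslope (fun u => f (u - b)) s u)⁻¹ / (u - s) ∨ u = s := by
  by_cases hus : u = s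
  · exact Or.inr hus
  · left
    have hus' := sub_ne_zero.2 hus
    rw [dslope_of_ne _ hus, slope_def_field, h0, sub_zero]
    field_simp

theorem Mer.one_div (hf : SigmaLike f) (hD : IsCell f D) {b : ℂ}
    (hS : ∀ s ∈ D, f (s - b) = 0 → s ∈ S) : Mer D S fun u => 1 / f (u - b) := by
  by_cases h : ∃ s ∈ D, f (s - b) = 0
  · obtain ⟨s, hs, h0⟩ := h
    refine ⟨{s}, _, by simpa using ⟨hs, hS s hs h0⟩, hD.analytic_inv_dslope hf hs h0, ?_⟩
    intro u hu hus
    have := (IsCell.one_div_eq b s u h0).resolve_right (by simpa using hus)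
    simp only [this]
    simp [rootProd]
  · push Not at h
    refine .of_analytic fun u hu => ?_
    have hd : Differentiable ℂ fun u => f (u - b) :=
      hf.diff.comp (f := fun u => u - b) (by fun_prop)
    exact analyticAt_const.div (hd.analyticAt u) (h u hu)

theorem Mer.f_comp (hf : SigmaLike f) {g : ℂ → ℂ} (hg : Differentiable ℂ g) :
    Mer D S fun u => f (g u) :=
  .of_differentiable (hf.diff.comp hg)

theorem Mer.div (hf : SigmaLike f) (hD : IsCell f D) {k : ℂ → ℂ} (hk : Mer D S k) {b : ℂ}
    (hS : ∀ s ∈ D, f (s - b) = 0 → s ∈ S) : Mer D S fun u => k u / f (u - b) := by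
  simpa only [mul_one_div] using hk.mul (Mer.one_div hf hD hS)

/-- The residue theorem for one simple pole. -/
theorem Mer.integral_div_eq_residue (hf : SigmaLike f) (hD : IsCell f D) {γ : Contour}
    (hγ : γ.trace ⊆ D) {k : ℂ → ℂ} (hk : Mer D γ.outside k) {b : ℂ} (hb : b ∈ γ.inside) :
    contourIntegral γ.toFun (fun u => k u / f (u - b)) = 2 * Real.pi * I * (k b / deriv f 0) := by
  have hbD := Contour.inside_subset_of_convex hD.convex hγ hb
  have h0 : f (b - b) = 0 := by rw [sub_self, hf.zero]
  set H := fun u => (dslope (fun u => f (u - b)) b u)⁻¹ with hH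
  have hHa := hD.analytic_inv_dslope hf hbD h0
  have hHb : H b = 1 / deriv f 0 := by
    rw [hH]
    simp only [dslope_same]
    rw [((hf.diff (b - b)).hasDerivAt.comp_sub_const b b).deriv, sub_self, _root_.one_div]
  obtain ⟨M, G, hM, hG, hkG⟩ := hk
  have hbM : b ∉ M := fun h => Set.disjoint_left.1 Contour.disjoint_inside_outside hb (hM b h).2
  set G' := fun u => G u * H u with hG'
  have hG'a : AnalyticOnNhd ℂ G' D := hG.mul hHa
  -- Near b the integrand is G'(u)/(rootProd M u · (u-b)). Subtracting the polar part at b leaves a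
  -- numerator Q with Q(b) = 0, so the remainder has poles only outside the contour.
  set Q := fun u => G' u * rootProd M b - G' b * rootProd M u with hQ
  have hQa : AnalyticOnNhd ℂ Q D := fun u hu =>
    ((hG'a u hu).mul analyticAt_const).sub
      (analyticAt_const.mul ((differentiable_rootProd M).analyticAt u))
  have hQd : AnalyticOnNhd ℂ (dslope Q b) D := fun u hu => AnalyticAt.dslope (hQa b hbD) (hQa u hu)
  have hQb : Q b = 0 := by simp only [hQ]; ring
  have hPb := rootProd_ne_zero hbM
  have hmer : Mer D γ.outside fun u => dslope Q b u / rootProd M u := ⟨M, _, hM, hQd, fun _ _ _ => rfl⟩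
  have hMt : ∀ s ∈ M, s ∉ γ.trace := fun s hs => (hM s hs).2.1
  rw [Contour.integral_congr (G := fun u => (1 / rootProd M b) * (dslope Q b u / rootProd M u) +
    (G' b / rootProd M b) * (1 / (u - b)))]
  · rw [Contour.integral_add, Contour.integral_const_mul, Contour.integral_const_mul,
      hmer.integral_eq_zero hD.convex hγ subset_rfl, Contour.integral_one_div_sub, hb.2,
      hkG b hbD hbM, hG']
    simp only [hHb]
    ring
    · exact continuousOn_const.mul (continuousOn_div_rootProd (hQd.continuousOn.mono hγ) hMt)
    · refine continuousOn_const.mul (continuousOn_const.div (by fun_prop) fun u hu => ?_)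
      exact sub_ne_zero.2 fun e => hb.1 (e ▸ hu)
  · intro u hu
    have hub : u ≠ b := fun e => hb.1 (e ▸ hu)
    have h1 := (IsCell.one_div_eq b b u h0).resolve_right hub
    have huM : u ∉ M := fun h => hMt u h hu
    have hPu := rootProd_ne_zero huM
    have hub' := sub_ne_zero.2 hub
    have h2 : dslope Q b u = Q u / (u - b) := by
      rw [dslope_of_ne _ hub, slope_def_field, hQb, sub_zero]
    rw [← mul_one_div, h1, hkG u (hγ hu) huM, h2]
    change _ * (H u / _) = _
    simp only [hQ, hG']
    field_simp
    ring

end Cell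

/-! ### Nested integrals over towers of contours -/

/-- The two-body factor. -/
noncomputable def cross (f : ℂ → ℂ) (h u w : ℂ) : ℂ := f (u - w) / f (u - w - h)

/-- The nested contour integral of `∏_{i<j} cross(u_i,u_j) ∏_i k_i(u_i) φ(u_i)`, for a list of
contours and a list of functions `k_i`. -/
noncomputable def nestedIntegral (f : ℂ → ℂ) (h : ℂ) :
    List Contour → List (ℂ → ℂ) → (ℂ → ℂ) → ℂ
  | [], [], _ => 1
  | γ :: Γ, k :: w, φ => (2 * Real.pi * I)⁻¹ * contourIntegral γ.toFun fun u =>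
      k u * φ u * nestedIntegral f h Γ w fun x => φ x * cross f h u x
  | _, _, _ => 0

/-- Points which are outside all contours of a list. -/
def outsideAll (Γ : List Contour) : Set ℂ := {s | ∀ γ ∈ Γ, s ∈ γ.outside}

/-- A list of nested contours in `D`, including the points of `P` and excluding those of `Q`. -/
structure IsTower (h : ℂ) (D P Q : Set ℂ) (Γ : List Contour) : Prop where
  pairwise : Γ.Pairwise (Contour.Nest h)
  trace_subset : ∀ γ ∈ Γ, γ.trace ⊆ D
  inside : ∀ γ ∈ Γ, P ⊆ γ.inside
  outside : ∀ γ ∈ Γ, Q ⊆ γ.outside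

theorem iteratedIntegral_const_mul (N : ℕ) (γ : Fin N → Contour) (c : ℂ) (F : (Fin N → ℂ) → ℂ) :
    iteratedIntegral N γ (fun u => c * F u) = c * iteratedIntegral N γ F := by
  induction N with
  | zero => rfl
  | succ N ih =>
    simp only [iteratedIntegral, ih]
    rw [Contour.integral_const_mul]
    ring

section Tower
variable {f : ℂ → ℂ} {h : ℂ} {D P Q : Set ℂ} {Γ : List Contour} {γ γ₁ γ₂ : Contour}

theorem IsTower.tail (H : IsTower h D P Q (γ :: Γ)) : IsTower h D P Q Γ :=
  ⟨(List.pairwise_cons.1 H.pairwise).2, fun δ hδ => H.trace_subset δ (by simp [hδ]),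
    fun δ hδ => H.inside δ (by simp [hδ]), fun δ hδ => H.outside δ (by simp [hδ])⟩

theorem IsTower.nest (H : IsTower h D P Q (γ :: Γ)) : ∀ δ ∈ Γ, Contour.Nest h γ δ :=
  (List.pairwise_cons.1 H.pairwise).1

theorem IsTower.skip (H : IsTower h D P Q (γ₁ :: γ₂ :: Γ)) : IsTower h D P Q (γ₁ :: Γ) :=
  ⟨H.pairwise.sublist (by simp), fun δ hδ => H.trace_subset δ (by
      simp only [List.mem_cons] at hδ ⊢; tauto),
    fun δ hδ => H.inside δ (by simp only [List.mem_cons] at hδ ⊢; tauto),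
    fun δ hδ => H.outside δ (by simp only [List.mem_cons] at hδ ⊢; tauto)⟩

theorem IsTower.head_trace (H : IsTower h D P Q (γ :: Γ)) : γ.trace ⊆ D :=
  H.trace_subset γ (by simp)

/-- A zero would force u = w + h inside the cell, but w + h is strictly inside γ while u lies on it.
-/
theorem Contour.Nest.f_ne_zero (hD : IsCell f D) (hγ : γ.trace ⊆ D) {δ : Contour}
    (H : Contour.Nest h γ δ) {u w : ℂ} (hu : u ∈ γ.trace) (hw : w ∈ δ.closedRegion) :
    f (u - w - h) ≠ 0 := by
  intro h0
  have h1 := (H w hw).2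
  have := hD.inj u (hγ hu) (w + h) (Contour.inside_subset_of_convex hD.convex hγ h1)
    (by rwa [← sub_sub])
  exact h1.1 (this ▸ hu)

theorem outsideAll_cons_subset : outsideAll (γ :: Γ) ⊆ outsideAll Γ :=
  fun s hs δ hδ => hs δ (by simp [hδ])

theorem Mer.tail {φ : ℂ → ℂ} (hφ : Mer D (outsideAll (γ :: Γ)) φ) : Mer D (outsideAll Γ) φ :=
  hφ.mono outsideAll_cons_subset

theorem Mer.continuousOn_trace {φ : ℂ → ℂ} (hφ : Mer D (outsideAll Γ) φ) (hγ : γ ∈ Γ)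
    (hD : γ.trace ⊆ D) : ContinuousOn φ γ.trace :=
  hφ.continuousOn hD fun _ hs => (hs γ hγ).1

theorem IsTower.continuousOn_letter (H : IsTower h D P Q Γ) {k : ℂ → ℂ} (hk : Mer D (P ∪ Q) k)
    (hγ : γ ∈ Γ) : ContinuousOn k γ.trace :=
  hk.continuousOn (H.trace_subset γ hγ) fun s hs => by
    rcases hs with hs | hs
    · exact (H.inside γ hγ hs).1
    · exact (H.outside γ hγ hs).1

/-- As a function of the inner variable the two-body factor has its only possible pole at u - h,
outside all inner contours. It can therefore be absorbed into φ. -/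
theorem Mer.cross_right (hf : SigmaLike f) (hD : IsCell f D) (H : IsTower h D P Q (γ :: Γ))
    {u : ℂ} (hu : u ∈ γ.trace) : Mer D (outsideAll Γ) (cross f h u) := by
  have e : cross f h u = fun w => -f (u - w) / f (w - (u - h)) := by
    funext w
    rw [cross, hf.sub_comm w (u - h), neg_div_neg_eq, sub_right_comm]
  rw [e]
  refine Mer.div hf hD (.of_differentiable (hf.diff.comp (by fun_prop)).neg) fun s hs h0 δ hδ => ?_
  rw [Contour.mem_outside_iff]
  intro hsδ
  refine (H.nest δ hδ).f_ne_zero hD H.head_trace hu hsδ ?_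
  rw [hf.sub_comm, neg_eq_zero] at h0
  rwa [sub_right_comm]

/-- As a function of the outer variable the pole is at w + h, inside both outer contours, so
replacing one by the other does not cross it. -/
theorem Mer.cross_left (hf : SigmaLike f) (hD : IsCell f D) {δ : Contour}
    (hγ : γ₁.trace ⊆ D) (H₁ : Contour.Nest h γ₁ δ) (H₂ : Contour.Nest h γ₂ δ)
    {w : ℂ} (hw : w ∈ δ.trace) : Mer D (γ₁.inside ∩ γ₂.inside) fun u => cross f h u w := by
  simp only [cross, sub_sub]
  refine Mer.div hf hD (.of_differentiable (hf.diff.comp (by fun_prop))) fun s hs h0 => ?_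
  have h1 := (H₁ w (Or.inr hw)).2
  have : s = w + h := hD.inj s hs _ (Contour.inside_subset_of_convex hD.convex hγ h1) h0
  rw [this]
  exact ⟨h1, (H₂ w (Or.inr hw)).2⟩

theorem IsTower.continuousOn_cross (hf : SigmaLike f) (hD : IsCell f D)
    (H : IsTower h D P Q (γ :: Γ)) {δ : Contour} (hδ : δ ∈ Γ) :
    ContinuousOn (Function.uncurry (cross f h)) (γ.trace ×ˢ δ.trace) := by
  have hc := hf.continuous
  unfold cross
  refine ContinuousOn.div (by fun_prop) (by fun_prop) ?_
  rintro ⟨u, w⟩ ⟨hu, hw⟩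
  exact (H.nest δ hδ).f_ne_zero hD H.head_trace hu (Or.inr hw)

/-- The parameter space is arbitrary because in the induction the outermost integration variable
joins the parameters. -/
theorem continuousOn_nestedIntegral (hf : SigmaLike f) (hD : IsCell f D) {X : Type}
    [TopologicalSpace X] {S : Set X} (w : List (ℂ → ℂ)) (H : IsTower h D P Q Γ)
    (hw : ∀ k ∈ w, Mer D (P ∪ Q) k) {φ : X → ℂ → ℂ}
    (hφ : ∀ γ ∈ Γ, ContinuousOn (Function.uncurry φ) (S ×ˢ γ.trace)) :
    ContinuousOn (fun x => nestedIntegral f h Γ w (φ x)) S := by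
  induction Γ generalizing X w with
  | nil =>
    cases w with
    | nil => simpa only [nestedIntegral] using continuousOn_const
    | cons k w => simpa only [nestedIntegral] using continuousOn_const
  | cons γ Γ ih =>
    cases w with
    | nil => simpa only [nestedIntegral] using continuousOn_const
    | cons k w =>
      simp only [nestedIntegral]
      refine continuousOn_const.mul (Contour.continuousOn_integral ?_)
      have hk : ContinuousOn k γ.trace := H.continuousOn_letter (hw k (by simp)) (by simp)
      refine ContinuousOn.mul (ContinuousOn.mul ?_ ?_) ?_
      · exact hk.comp continuousOn_snd fun p hp => hp.2
      · exact hφ γ (by simp)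
      · refine ih (X := X × ℂ) (S := S ×ˢ γ.trace) w H.tail (fun k hk => hw k (by simp [hk]))
          (φ := fun p x => φ p.1 x * cross f h p.2 x) fun δ hδ => ?_
        refine ContinuousOn.mul ?_ ?_
        · exact (hφ δ (by simp [hδ])).comp (f := fun p : (X × ℂ) × ℂ => (p.1.1, p.2))
            (by fun_prop) fun p hp => ⟨hp.1.1, hp.2⟩
        · exact (H.continuousOn_cross hf hD hδ).comp (f := fun p : (X × ℂ) × ℂ => (p.1.2, p.2))
            (by fun_prop) fun p hp => ⟨hp.1.2, hp.2⟩

theorem continuousOn_uncurry_of_snd {k : ℂ → ℂ} {S T : Set ℂ} (hk : ContinuousOn k T) :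
    ContinuousOn (fun p : ℂ × ℂ => k p.2) (S ×ˢ T) :=
  hk.comp continuousOn_snd fun _ hp => hp.2

theorem continuousOn_uncurry_of_fst {k : ℂ → ℂ} {S T : Set ℂ} (hk : ContinuousOn k S) :
    ContinuousOn (fun p : ℂ × ℂ => k p.1) (S ×ˢ T) :=
  hk.comp continuousOn_fst fun _ hp => hp.1

theorem continuousOn_nestedIntegral_cross (hf : SigmaLike f) (hD : IsCell f D)
    (w : List (ℂ → ℂ)) (H : IsTower h D P Q (γ :: Γ)) (hw : ∀ k ∈ w, Mer D (P ∪ Q) k)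
    {φ : ℂ → ℂ} (hφ : Mer D (outsideAll Γ) φ) :
    ContinuousOn (fun u => nestedIntegral f h Γ w fun x => φ x * cross f h u x) γ.trace := by
  refine continuousOn_nestedIntegral hf hD w H.tail hw (φ := fun u x => φ x * cross f h u x)
    fun δ hδ => ?_
  exact (continuousOn_uncurry_of_snd (hφ.continuousOn_trace hδ
    (H.trace_subset δ (by simp [hδ])))).mul (H.continuousOn_cross hf hD hδ)

theorem sum_nestedIntegral_cons (hf : SigmaLike f) (hD : IsCell f D) {ι : Type*} (s : Finset ι)
    (c : ι → ℂ) (w : ι → List (ℂ → ℂ)) {k : ℂ → ℂ} (H : IsTower h D P Q (γ :: Γ))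
    (hw : ∀ i ∈ s, ∀ k ∈ w i, Mer D (P ∪ Q) k) (hk : Mer D (P ∪ Q) k) {φ : ℂ → ℂ}
    (hφ : Mer D (outsideAll (γ :: Γ)) φ) :
    ∑ i ∈ s, c i * nestedIntegral f h (γ :: Γ) (k :: w i) φ =
      (2 * Real.pi * I)⁻¹ * contourIntegral γ.toFun fun u => k u * φ u *
        ∑ i ∈ s, c i * nestedIntegral f h Γ (w i) fun x => φ x * cross f h u x := by
  have hk' : ContinuousOn k γ.trace := H.continuousOn_letter hk (by simp)
  have hφ' : ContinuousOn φ γ.trace := hφ.continuousOn_trace (by simp) H.head_trace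
  simp only [Finset.mul_sum (s := s)]
  rw [Contour.integral_sum, Finset.mul_sum]
  · refine Finset.sum_congr rfl fun i _ => ?_
    rw [nestedIntegral, mul_left_comm, ← Contour.integral_const_mul]
    congr 2
    funext u
    ring
  · intro i hi
    exact (hk'.mul hφ').mul (continuousOn_const.mul
      (continuousOn_nestedIntegral_cross hf hD (w i) H (hw i hi) hφ.tail))

/-- Linear relations between nested integrals persist under adding letters in front. -/
theorem sum_nestedIntegral_append (hf : SigmaLike f) (hD : IsCell f D) {ι κ : Type*} (s : Finset ι)
    (t : Finset κ) (c : ι → ℂ) (d : κ → ℂ) (w : ι → List (ℂ → ℂ)) (w' : κ → List (ℂ → ℂ))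
    (hw : ∀ i ∈ s, ∀ k ∈ w i, Mer D (P ∪ Q) k) (hw' : ∀ i ∈ t, ∀ k ∈ w' i, Mer D (P ∪ Q) k)
    (hrel : ∀ Γ φ, IsTower h D P Q Γ → Mer D (outsideAll Γ) φ →
      ∑ i ∈ s, c i * nestedIntegral f h Γ (w i) φ = ∑ i ∈ t, d i * nestedIntegral f h Γ (w' i) φ)
    (v : List (ℂ → ℂ)) (hv : ∀ k ∈ v, Mer D (P ∪ Q) k) {φ : ℂ → ℂ} (H : IsTower h D P Q Γ)
    (hφ : Mer D (outsideAll Γ) φ) :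
    ∑ i ∈ s, c i * nestedIntegral f h Γ (v ++ w i) φ =
      ∑ i ∈ t, d i * nestedIntegral f h Γ (v ++ w' i) φ := by
  induction v generalizing Γ φ with
  | nil => exact hrel Γ φ H hφ
  | cons k v ih =>
    have hvs : ∀ k ∈ v, Mer D (P ∪ Q) k := fun k hk => hv k (by simp [hk])
    cases Γ with
    | nil => simp [nestedIntegral]
    | cons γ Γ =>
      simp only [List.cons_append]
      rw [sum_nestedIntegral_cons hf hD s c (fun i => v ++ w i) H _ (hv k (by simp)) hφ,
        sum_nestedIntegral_cons hf hD t d (fun i => v ++ w' i) H _ (hv k (by simp)) hφ]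
      · congr 1
        refine Contour.integral_congr fun u hu => ?_
        rw [ih hvs H.tail (hφ.tail.mul (Mer.cross_right hf hD H hu))]
      · intro i hi k' hk'
        exact (List.mem_append.1 hk').elim (hvs k') (hw' i hi k')
      · intro i hi k' hk'
        exact (List.mem_append.1 hk').elim (hvs k') (hw i hi k')

theorem nestedIntegral_append_congr (hf : SigmaLike f) (hD : IsCell f D)
    {w w' : List (ℂ → ℂ)} (hw : ∀ k ∈ w, Mer D (P ∪ Q) k) (hw' : ∀ k ∈ w', Mer D (P ∪ Q) k)
    (hrel : ∀ Γ φ, IsTower h D P Q Γ → Mer D (outsideAll Γ) φ →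
      nestedIntegral f h Γ w φ = nestedIntegral f h Γ w' φ)
    (v : List (ℂ → ℂ)) (hv : ∀ k ∈ v, Mer D (P ∪ Q) k) {φ : ℂ → ℂ} (H : IsTower h D P Q Γ)
    (hφ : Mer D (outsideAll Γ) φ) :
    nestedIntegral f h Γ (v ++ w) φ = nestedIntegral f h Γ (v ++ w') φ := by
  have := sum_nestedIntegral_append hf hD (Finset.univ : Finset Unit) (Finset.univ : Finset Unit)
    (fun _ => 1) (fun _ => 1) (fun _ => w) (fun _ => w') (fun _ _ => hw) (fun _ _ => hw')
    (fun Γ φ H hφ => by simpa using hrel Γ φ H hφ) v hv H hφ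
  simpa using this

/-- Interchange of an additional outer integration with a nested integral. -/
theorem integral_nestedIntegral_cons (hf : SigmaLike f) (hD : IsCell f D) {γ₀ : Contour}
    (w : List (ℂ → ℂ)) {l : ℂ → ℂ} (H : IsTower h D P Q (γ₀ :: γ :: Γ))
    (hw : ∀ k ∈ w, Mer D (P ∪ Q) k) (hl : Mer D (P ∪ Q) l) {φ k : ℂ → ℂ}
    (hφ : Mer D (outsideAll (γ :: Γ)) φ) (hk : ContinuousOn k γ₀.trace) :
    contourIntegral γ₀.toFun (fun u => k u * nestedIntegral f h (γ :: Γ) (l :: w)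
      fun x => φ x * cross f h u x) =
    (2 * Real.pi * I)⁻¹ * contourIntegral γ.toFun fun y => l y * φ y *
      contourIntegral γ₀.toFun fun u => (k u * cross f h u y) * nestedIntegral f h Γ w
        fun x => (φ x * cross f h y x) * cross f h u x := by
  have hl' : ContinuousOn l γ.trace := H.continuousOn_letter hl (by simp)
  have hφ' : ContinuousOn φ γ.trace := hφ.continuousOn_trace (by simp) H.tail.head_trace
  have e1 : ∀ u, k u * nestedIntegral f h (γ :: Γ) (l :: w) (fun x => φ x * cross f h u x) =
      (2 * Real.pi * I)⁻¹ * contourIntegral γ.toFun fun y => l y * φ y *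
        ((k u * cross f h u y) * nestedIntegral f h Γ w
          fun x => (φ x * cross f h y x) * cross f h u x) := by
    intro u
    rw [nestedIntegral, mul_left_comm, ← Contour.integral_const_mul]
    congr 2
    funext y
    rw [show (fun x => φ x * cross f h u x * cross f h y x) =
      fun x => φ x * cross f h y x * cross f h u x from funext fun x => mul_right_comm _ _ _]
    ring
  simp only [e1]
  rw [Contour.integral_const_mul, Contour.integral_swap]
  · congr 2
    funext y
    rw [Contour.integral_const_mul]
  · refine ContinuousOn.mul ?_ (ContinuousOn.mul (ContinuousOn.mul ?_ ?_) ?_)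
    · exact continuousOn_uncurry_of_snd (hl'.mul hφ')
    · exact continuousOn_uncurry_of_fst hk
    · exact H.continuousOn_cross hf hD (by simp)
    · refine continuousOn_nestedIntegral hf hD w H.tail.tail hw
        (φ := fun (p : ℂ × ℂ) x => φ x * cross f h p.2 x * cross f h p.1 x) fun δ hδ => ?_
      refine ContinuousOn.mul (ContinuousOn.mul ?_ ?_) ?_
      · exact (hφ.continuousOn_trace (by simp [hδ]) (H.trace_subset δ (by simp [hδ]))).comp
          (f := fun p : (ℂ × ℂ) × ℂ => p.2) (by fun_prop) fun p hp => hp.2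
      · exact (H.tail.continuousOn_cross hf hD hδ).comp
          (f := fun p : (ℂ × ℂ) × ℂ => (p.1.2, p.2)) (by fun_prop) fun p hp => ⟨hp.1.2, hp.2⟩
      · exact (H.continuousOn_cross hf hD (by simp [hδ])).comp
          (f := fun p : (ℂ × ℂ) × ℂ => (p.1.1, p.2)) (by fun_prop) fun p hp => ⟨hp.1.1, hp.2⟩

/-- Deformation of an additional contour around a nested integral. -/
theorem integral_nestedIntegral_deform (hf : SigmaLike f) (hD : IsCell f D)
    (w : List (ℂ → ℂ)) (H₁ : IsTower h D P Q (γ₁ :: Γ)) (H₂ : IsTower h D P Q (γ₂ :: Γ))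
    (hw : ∀ k ∈ w, Mer D (P ∪ Q) k) {φ k : ℂ → ℂ} (hφ : Mer D (outsideAll Γ) φ)
    (hk : Mer D ((γ₁.inside ∩ γ₂.inside) ∪ (γ₁.outside ∩ γ₂.outside)) k) :
    contourIntegral γ₁.toFun (fun u => k u * nestedIntegral f h Γ w fun x => φ x * cross f h u x) =
    contourIntegral γ₂.toFun (fun u => k u * nestedIntegral f h Γ w
      fun x => φ x * cross f h u x) := by
  induction Γ generalizing w φ k with
  | nil =>
    cases w with
    | nil =>
      simp only [nestedIntegral, mul_one]
      exact hk.integral_eq_integral hD.convex H₁.head_trace H₂.head_trace subset_rfl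
    | cons l w => simp only [nestedIntegral, mul_zero, Contour.integral_zero]
  | cons γ Γ ih =>
    cases w with
    | nil => simp only [nestedIntegral, mul_zero, Contour.integral_zero]
    | cons l w =>
      have hws : ∀ k ∈ w, Mer D (P ∪ Q) k := fun k hk => hw k (by simp [hk])
      have hl := hw l (by simp)
      have hc₁ : ContinuousOn k γ₁.trace := hk.continuousOn H₁.head_trace fun s hs =>
        hs.elim (fun h => h.1.1) fun h => h.1.1
      have hc₂ : ContinuousOn k γ₂.trace := hk.continuousOn H₂.head_trace fun s hs =>
        hs.elim (fun h => h.2.1) fun h => h.2.1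
      rw [integral_nestedIntegral_cons hf hD w H₁ hws hl hφ hc₁,
        integral_nestedIntegral_cons hf hD w H₂ hws hl hφ hc₂]
      congr 1
      refine Contour.integral_congr fun y hy => ?_
      rw [ih w H₁.skip H₂.skip hws (hφ.tail.mul (Mer.cross_right hf hD H₁.tail hy))
        (hk.mul ((Mer.cross_left hf hD H₁.head_trace (H₁.nest γ (by simp))
          (H₂.nest γ (by simp)) hy).mono Set.subset_union_left))]

/-- Two outermost letters may be exchanged if their difference is the product of
`f(u₁ - u₂ - h)` and a symmetric function. -/
theorem nestedIntegral_exchange (hf : SigmaLike f) (hD : IsCell f D)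
    {a₁ b₁ a₂ b₂ k : ℂ → ℂ} (ha₁ : Mer D (P ∪ Q) a₁) (hb₁ : Mer D (P ∪ Q) b₁)
    (ha₂ : Mer D (P ∪ Q) a₂) (hb₂ : Mer D (P ∪ Q) b₂) (hk : Mer D (P ∪ Q) k) (κ C : ℂ)
    (hrel : ∀ u w, a₁ u * b₁ w - a₂ u * b₂ w =
      f (u - w - h) * (κ * f (C - u - w) * (k u * k w)))
    (w : List (ℂ → ℂ)) (hw : ∀ k ∈ w, Mer D (P ∪ Q) k) {φ : ℂ → ℂ} (H : IsTower h D P Q Γ)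
    (hφ : Mer D (outsideAll Γ) φ) :
    nestedIntegral f h Γ (a₁ :: b₁ :: w) φ = nestedIntegral f h Γ (a₂ :: b₂ :: w) φ := by
  rcases Γ with _ | ⟨γ₁, _ | ⟨γ₂, Γ⟩⟩
  · simp only [nestedIntegral]
  · simp only [nestedIntegral, mul_zero, Contour.integral_zero]
  set J : ℂ → ℂ → ℂ := fun u y => nestedIntegral f h Γ w
    fun x => φ x * cross f h u x * cross f h y x with hJ
  have hJsymm : ∀ u y, J u y = J y u := by
    intro u y
    simp only [hJ, mul_right_comm _ (cross f h u _)]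
  -- The integrand of the difference once `hrel` has cancelled the denominator f(u-y-h). The factor
  -- f(u-y) makes it antisymmetric, everything else being symmetric in u and y.
  set W : ℂ → ℂ → ℂ := fun u y => (f (u - y) * (κ * f (C - u - y) * (k u * k y)) * (φ u * φ y)) *
    J u y with hW
  have hWanti : ∀ u y, W u y = -1 * W y u := by
    intro u y
    simp only [hW]
    rw [hJsymm u y, hf.sub_comm u y, sub_right_comm C u y]
    ring
  have H₁ := H.skip
  have H₂ := H.tail
  have hφ₁ : ContinuousOn φ γ₁.trace := hφ.continuousOn_trace (by simp) H.head_trace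
  have hφ₂ : ContinuousOn φ γ₂.trace := hφ.continuousOn_trace (by simp) H₂.head_trace
  have hJcont : ∀ δ ε, IsTower h D P Q (δ :: Γ) → IsTower h D P Q (ε :: Γ) →
      ContinuousOn (Function.uncurry J) (δ.trace ×ˢ ε.trace) := by
    intro δ ε Hδ Hε
    refine continuousOn_nestedIntegral hf hD w H₂.tail hw
      (φ := fun (p : ℂ × ℂ) x => φ x * cross f h p.1 x * cross f h p.2 x) fun θ hθ => ?_
    refine ContinuousOn.mul (ContinuousOn.mul ?_ ?_) ?_
    · exact (hφ.continuousOn_trace (by simp [hθ]) (H.trace_subset θ (by simp [hθ]))).comp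
        (f := fun p : (ℂ × ℂ) × ℂ => p.2) (by fun_prop) fun p hp => hp.2
    · exact (Hδ.continuousOn_cross hf hD hθ).comp
        (f := fun p : (ℂ × ℂ) × ℂ => (p.1.1, p.2)) (by fun_prop) fun p hp => ⟨hp.1.1, hp.2⟩
    · exact (Hε.continuousOn_cross hf hD hθ).comp
        (f := fun p : (ℂ × ℂ) × ℂ => (p.1.2, p.2)) (by fun_prop) fun p hp => ⟨hp.1.2, hp.2⟩
  have hfc := hf.continuous
  have expand : ∀ a b, Mer D (P ∪ Q) a → Mer D (P ∪ Q) b →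
      nestedIntegral f h (γ₁ :: γ₂ :: Γ) (a :: b :: w) φ =
      (2 * Real.pi * I)⁻¹ * ((2 * Real.pi * I)⁻¹ * contourIntegral γ₁.toFun fun u =>
        contourIntegral γ₂.toFun fun y => a u * b y * (cross f h u y * (φ u * φ y) * J u y)) := by
    intro a b _ _
    rw [nestedIntegral]
    congr 1
    rw [← Contour.integral_const_mul]
    congr 1
    funext u
    rw [nestedIntegral, mul_left_comm, ← Contour.integral_const_mul]
    congr 2
    funext y
    simp only [hJ]
    ring
  have hcont : ∀ a b, Mer D (P ∪ Q) a → Mer D (P ∪ Q) b → ContinuousOn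
      (Function.uncurry fun u y => a u * b y * (cross f h u y * (φ u * φ y) * J u y))
      (γ₁.trace ×ˢ γ₂.trace) := by
    intro a b ha hb
    refine ContinuousOn.mul (ContinuousOn.mul ?_ ?_) (ContinuousOn.mul (ContinuousOn.mul ?_ ?_) ?_)
    · exact continuousOn_uncurry_of_fst (H.continuousOn_letter ha (by simp))
    · exact continuousOn_uncurry_of_snd (H.continuousOn_letter hb (by simp))
    · exact H.continuousOn_cross hf hD (by simp)
    · exact (continuousOn_uncurry_of_fst hφ₁).mul (continuousOn_uncurry_of_snd hφ₂)
    · exact hJcont _ _ H₁ H₂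
  have hcont1 : ∀ a b, Mer D (P ∪ Q) a → Mer D (P ∪ Q) b → ∀ u ∈ γ₁.trace, ContinuousOn
      (fun y => a u * b y * (cross f h u y * (φ u * φ y) * J u y)) γ₂.trace :=
    fun a b ha hb u hu => (hcont a b ha hb).comp (f := fun y => (u, y)) (by fun_prop)
      fun y hy => ⟨hu, hy⟩
  rw [← sub_eq_zero, expand _ _ ha₁ hb₁, expand _ _ ha₂ hb₂, ← mul_sub, ← mul_sub,
    ← Contour.integral_sub (Contour.continuousOn_integral (hcont _ _ ha₁ hb₁))
      (Contour.continuousOn_integral (hcont _ _ ha₂ hb₂))]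
  -- The pole y = u-h, the only obstruction between γ₂ and γ₁, has disappeared, so the inner contour
  -- may be moved out to γ₁.
  have e1 : ∀ u ∈ γ₁.trace,
      (contourIntegral γ₂.toFun fun y => a₁ u * b₁ y * (cross f h u y * (φ u * φ y) * J u y)) -
      (contourIntegral γ₂.toFun fun y => a₂ u * b₂ y * (cross f h u y * (φ u * φ y) * J u y)) =
      contourIntegral γ₁.toFun fun y => W u y := by
    intro u hu
    rw [← Contour.integral_sub (hcont1 _ _ ha₁ hb₁ u hu) (hcont1 _ _ ha₂ hb₂ u hu)]
    have e2 : ∀ y, W u y = (f (u - y) * (κ * f (C - u - y) * (k u * k y)) * (φ u * φ y)) *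
        nestedIntegral f h Γ w fun x => (φ x * cross f h u x) * cross f h y x := fun y => rfl
    simp only [e2]
    rw [integral_nestedIntegral_deform hf hD w H₁ H₂ hw
      (hφ.tail.tail.mul (Mer.cross_right hf hD H₁ hu)) (γ₂ := γ₂)]
    · refine Contour.integral_congr fun y hy => ?_
      have hne := (H.nest γ₂ (by simp)).f_ne_zero hD H.head_trace hu (Or.inr hy)
      rw [← sub_mul, hrel, cross]
      field_simp
      rfl
    · have hsub : P ∪ Q ⊆ (γ₁.inside ∩ γ₂.inside) ∪ (γ₁.outside ∩ γ₂.outside) :=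
        Set.union_subset_union
          (Set.subset_inter (H.inside γ₁ (by simp)) (H.inside γ₂ (by simp)))
          (Set.subset_inter (H.outside γ₁ (by simp)) (H.outside γ₂ (by simp)))
      have hsub2 : outsideAll (γ₁ :: γ₂ :: Γ) ⊆
          (γ₁.inside ∩ γ₂.inside) ∪ (γ₁.outside ∩ γ₂.outside) :=
        fun s hs => Or.inr ⟨hs γ₁ (by simp), hs γ₂ (by simp)⟩
      have hcst : ∀ c : ℂ, Mer D ((γ₁.inside ∩ γ₂.inside) ∪ (γ₁.outside ∩ γ₂.outside))
          fun _ => c := fun c => .of_differentiable (by fun_prop)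
      refine ((Mer.f_comp hf (by fun_prop)).mul (((hcst κ).mul (Mer.f_comp hf (by fun_prop))).mul
        ((hcst _).mul (hk.mono hsub)))).mul ((hcst _).mul (hφ.mono hsub2))
  rw [Contour.integral_congr e1]
  have hWc : ContinuousOn (Function.uncurry W) (γ₁.trace ×ˢ γ₁.trace) := by
    have hkc : ContinuousOn k γ₁.trace := H.continuousOn_letter hk (by simp)
    refine ContinuousOn.mul (ContinuousOn.mul (ContinuousOn.mul ?_ (ContinuousOn.mul ?_ ?_)) ?_)
      (hJcont _ _ H₁ H₁)
    · fun_prop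
    · fun_prop
    · exact (continuousOn_uncurry_of_fst hkc).mul (continuousOn_uncurry_of_snd hkc)
    · exact (continuousOn_uncurry_of_fst hφ₁).mul (continuousOn_uncurry_of_snd hφ₁)
  -- Both variables now run over the same contour, and Fubini combined with antisymmetry gives zero.
  have e3 : (contourIntegral γ₁.toFun fun u => contourIntegral γ₁.toFun fun y => W u y) = 0 := by
    have h1 := Contour.integral_swap hWc
    have h2 : (contourIntegral γ₁.toFun fun u => contourIntegral γ₁.toFun fun y => W u y) =
        -1 * contourIntegral γ₁.toFun fun u => contourIntegral γ₁.toFun fun y => W y u := by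
      rw [← Contour.integral_const_mul]
      congr 1
      funext u
      rw [← Contour.integral_const_mul]
      congr 1
      funext y
      exact hWanti u y
    rw [← h1] at h2
    exact self_eq_neg.1 (h2.trans (neg_one_mul _))
  rw [e3, mul_zero, mul_zero]

/-- Only the values of the letters on the contours matter. -/
theorem nestedIntegral_congr {w w' : List (ℂ → ℂ)} {φ φ' : ℂ → ℂ}
    (hw : List.Forall₂ (fun k k' => ∀ γ ∈ Γ, ∀ u ∈ γ.trace, k u * φ u = k' u * φ' u) w w') :
    nestedIntegral f h Γ w φ = nestedIntegral f h Γ w' φ' := by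
  induction Γ generalizing w w' φ φ' with
  | nil => cases hw <;> simp only [nestedIntegral]
  | cons γ Γ ih =>
    cases hw with
    | nil => simp only [nestedIntegral]
    | cons hk hw =>
      rw [nestedIntegral, nestedIntegral]
      congr 1
      refine Contour.integral_congr fun u hu => ?_
      rw [hk γ (by simp) u hu, ih]
      refine hw.imp fun k k' h' δ hδ x hx => ?_
      rw [← mul_assoc, h' δ (by simp [hδ]) x hx, mul_assoc]

end Tower

/-- The nested integral as an iterated integral over tuples. -/
theorem iteratedIntegral_eq_nestedIntegral (f : ℂ → ℂ) (h : ℂ) (N : ℕ) (γ : Fin N → Contour)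
    (k : Fin N → ℂ → ℂ) (φ : ℂ → ℂ) :
    iteratedIntegral N γ (fun u => (∏ i : Fin N, ∏ j ∈ Finset.Ioi i, cross f h (u i) (u j)) *
      ∏ i, (k i (u i) * φ (u i))) = nestedIntegral f h (List.ofFn γ) (List.ofFn k) φ := by
  induction N generalizing φ with
  | zero => simp [iteratedIntegral, nestedIntegral]
  | succ N ih =>
    rw [iteratedIntegral, List.ofFn_succ, List.ofFn_succ, nestedIntegral]
    congr 2
    funext u
    have h1 := ih (Fin.tail γ) (Fin.tail k) fun x => φ x * cross f h u x
    simp only [Fin.tail] at h1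
    refine Eq.trans ?_ (congrArg (k 0 u * φ u * ·) h1)
    simp only [← iteratedIntegral_const_mul]
    congr 1
    funext u'
    simp only [Fin.prod_univ_succ (n := N), Fin.cons_zero, Fin.cons_succ, Fin.prod_Ioi_zero,
      Fin.prod_Ioi_succ, Finset.prod_mul_distrib]
    ring

/-! ### The residue theorem for balanced quotients -/

section Elliptic
variable {f : ℂ → ℂ} {h : ℂ} {D P Q : Set ℂ} {Γ : List Contour} {γ : Contour}

/-- The quotient `∏ f(u - a) / f(u - b)` over a list of pairs `(a, b)`. -/
noncomputable def sigmaQuot (f : ℂ → ℂ) (L : List (ℂ × ℂ)) (u : ℂ) : ℂ :=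
  (L.map fun r => f (u - r.1) / f (u - r.2)).prod

@[simp] theorem sigmaQuot_nil (u : ℂ) : sigmaQuot f [] u = 1 := rfl

@[simp] theorem sigmaQuot_cons (r : ℂ × ℂ) (L : List (ℂ × ℂ)) (u : ℂ) :
    sigmaQuot f (r :: L) u = f (u - r.1) / f (u - r.2) * sigmaQuot f L u := rfl

theorem continuousOn_sigmaQuot (hf : SigmaLike f) {S : Set ℂ} {L : List (ℂ × ℂ)}
    (hL : ∀ r ∈ L, ∀ u ∈ S, f (u - r.2) ≠ 0) : ContinuousOn (sigmaQuot f L) S := by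
  have hc := hf.continuous
  induction L with
  | nil => exact continuousOn_const
  | cons r L ih =>
    refine ContinuousOn.mul (ContinuousOn.div (by fun_prop) (by fun_prop)
      (hL r (by simp))) (ih fun r' hr' => hL r' (by simp [hr']))

/-- Reduction of the number of poles by the three-term relation. -/
theorem SigmaLike.two_pole_reduction (hf : SigmaLike f) {a₁ a₂ b₁ b₂ u : ℂ}
    (h₁ : f (b₁ - b₂) ≠ 0) (h₂ : f (b₁ + b₂ - a₁ - a₂) ≠ 0) (hu₁ : f (u - b₁) ≠ 0)
    (hu₂ : f (u - b₂) ≠ 0) :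
    f (u - a₁) / f (u - b₁) * (f (u - a₂) / f (u - b₂)) =
      f (b₁ - a₁) * f (b₁ - a₂) / (f (b₁ - b₂) * f (b₁ + b₂ - a₁ - a₂)) *
        (f (u - (a₁ + a₂ - b₂)) / f (u - b₁)) -
      f (b₂ - a₁) * f (b₂ - a₂) / (f (b₁ - b₂) * f (b₁ + b₂ - a₁ - a₂)) *
        (f (u - (a₁ + a₂ - b₁)) / f (u - b₂)) := by
  have h3 := hf.three_term (u - (a₁ + a₂) / 2) ((a₂ - a₁) / 2) (b₁ - (a₁ + a₂) / 2)
    (b₂ - (a₁ + a₂) / 2)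
  rw [show u - (a₁ + a₂) / 2 + (a₂ - a₁) / 2 = u - a₁ by ring,
    show u - (a₁ + a₂) / 2 - (a₂ - a₁) / 2 = u - a₂ by ring,
    show b₁ - (a₁ + a₂) / 2 + (b₂ - (a₁ + a₂) / 2) = b₁ + b₂ - a₁ - a₂ by ring,
    show b₁ - (a₁ + a₂) / 2 - (b₂ - (a₁ + a₂) / 2) = b₁ - b₂ by ring,
    show u - (a₁ + a₂) / 2 + (b₁ - (a₁ + a₂) / 2) = u - (a₁ + a₂ - b₁) by ring,
    show u - (a₁ + a₂) / 2 - (b₁ - (a₁ + a₂) / 2) = u - b₁ by ring,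
    show (a₂ - a₁) / 2 + (b₂ - (a₁ + a₂) / 2) = b₂ - a₁ by ring,
    show (a₂ - a₁) / 2 - (b₂ - (a₁ + a₂) / 2) = a₂ - b₂ by ring,
    show u - (a₁ + a₂) / 2 + (b₂ - (a₁ + a₂) / 2) = u - (a₁ + a₂ - b₂) by ring,
    show u - (a₁ + a₂) / 2 - (b₂ - (a₁ + a₂) / 2) = u - b₂ by ring,
    show (a₂ - a₁) / 2 + (b₁ - (a₁ + a₂) / 2) = b₁ - a₁ by ring,
    show (a₂ - a₁) / 2 - (b₁ - (a₁ + a₂) / 2) = a₂ - b₁ by ring,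
    hf.sub_comm a₂ b₁, hf.sub_comm a₂ b₂] at h3
  field_simp
  linear_combination h3

/-- The residue theorem for balanced quotients with one simple pole `c` outside the contour. -/
theorem integral_balanced (hf : SigmaLike f) (hD : IsCell f D) (hγ : γ.trace ⊆ D)
    {c : ℂ} (hc : ∀ u ∈ γ.closedRegion, f (u - c) ≠ 0) (L : List (ℂ × ℂ)) (a : ℂ)
    (hL : ∀ r ∈ L, r.2 ∈ γ.inside)
    (hbal : a + (L.map Prod.fst).sum = c + (L.map Prod.snd).sum) :
    contourIntegral γ.toFun (fun u => f (u - a) / f (u - c) * sigmaQuot f L u) =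
      -(2 * Real.pi * I / deriv f 0) * (f (c - a) * sigmaQuot f L c) := by
  have hfc := hf.continuous
  have hct : ∀ u ∈ γ.trace, f (u - c) ≠ 0 := fun u hu => hc u (Or.inr hu)
  have hbt : ∀ b ∈ γ.inside, ∀ u ∈ γ.trace, f (u - b) ≠ 0 := fun b hb u hu h0 => hb.1
    (hD.inj u (hγ hu) b (Contour.inside_subset_of_convex hD.convex hγ hb) h0 ▸ hu)
  have hcb : ∀ b ∈ γ.inside, f (c - b) ≠ 0 := fun b hb h0 => by
    rw [hf.sub_comm, neg_eq_zero] at h0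
    exact hc b (Or.inl hb) h0
  have hd := hf.deriv_zero
  -- Without pairs, balance gives a = c and the integrand is constant. With one pair there is a
  -- single residue inside, and balance turns it into the value at c. With more pairs the three-term
  -- relation merges two of them into one, preserving balance.
  match L with
  | [] =>
    simp only [List.map_nil, List.sum_nil, add_zero] at hbal
    subst hbal
    rw [sub_self, hf.zero, zero_mul, mul_zero]
    refine (Contour.integral_congr fun u hu => ?_).trans
      (Mer.integral_eq_zero (D := D) (S := ∅) (k := fun _ => 1) (.of_differentiable (by fun_prop))
        hD.convex hγ (by simp))
    rw [sigmaQuot_nil, mul_one, div_self (hct u hu)]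
  | [(a₁, b₁)] =>
    simp only [List.map_cons, List.map_nil, List.sum_cons, List.sum_nil, add_zero] at hbal
    have hb₁ := hL _ (List.mem_singleton_self _)
    have hbc := hc b₁ (Or.inl hb₁)
    have hm : Mer D γ.outside fun u => f (u - a) * f (u - a₁) / f (u - c) :=
      Mer.div hf hD ((Mer.f_comp hf (by fun_prop)).mul (Mer.f_comp hf (by fun_prop)))
        fun s _ h0 => Contour.mem_outside_iff.2 fun hs => hc s hs h0
    have h1 := hm.integral_div_eq_residue hf hD hγ hb₁
    simp only [sigmaQuot_cons, sigmaQuot_nil, mul_one]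
    rw [show (fun u => f (u - a) / f (u - c) * (f (u - a₁) / f (u - b₁))) =
      fun u => f (u - a) * f (u - a₁) / f (u - c) / f (u - b₁) by
        funext u; rw [div_mul_div_comm, div_div], h1, hf.sub_comm b₁ c,
      show b₁ - a = a₁ - c by linear_combination -hbal,
      show b₁ - a₁ = a - c by linear_combination -hbal, hf.sub_comm a c, hf.sub_comm a₁ c]
    have := hcb b₁ hb₁
    field_simp
  | (a₁, b₁) :: (a₂, b₂) :: L =>
    have hb₁ := hL (a₁, b₁) (by simp)
    have hb₂ := hL (a₂, b₂) (by simp)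
    have hL' : ∀ r ∈ L, r.2 ∈ γ.inside := fun r hr => hL r (by simp [hr])
    simp only [List.map_cons, List.sum_cons] at hbal
    -- The reduction divides by f(b₁-b₂) f(b₁+b₂-a₁-a₂), so it first covers only generic b₁.
    have generic : ∀ b₁ ∈ γ.inside, ∀ a, a + (a₁ + (a₂ + (L.map Prod.fst).sum)) =
        c + (b₁ + (b₂ + (L.map Prod.snd).sum)) → f (b₁ - b₂) ≠ 0 →
        f (b₁ + b₂ - a₁ - a₂) ≠ 0 →
        contourIntegral γ.toFun (fun u => f (u - a) / f (u - c) *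
          sigmaQuot f ((a₁, b₁) :: (a₂, b₂) :: L) u) =
        -(2 * Real.pi * I / deriv f 0) *
          (f (c - a) * sigmaQuot f ((a₁, b₁) :: (a₂, b₂) :: L) c) := by
      intro b₁ hb₁ a hbal h₁ h₂
      have ih₁ := integral_balanced hf hD hγ hc ((a₁ + a₂ - b₂, b₁) :: L) a
        (by simpa using ⟨hb₁, fun a b hr => hL' (a, b) hr⟩)
        (by simp only [List.map_cons, List.sum_cons]; linear_combination hbal)
      have ih₂ := integral_balanced hf hD hγ hc ((a₁ + a₂ - b₁, b₂) :: L) a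
        (by simpa using ⟨hb₂, fun a b hr => hL' (a, b) hr⟩)
        (by simp only [List.map_cons, List.sum_cons]; linear_combination hbal)
      have hred : ∀ u, f (u - b₁) ≠ 0 → f (u - b₂) ≠ 0 →
          sigmaQuot f ((a₁, b₁) :: (a₂, b₂) :: L) u =
          f (b₁ - a₁) * f (b₁ - a₂) / (f (b₁ - b₂) * f (b₁ + b₂ - a₁ - a₂)) *
            sigmaQuot f ((a₁ + a₂ - b₂, b₁) :: L) u -
          f (b₂ - a₁) * f (b₂ - a₂) / (f (b₁ - b₂) * f (b₁ + b₂ - a₁ - a₂)) *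
            sigmaQuot f ((a₁ + a₂ - b₁, b₂) :: L) u := by
        intro u hu₁ hu₂
        simp only [sigmaQuot_cons]
        rw [← mul_assoc, hf.two_pole_reduction h₁ h₂ hu₁ hu₂]
        ring
      have hcont : ∀ (C x b : ℂ), b ∈ γ.inside → ContinuousOn (fun u => C *
          (f (u - a) / f (u - c) * sigmaQuot f ((x, b) :: L) u)) γ.trace := fun C x b hb =>
        continuousOn_const.mul ((ContinuousOn.div (by fun_prop) (by fun_prop) hct).mul
          (continuousOn_sigmaQuot hf fun r hr u hu => hbt _ (by
            rcases List.mem_cons.1 hr with rfl | hr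
            exacts [hb, hL' r hr]) u hu))
      rw [hred c (hcb _ hb₁) (hcb _ hb₂), mul_sub, mul_left_comm (f (c - a)),
        mul_left_comm (f (c - a)), mul_sub, mul_left_comm, ← ih₁,
        mul_left_comm (-(2 * Real.pi * I / deriv f 0)), ← ih₂, ← Contour.integral_const_mul,
        ← Contour.integral_const_mul, ← Contour.integral_sub (hcont _ _ _ hb₁)
        (hcont _ _ _ hb₂)]
      refine Contour.integral_congr fun u hu => ?_
      rw [hred u (hbt _ hb₁ u hu) (hbt _ hb₂ u hu)]
      ring
    -- In general b₁ and a are shifted by the same ε, which keeps the balance; small nonzero ε are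
    -- generic, and both sides are continuous at ε = 0.
    set V : Set ℂ := {ε | b₁ + ε ∈ γ.inside} with hV
    have hVo : IsOpen V := γ.isOpen_inside.preimage (by fun_prop)
    have h0V : (0 : ℂ) ∈ V := by simpa [hV] using hb₁
    have key : ∀ᶠ ε in nhdsWithin (0 : ℂ) {0}ᶜ,
        contourIntegral γ.toFun (fun u => f (u - (a + ε)) / f (u - c) *
          sigmaQuot f ((a₁, b₁ + ε) :: (a₂, b₂) :: L) u) =
        -(2 * Real.pi * I / deriv f 0) *
          (f (c - (a + ε)) * sigmaQuot f ((a₁, b₁ + ε) :: (a₂, b₂) :: L) c) := by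
      have hshift : ∀ y : ℂ, ∀ᶠ ε in nhdsWithin (0 : ℂ) {0}ᶜ, f (y + ε) ≠ 0 := fun y => by
        have h1 := hf.eventually_ne y
        have h2 : Tendsto (fun ε : ℂ => y + ε) (nhdsWithin 0 {0}ᶜ) (nhdsWithin y {y}ᶜ) := by
          refine tendsto_nhdsWithin_iff.2 ⟨?_, ?_⟩
          · have : ContinuousAt (fun ε : ℂ => y + ε) 0 := by fun_prop
            simpa [ContinuousAt] using this.tendsto.mono_left nhdsWithin_le_nhds
          · filter_upwards [self_mem_nhdsWithin] with ε hε
            simpa using hε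
        exact h2.eventually h1
      filter_upwards [hshift (b₁ - b₂), hshift (b₁ + b₂ - a₁ - a₂),
        nhdsWithin_le_nhds (hVo.mem_nhds h0V)] with ε h1 h2 h3
      refine generic _ h3 _ ?_ ?_ ?_
      · linear_combination hbal
      · rwa [show b₁ + ε - b₂ = b₁ - b₂ + ε by ring]
      · rwa [show b₁ + ε + b₂ - a₁ - a₂ = b₁ + b₂ - a₁ - a₂ + ε by ring]
    have hl : ContinuousAt (fun ε => contourIntegral γ.toFun fun u => f (u - (a + ε)) / f (u - c) *
          sigmaQuot f ((a₁, b₁ + ε) :: (a₂, b₂) :: L) u) 0 := by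
      refine (Contour.continuousOn_integral (S := V) ?_).continuousAt (hVo.mem_nhds h0V)
      simp only [sigmaQuot_cons, Function.uncurry_def]
      refine ContinuousOn.mul (ContinuousOn.div (by fun_prop) (by fun_prop) fun p hp => hct _ hp.2)
        (ContinuousOn.mul (ContinuousOn.div (by fun_prop) (by fun_prop)
          fun p hp => hbt _ hp.1 _ hp.2) (ContinuousOn.mul (ContinuousOn.div (by fun_prop)
          (by fun_prop) fun p hp => hbt _ hb₂ _ hp.2) ?_))
      exact continuousOn_uncurry_of_snd (continuousOn_sigmaQuot hf fun r hr => hbt _ (hL' r hr))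
    have hr : ContinuousAt (fun ε => -(2 * Real.pi * I / deriv f 0) *
          (f (c - (a + ε)) * sigmaQuot f ((a₁, b₁ + ε) :: (a₂, b₂) :: L) c)) 0 := by
      simp only [sigmaQuot_cons]
      refine continuousAt_const.mul (ContinuousAt.mul (by fun_prop) (ContinuousAt.mul
        (ContinuousAt.div continuousAt_const (by fun_prop) ?_) continuousAt_const))
      simpa using hcb _ hb₁
    have := tendsto_nhds_unique_of_eventuallyEq (hl.tendsto.mono_left nhdsWithin_le_nhds)
      (hr.tendsto.mono_left nhdsWithin_le_nhds) key
    simpa only [add_zero] using this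
termination_by L.length

theorem continuousOn_balanced (hf : SigmaLike f) (hD : IsCell f D) (hγ : γ.trace ⊆ D)
    {c : ℂ} (hc : ∀ u ∈ γ.closedRegion, f (u - c) ≠ 0) (L : List (ℂ × ℂ)) (a : ℂ)
    (hL : ∀ r ∈ L, r.2 ∈ γ.inside) :
    ContinuousOn (fun u => f (u - a) / f (u - c) * sigmaQuot f L u) γ.trace := by
  have hfc := hf.continuous
  refine (ContinuousOn.div (by fun_prop) (by fun_prop) fun u hu => hc u (Or.inr hu)).mul
    (continuousOn_sigmaQuot hf fun r hr u hu h0 => (hL r hr).1 ?_)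
  exact hD.inj u (hγ hu) r.2 (Contour.inside_subset_of_convex hD.convex hγ (hL r hr)) h0 ▸ hu

/-- Outermost integration of a balanced quotient against a nested integral. -/
theorem integral_balanced_nestedIntegral (hf : SigmaLike f) (hD : IsCell f D)
    {c : ℂ} (hc : ∀ u ∈ γ.closedRegion, f (u - c) ≠ 0) (L : List (ℂ × ℂ)) (a : ℂ)
    (w : List (ℂ → ℂ)) (H : IsTower h D P Q (γ :: Γ)) (hL : ∀ r ∈ L, r.2 ∈ γ.inside)
    (hw : ∀ k ∈ w, Mer D (P ∪ Q) k) {φ : ℂ → ℂ} (hφ : Mer D (outsideAll Γ) φ)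
    (hbal : a + (L.map Prod.fst).sum = c + (L.map Prod.snd).sum + h * Γ.length) :
    contourIntegral γ.toFun (fun u => f (u - a) / f (u - c) * sigmaQuot f L u *
      nestedIntegral f h Γ w fun x => φ x * cross f h u x) =
      -(2 * Real.pi * I / deriv f 0) * (f (c - a) * sigmaQuot f L c *
        nestedIntegral f h Γ w fun x => φ x * cross f h c x) := by
  induction Γ generalizing L w φ with
  | nil =>
    cases w with
    | nil =>
      simp only [nestedIntegral, mul_one]
      exact integral_balanced hf hD H.head_trace hc L a hL (by simpa using hbal)
    | cons l w => simp only [nestedIntegral, mul_zero, Contour.integral_zero]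
  | cons δ Γ ih =>
    cases w with
    | nil => simp only [nestedIntegral, mul_zero, Contour.integral_zero]
    | cons l w =>
      rw [integral_nestedIntegral_cons hf hD w H (fun k hk => hw k (by simp [hk]))
        (hw l (by simp)) hφ (continuousOn_balanced hf hD H.head_trace hc L a hL), nestedIntegral,
        mul_left_comm (f (c - a) * _), mul_left_comm (-(2 * Real.pi * I / deriv f 0))]
      congr 1
      rw [← Contour.integral_const_mul, ← Contour.integral_const_mul]
      refine Contour.integral_congr fun y hy => ?_
      have hn := H.nest δ (by simp) y (Or.inr hy)
      -- The two-body factor with the next variable y joins the quotient as the pair (y, y+h): its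
      -- pole is inside γ, and it accounts for one h in the balance condition.
      have := ih ((y, y + h) :: L) w H.skip (by
          rintro r hr
          rcases List.mem_cons.1 hr with rfl | hr
          exacts [hn.2, hL r hr]) (fun k hk => hw k (by simp [hk]))
          (hφ.tail.mul (Mer.cross_right hf hD H.tail hy)) (by
            simp only [List.map_cons, List.sum_cons, List.length_cons] at hbal ⊢
            push_cast at hbal
            linear_combination hbal)
      simp only [sigmaQuot_cons, ← sub_sub] at this
      have e : ∀ u, f (u - a) / f (u - c) * sigmaQuot f L u * cross f h u y =
          f (u - a) / f (u - c) * (f (u - y) / f (u - y - h) * sigmaQuot f L u) := fun u => by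
        rw [cross]; ring
      simp only [e]
      rw [this, show (fun x => φ x * cross f h c x * cross f h y x) =
        fun x => φ x * cross f h y x * cross f h c x from funext fun x => mul_right_comm _ _ _,
        cross]
      ring

end Elliptic

/-! ### Weight functions, words and norms of configurations -/

section Letters
variable (f : ℂ → ℂ) (h : ℂ) (Λ p : ℕ → ℂ)

/-- The product `∏_{j<m} f(u - q_j) / f(u - p_j)` with `q_j = p_j + h Λ_j`. -/
noncomputable def sitePrefix (m : ℕ) (u : ℂ) : ℂ :=
  ∏ j ∈ Finset.range m, f (u - (p j + h * Λ j)) / f (u - p j)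

/-- The weight function of one particle at the site `m`, with dynamical parameter `ℓ`. -/
noncomputable def weightLetter (m : ℕ) (ℓ u : ℂ) : ℂ :=
  sitePrefix f h Λ p m u * (f (ℓ + h + p m - u) / f (u - p m))

/-- The words `ψ[ℓ + 2h(k-1)], …, ψ[ℓ + 2h], ψ[ℓ]`. -/
noncomputable def row (h : ℂ) (Z : ℂ → ℂ → ℂ) : ℕ → ℂ → List (ℂ → ℂ)
  | 0, _ => []
  | k + 1, ℓ => Z (ℓ + 2 * h * k) :: row h Z k ℓ

/-- The number of particles at the sites `< m`. -/
def numBelow (y : ℕ → ℕ) (m : ℕ) : ℕ := ∑ i ∈ Finset.range m, y i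

/-- The dynamical parameter at the site `m`. -/
noncomputable def siteParam (x : ℂ) (y : ℕ → ℕ) (m : ℕ) : ℂ :=
  x - h * sumΛ Λ m + 2 * h * numBelow y m

/-- The word of weight functions of the configuration `y` on the sites `< m`. -/
noncomputable def weightWord (x : ℂ) (y : ℕ → ℕ) : ℕ → List (ℂ → ℂ)
  | 0 => []
  | m + 1 => row h (weightLetter f h Λ p m) (y m) (siteParam h Λ x y m) ++ weightWord x y m

/-- The inverse squared norm of `k` particles at a site of spin `S`. -/
noncomputable def siteNorm (S : ℂ) (k : ℕ) (ℓ : ℂ) : ℂ :=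
  ∏ j ∈ Finset.range k, f (h * (S - j)) / (f (ℓ + h * (k + j) - h * S) * f (ℓ + h * (1 + j)))

/-- The inverse squared norm of the configuration `y` on the sites `< m`. -/
noncomputable def wordNorm (x : ℂ) (y : ℕ → ℕ) (m : ℕ) : ℂ :=
  ∏ i ∈ Finset.range m, siteNorm f h (Λ i) (y i) (siteParam h Λ x y i)

end Letters

section LetterFacts
variable {f : ℂ → ℂ} {h : ℂ} {Λ p : ℕ → ℂ} {D P Q : Set ℂ} {Γ : List Contour} {γ : Contour}

theorem length_row (Z : ℂ → ℂ → ℂ) (k : ℕ) (ℓ : ℂ) : (row h Z k ℓ).length = k := by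
  induction k with
  | zero => rfl
  | succ k ih => rw [row, List.length_cons, ih]

theorem row_succ' (Z : ℂ → ℂ → ℂ) (k : ℕ) (ℓ : ℂ) :
    row h Z (k + 1) ℓ = row h Z k (ℓ + 2 * h) ++ [Z ℓ] := by
  induction k with
  | zero => simp [row]
  | succ k ih =>
    rw [row, ih, row, List.cons_append]
    congr 2
    push_cast
    ring

theorem mem_row {Z : ℂ → ℂ → ℂ} {k : ℕ} {ℓ : ℂ} {g : ℂ → ℂ} (hg : g ∈ row h Z k ℓ) :
    ∃ ℓ', g = Z ℓ' := by
  induction k with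
  | zero => simp [row] at hg
  | succ k ih =>
    rcases List.mem_cons.1 hg with rfl | hg
    exacts [⟨_, rfl⟩, ih hg]

theorem forall₂_row {R : (ℂ → ℂ) → (ℂ → ℂ) → Prop} {Z Z' : ℂ → ℂ → ℂ} {a : ℂ}
    (hR : ∀ ℓ, R (Z ℓ) (Z' (ℓ + a))) (k : ℕ) (ℓ : ℂ) :
    List.Forall₂ R (row h Z k ℓ) (row h Z' k (ℓ + a)) := by
  induction k with
  | zero => exact .nil
  | succ k ih =>
    refine .cons ?_ ih
    rw [add_right_comm]
    exact hR _

theorem numBelow_congr {y y' : ℕ → ℕ} {m : ℕ} (hy : ∀ i < m, y i = y' i) :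
    numBelow y m = numBelow y' m :=
  Finset.sum_congr rfl fun i hi => hy i (Finset.mem_range.1 hi)

theorem siteParam_congr {x : ℂ} {y y' : ℕ → ℕ} {m : ℕ} (hy : ∀ i < m, y i = y' i) :
    siteParam h Λ x y m = siteParam h Λ x y' m := by
  rw [siteParam, siteParam, numBelow_congr hy]

theorem weightWord_congr {x : ℂ} {y y' : ℕ → ℕ} {m : ℕ} (hy : ∀ i < m, y i = y' i) :
    weightWord f h Λ p x y m = weightWord f h Λ p x y' m := by
  induction m with
  | zero => rfl
  | succ m ih =>
    rw [weightWord, weightWord, ih fun i hi => hy i (by omega), hy m (by omega),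
      siteParam_congr fun i hi => hy i (by omega)]

theorem wordNorm_congr {x : ℂ} {y y' : ℕ → ℕ} {m : ℕ} (hy : ∀ i < m, y i = y' i) :
    wordNorm f h Λ x y m = wordNorm f h Λ x y' m := by
  refine Finset.prod_congr rfl fun i hi => ?_
  rw [Finset.mem_range] at hi
  rw [hy i hi, siteParam_congr fun j hj => hy j (by omega)]

theorem length_weightWord (x : ℂ) (y : ℕ → ℕ) (m : ℕ) :
    (weightWord f h Λ p x y m).length = numBelow y m := by
  induction m with
  | zero => rfl
  | succ m ih =>
    rw [weightWord, List.length_append, length_row, ih, numBelow, numBelow,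
      Finset.sum_range_succ, add_comm]

theorem mem_weightWord {x : ℂ} {y : ℕ → ℕ} {m : ℕ} {g : ℂ → ℂ}
    (hg : g ∈ weightWord f h Λ p x y m) : ∃ i ℓ, g = weightLetter f h Λ p i ℓ := by
  induction m with
  | zero => simp [weightWord] at hg
  | succ m ih =>
    rcases List.mem_append.1 hg with hg | hg
    · exact ⟨m, mem_row hg⟩
    · exact ih hg

theorem nestedIntegral_eq_zero_of_length {w : List (ℂ → ℂ)} {φ : ℂ → ℂ}
    (hw : w.length ≠ Γ.length) : nestedIntegral f h Γ w φ = 0 := by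
  induction Γ generalizing w φ with
  | nil =>
    cases w with
    | nil => simp at hw
    | cons k w => simp only [nestedIntegral]
  | cons γ Γ ih =>
    cases w with
    | nil => simp only [nestedIntegral]
    | cons k w =>
      rw [nestedIntegral]
      simp only [ih (w := w) (by simpa using hw), mul_zero, Contour.integral_zero]

theorem Mer.sitePrefix (hf : SigmaLike f) (hD : IsCell f D) (hpD : ∀ j, p j ∈ D)
    (hp : ∀ j, p j ∈ P) (m : ℕ) : Mer D (P ∪ Q) (sitePrefix f h Λ p m) :=
  Mer.prod _ fun j _ => Mer.div hf hD (Mer.f_comp hf (by fun_prop)) fun s hs h0 =>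
    Or.inl (hD.inj s hs _ (hpD j) h0 ▸ hp j)

theorem Mer.weightLetter (hf : SigmaLike f) (hD : IsCell f D) (hpD : ∀ j, p j ∈ D)
    (hp : ∀ j, p j ∈ P) (m : ℕ) (ℓ : ℂ) : Mer D (P ∪ Q) (weightLetter f h Λ p m ℓ) :=
  (Mer.sitePrefix hf hD hpD hp m).mul (Mer.div hf hD (Mer.f_comp hf (by fun_prop))
    fun s hs h0 => Or.inl (hD.inj s hs _ (hpD m) h0 ▸ hp m))

end LetterFacts

/-! ### The empty partition function -/

section Vacuum
variable {f : ℂ → ℂ} {h : ℂ} {Λ p : ℕ → ℂ} {D P Q : Set ℂ} {Γ : List Contour} {γ : Contour}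

/-- The one-particle factor of the empty partition function. -/
noncomputable def vacuumFactor (f : ℂ → ℂ) (h x c : ℂ) (N : ℕ) (u : ℂ) : ℂ :=
  f (x + u - c + h * N) / f (u - c)

theorem Mer.vacuumFactor (hf : SigmaLike f) (hD : IsCell f D) {x c : ℂ} {N : ℕ} {S : Set ℂ}
    (hS : ∀ s ∈ D, f (s - c) = 0 → s ∈ S) : Mer D S (vacuumFactor f h x c N) :=
  Mer.div hf hD (Mer.f_comp hf (by fun_prop)) hS

theorem mem_outsideAll_of_ne_zero {c : ℂ}
    (hc : ∀ γ ∈ Γ, ∀ u ∈ γ.closedRegion, f (u - c) ≠ 0) {s : ℂ} (h0 : f (s - c) = 0) :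
    s ∈ outsideAll Γ :=
  fun γ hγ => Contour.mem_outside_iff.2 fun hs => hc γ hγ s hs h0

/-- Adding h to a point enclosed by an inner contour gives a point inside the outer one, so after
integrating out the outermost variable the excluded pole may move from c to c - h. -/
theorem IsTower.ne_zero_shift (H : IsTower h D P Q (γ :: Γ)) {c : ℂ}
    (hc : ∀ γ' ∈ γ :: Γ, ∀ u ∈ γ'.closedRegion, f (u - c) ≠ 0) :
    ∀ γ' ∈ Γ, ∀ u ∈ γ'.closedRegion, f (u - (c - h)) ≠ 0 := by
  intro γ' hγ' u hu
  rw [show u - (c - h) = u + h - c by ring]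
  exact hc γ (by simp) _ (Or.inl (H.nest γ' hγ' u hu).2)

/-- Each contour passed allows one shift by h. With c = q_0 and b = p_0 this gives f(h(Λ_0-i)) ≠ 0,
as the evaluation of the norm at site 0 requires. -/
theorem IsTower.ne_zero_sub (hf : SigmaLike f) (H : IsTower h D P Q Γ) {c b : ℂ} (hb : b ∈ P)
    (hc : ∀ γ ∈ Γ, ∀ u ∈ γ.closedRegion, f (u - c) ≠ 0) {i : ℕ} (hi : i < Γ.length) :
    f (c - h * i - b) ≠ 0 := by
  induction Γ generalizing c i with
  | nil => simp at hi
  | cons γ Γ ih =>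
    cases i with
    | zero =>
      rw [Nat.cast_zero, mul_zero, sub_zero, hf.sub_comm, neg_ne_zero]
      exact hc γ (by simp) b (Or.inl (H.inside γ (by simp) hb))
    | succ i =>
      have := ih H.tail (H.ne_zero_shift hc) (i := i) (by simpa using hi)
      rwa [show c - h - h * i - b = c - h * (i + 1 : ℕ) - b by push_cast; ring] at this

/-- The empty partition function for particles at the site `0`. -/
theorem nestedIntegral_row_zero (hf : SigmaLike f) (hD : IsCell f D) (hpD : ∀ j, p j ∈ D)
    (hp : ∀ j, p j ∈ P) (x : ℂ) {c : ℂ} (H : IsTower h D P Q Γ)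
    (hc : ∀ γ ∈ Γ, ∀ u ∈ γ.closedRegion, f (u - c) ≠ 0) :
    nestedIntegral f h Γ (row h (weightLetter f h Λ p 0) Γ.length x)
      (vacuumFactor f h x c Γ.length) =
      ∏ i ∈ Finset.range Γ.length, 1 / deriv f 0 * (f (x + h * (Γ.length - i)) *
        f (c - h * i - p 0 - x - h * (2 * (Γ.length - i) - 1)) / f (c - h * i - p 0)) := by
  induction Γ generalizing c with
  | nil => simp [row, nestedIntegral]
  | cons γ Γ ih =>
    have hcγ := hc γ (by simp)
    have hφ : Mer D (outsideAll Γ) (vacuumFactor f h x c (γ :: Γ).length) :=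
      Mer.vacuumFactor hf hD fun s _ h0 =>
        mem_outsideAll_of_ne_zero (fun δ hδ => hc δ (by simp [hδ])) h0
    have hw : ∀ k ∈ row h (weightLetter f h Λ p 0) Γ.length x, Mer D (P ∪ Q) k := by
      intro k hk
      obtain ⟨ℓ, rfl⟩ := mem_row hk
      exact Mer.weightLetter hf hD hpD hp 0 ℓ
    -- The numerators come from the vacuum factor (zero at c - x - h(|Γ|+1)) and from the letter;
    -- the parameter x + 2h|Γ| of the outermost letter is what balances the inner two-body factors.
    have key := integral_balanced_nestedIntegral hf hD hcγ
      [(x + 2 * h * Γ.length + h + p 0, p 0)] (c - x - h * (Γ.length + 1)) _ H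
      (by simpa using H.inside γ (by simp) (hp 0)) hw hφ (by
        simp only [List.map_cons, List.map_nil, List.sum_cons, List.sum_nil]; ring)
    rw [List.length_cons, row, nestedIntegral, ← List.length_cons (a := γ)]
    have e : ∀ u, weightLetter f h Λ p 0 (x + 2 * h * Γ.length) u *
        vacuumFactor f h x c (γ :: Γ).length u =
        (-1) * (f (u - (c - x - h * (Γ.length + 1))) / f (u - c) *
          sigmaQuot f [(x + 2 * h * Γ.length + h + p 0, p 0)] u) := by
      intro u
      simp only [weightLetter, sitePrefix, vacuumFactor, sigmaQuot_cons, sigmaQuot_nil,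
        Finset.range_zero, Finset.prod_empty, one_mul, mul_one, List.length_cons, Nat.cast_add,
        Nat.cast_one]
      rw [hf.sub_comm _ u, show x + u - c + h * (Γ.length + 1) =
        u - (c - x - h * (Γ.length + 1)) by ring]
      ring
    simp only [e, mul_assoc (-1 : ℂ)]
    rw [Contour.integral_const_mul, key]
    -- Evaluated at the residue point c, the two-body factor replaces the denominator f(u-c) by
    -- f(u-(c-h)): the result is the vacuum factor for one particle less, with pole c - h.
    have e2 : nestedIntegral f h Γ (row h (weightLetter f h Λ p 0) Γ.length x)
        (fun y => vacuumFactor f h x c (γ :: Γ).length y * cross f h c y) =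
        nestedIntegral f h Γ (row h (weightLetter f h Λ p 0) Γ.length x)
          (vacuumFactor f h x (c - h) Γ.length) := by
      refine nestedIntegral_congr (List.forall₂_same.2 fun k hk δ hδ u hu => ?_)
      have h1 := hc δ (by simp [hδ]) u (Or.inr hu)
      have h2 := H.ne_zero_shift hc δ hδ u (Or.inr hu)
      congr 1
      rw [vacuumFactor, vacuumFactor, cross, hf.sub_comm c u,
        show c - u - h = (c - h) - u by ring, hf.sub_comm (c - h) u,
        show x + u - (c - h) + h * Γ.length = x + u - c + h * (γ :: Γ).length by
          push_cast [List.length_cons]; ring]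
      field_simp
    rw [e2, ih H.tail (H.ne_zero_shift hc), List.length_cons, Finset.prod_range_succ', mul_comm]
    have e3 : ∀ i : ℕ, ((Γ.length + 1 : ℕ) : ℂ) - ((i + 1 : ℕ) : ℂ) = Γ.length - i := fun i => by
      push_cast; ring
    have e4 : ∀ i : ℕ, c - h - h * i = c - h * ((i + 1 : ℕ) : ℂ) := fun i => by push_cast; ring
    simp only [e3, e4]
    rw [sigmaQuot_cons, sigmaQuot_nil]
    have hd := hf.deriv_zero
    have hπ := Complex.two_pi_I_ne_zero
    rw [show c - (c - x - h * (Γ.length + 1)) = x + h * ((Γ.length + 1 : ℕ) - (0 : ℕ)) by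
        push_cast; ring,
      show c - (x + 2 * h * Γ.length + h + p 0) = c - h * (0 : ℕ) - p 0 - x -
        h * (2 * ((Γ.length + 1 : ℕ) - (0 : ℕ)) - 1) by push_cast; ring,
      show c - p 0 = c - h * (0 : ℕ) - p 0 by push_cast; ring]
    field_simp

theorem sigmaQuot_map_range (a b : ℕ → ℂ) (m : ℕ) (u : ℂ) :
    sigmaQuot f ((List.range m).map fun j => (a j, b j)) u =
      ∏ j ∈ Finset.range m, f (u - a j) / f (u - b j) := by
  rw [sigmaQuot, List.map_map, ← List.prod_toFinset _ (List.nodup_range), List.toFinset_range]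
  rfl

/-- The empty partition function vanishes if the outermost letter is not at the site `0`. -/
theorem nestedIntegral_cons_eq_zero (hf : SigmaLike f) (hD : IsCell f D)
    (hp : ∀ j, p j ∈ P) (x : ℂ) (m : ℕ) (w : List (ℂ → ℂ)) (H : IsTower h D P Q (γ :: Γ))
    (hw : ∀ k ∈ w, Mer D (P ∪ Q) k)
    (hc : ∀ γ' ∈ γ :: Γ, ∀ u ∈ γ'.closedRegion, f (u - (p 0 + h * Λ 0)) ≠ 0) :
    nestedIntegral f h (γ :: Γ)
      (weightLetter f h Λ p (m + 1) (x - h * sumΛ Λ (m + 1) + 2 * h * Γ.length) :: w)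
      (vacuumFactor f h x (p 0 + h * Λ 0) (γ :: Γ).length) = 0 := by
  set c := p 0 + h * Λ 0 with hcdef
  set ℓ := x - h * sumΛ Λ (m + 1) + 2 * h * Γ.length with hℓ
  have hφ : Mer D (outsideAll Γ) (vacuumFactor f h x c (γ :: Γ).length) :=
    Mer.vacuumFactor hf hD fun s _ h0 =>
      mem_outsideAll_of_ne_zero (fun δ hδ => hc δ (by simp [hδ])) h0
  have hin : ∀ j, p j ∈ γ.inside := fun j => H.inside γ (by simp) (hp j)
  have sum_map : ∀ a : ℕ → ℂ, ((List.range m).map a).sum = ∑ j ∈ Finset.range m, a j := fun a => by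
    rw [← List.sum_toFinset _ List.nodup_range, List.toFinset_range]
  -- A letter at a site beyond 0 contains the numerator f(u-q_0), and q_0 = c. Hence the theorem
  -- applies with a = c and its right side carries the factor f(0) = 0.
  have key := integral_balanced_nestedIntegral hf hD (hc γ (by simp))
    ((ℓ + h + p (m + 1), p (m + 1)) :: (c - x - h * (Γ.length + 1), p 0) ::
      (List.range m).map fun j => (p (j + 1) + h * Λ (j + 1), p (j + 1))) c w H (by
        intro r hr
        simp only [List.mem_cons, List.mem_map] at hr
        rcases hr with rfl | rfl | ⟨j, _, rfl⟩ <;> exact hin _) hw hφ (by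
        simp only [List.map_cons, List.sum_cons, List.map_map, Function.comp_def, sum_map,
          Finset.sum_add_distrib, hℓ, sumΛ, Finset.sum_range_succ', ← Finset.mul_sum, hcdef]
        ring)
  rw [sub_self, hf.zero, zero_mul, zero_mul, mul_zero] at key
  rw [nestedIntegral]
  have e : ∀ u, weightLetter f h Λ p (m + 1) ℓ u * vacuumFactor f h x c (γ :: Γ).length u =
      (-1) * (f (u - c) / f (u - c) * sigmaQuot f ((ℓ + h + p (m + 1), p (m + 1)) ::
        (c - x - h * (Γ.length + 1), p 0) ::
        (List.range m).map fun j => (p (j + 1) + h * Λ (j + 1), p (j + 1))) u) := by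
    intro u
    rw [sigmaQuot_cons, sigmaQuot_cons, sigmaQuot_map_range, weightLetter, sitePrefix,
      Finset.prod_range_succ', vacuumFactor, hf.sub_comm _ u, List.length_cons, Nat.cast_add,
      Nat.cast_one, show x + u - c + h * (Γ.length + 1) =
        u - (c - x - h * (Γ.length + 1)) by ring]
    ring
  simp only [e, mul_assoc (-1 : ℂ)]
  simp only [mul_assoc] at key
  simp only [mul_assoc]
  rw [Contour.integral_const_mul, key, mul_zero, mul_zero]

theorem weightWord_eq_row {x : ℂ} {y : ℕ → ℕ} {m : ℕ} (hy : ∀ i ≤ m, 0 < i → y i = 0) :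
    weightWord f h Λ p x y (m + 1) = row h (weightLetter f h Λ p 0) (y 0) x := by
  induction m with
  | zero => simp [weightWord, siteParam, sumΛ, numBelow]
  | succ m ih =>
    rw [weightWord, hy (m + 1) le_rfl (by omega), row, List.nil_append,
      ih fun i hi => hy i (by omega)]

theorem wordNorm_eq_siteNorm {x : ℂ} {y : ℕ → ℕ} {m : ℕ} (hy : ∀ i ≤ m, 0 < i → y i = 0) :
    wordNorm f h Λ x y (m + 1) = siteNorm f h (Λ 0) (y 0) x := by
  rw [wordNorm, Finset.prod_range_succ', Finset.prod_eq_one, one_mul]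
  · simp [siteParam, sumΛ, numBelow]
  · intro i hi
    rw [Finset.mem_range] at hi
    rw [hy (i + 1) (by omega) (by omega), siteNorm, Finset.prod_range_zero]

/-- The outermost letter belongs to the last occupied site, so all remaining letters lie at or below
it and their number determines its dynamical parameter. -/
theorem exists_weightWord_eq_cons {x : ℂ} {y : ℕ → ℕ} {m : ℕ}
    (hy : ¬ ∀ i < m, 0 < i → y i = 0) : ∃ i w, weightWord f h Λ p x y m =
      weightLetter f h Λ p (i + 1) (x - h * sumΛ Λ (i + 1) + 2 * h * (w.length : ℂ)) :: w ∧
      ∀ k ∈ w, ∃ i ℓ, k = weightLetter f h Λ p i ℓ := by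
  induction m with
  | zero => exact absurd (fun i hi => absurd hi (by omega)) hy
  | succ m ih =>
    rw [weightWord]
    cases hm : y m with
    | zero =>
      rw [row, List.nil_append]
      refine ih fun hall => hy fun i hi hi0 => ?_
      rcases Nat.lt_succ_iff_lt_or_eq.1 hi with hi | rfl
      exacts [hall i hi hi0, hm]
    | succ k =>
      cases m with
      | zero => exact absurd (fun i hi hi0 => absurd hi (by omega)) hy
      | succ m =>
        refine ⟨m, row h (weightLetter f h Λ p (m + 1)) k (siteParam h Λ x y (m + 1)) ++
          weightWord f h Λ p x y (m + 1), ?_, ?_⟩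
        · rw [row, List.cons_append]
          congr 2
          rw [List.length_append, length_row, length_weightWord, siteParam]
          push_cast
          ring
        · intro g hg
          rcases List.mem_append.1 hg with hg | hg
          · exact ⟨_, mem_row hg⟩
          · exact mem_weightWord hg

/-- The empty partition function of a configuration which is not concentrated at the site `0`. -/
theorem nestedIntegral_weightWord_eq_zero (hf : SigmaLike f) (hD : IsCell f D)
    (hpD : ∀ j, p j ∈ D) (hp : ∀ j, p j ∈ P) (x : ℂ) {y : ℕ → ℕ} {m : ℕ}
    (hy : ¬ ∀ i < m, 0 < i → y i = 0) (H : IsTower h D P Q Γ)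
    (hc : ∀ γ ∈ Γ, ∀ u ∈ γ.closedRegion, f (u - (p 0 + h * Λ 0)) ≠ 0) :
    nestedIntegral f h Γ (weightWord f h Λ p x y m)
      (vacuumFactor f h x (p 0 + h * Λ 0) Γ.length) = 0 := by
  by_cases hl : (weightWord f h Λ p x y m).length = Γ.length
  swap
  · exact nestedIntegral_eq_zero_of_length hl
  obtain ⟨i, w, hw, hk⟩ := exists_weightWord_eq_cons (f := f) (h := h) (Λ := Λ) (p := p) (x := x) hy
  rw [hw] at hl ⊢
  cases Γ with
  | nil => simp at hl
  | cons γ Γ =>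
    have hl' : w.length = Γ.length := by simpa using hl
    rw [hl']
    refine nestedIntegral_cons_eq_zero hf hD hp x i w H (fun k hkw => ?_) hc
    obtain ⟨i, ℓ, rfl⟩ := hk k hkw
    exact Mer.weightLetter hf hD hpD hp i ℓ

/-- The empty partition function of the configuration concentrated at the site `0`. -/
theorem siteNorm_mul_nestedIntegral_row (hf : SigmaLike f) (hD : IsCell f D)
    (hpD : ∀ j, p j ∈ D) (hp : ∀ j, p j ∈ P) (x : ℂ) (H : IsTower h D P Q Γ)
    (hc : ∀ γ ∈ Γ, ∀ u ∈ γ.closedRegion, f (u - (p 0 + h * Λ 0)) ≠ 0)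
    (h1 : ∀ j < Γ.length, f (x + h * (1 + j)) ≠ 0)
    (h2 : ∀ j < Γ.length, f (x + h * (Γ.length + j) - h * Λ 0) ≠ 0) :
    siteNorm f h (Λ 0) Γ.length x * nestedIntegral f h Γ
      (row h (weightLetter f h Λ p 0) Γ.length x)
      (vacuumFactor f h x (p 0 + h * Λ 0) Γ.length) = (-1 / deriv f 0) ^ Γ.length := by
  rw [nestedIntegral_row_zero hf hD hpD hp x H hc]
  -- This nonvanishing comes from the position of q_0 relative to the contours, not from genericity
  -- of x.
  have hne : ∀ j ∈ Finset.range Γ.length, f (h * (Λ 0 - j)) ≠ 0 := by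
    intro j hj
    have := H.ne_zero_sub hf (hp 0) hc (Finset.mem_range.1 hj)
    rwa [show p 0 + h * Λ 0 - h * j - p 0 = h * (Λ 0 - j) by ring] at this
  set N := Γ.length with hN
  have e : ∀ i ∈ Finset.range N, 1 / deriv f 0 * (f (x + h * (N - i)) *
      f (p 0 + h * Λ 0 - h * i - p 0 - x - h * (2 * (N - i) - 1)) /
        f (p 0 + h * Λ 0 - h * i - p 0)) = -1 / deriv f 0 * (1 / f (h * (Λ 0 - i))) *
      (fun j : ℕ => f (x + h * (1 + j)) * f (x + h * (N + j) - h * Λ 0)) (N - 1 - i) := by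
    intro i hi
    rw [Finset.mem_range] at hi
    have hsub : ((N - 1 - i : ℕ) : ℂ) = N - 1 - i := by
      rw [Nat.cast_sub (by omega), Nat.cast_sub (by omega), Nat.cast_one]
    simp only [hsub]
    rw [show p 0 + h * Λ 0 - h * i - p 0 - x - h * (2 * (N - i) - 1) =
        -(x + h * (N + (N - 1 - i)) - h * Λ 0) by ring, hf.odd,
      show p 0 + h * Λ 0 - h * i - p 0 = h * (Λ 0 - i) by ring,
      show x + h * (1 + (N - 1 - i)) = x + h * (N - i) by ring]
    ring
  -- The residues appear in the order opposite to the factors of the norm, whence the reflection of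
  -- the product.
  rw [Finset.prod_congr rfl e, Finset.prod_mul_distrib, Finset.prod_mul_distrib,
    Finset.prod_range_reflect
      (fun j : ℕ => f (x + h * (1 + j)) * f (x + h * (N + j) - h * Λ 0)) N, Finset.prod_const, Finset.card_range, siteNorm]
  have e1 : (∏ j ∈ Finset.range N, f (h * (Λ 0 - j)) /
      (f (x + h * (N + j) - h * Λ 0) * f (x + h * (1 + j)))) *
      ((∏ j ∈ Finset.range N, 1 / f (h * (Λ 0 - j))) *
        ∏ j ∈ Finset.range N, f (x + h * (1 + j)) * f (x + h * (N + j) - h * Λ 0)) = 1 := by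
    rw [← Finset.prod_mul_distrib, ← Finset.prod_mul_distrib, Finset.prod_eq_one]
    intro j hj
    have a1 := hne j hj
    have a2 := h1 j (Finset.mem_range.1 hj)
    have a3 := h2 j (Finset.mem_range.1 hj)
    field_simp
  linear_combination (-1 / deriv f 0) ^ N * e1

end Vacuum

/-! ### Site letters and their one- and two-body relations -/

section SiteLetter
variable {f : ℂ → ℂ} {h : ℂ} {Λ p : ℕ → ℂ} {D P Q : Set ℂ} {Γ : List Contour} {γ : Contour}

/-- The one-parameter family of letters at the site `m` for the spectral parameter `v`. -/
noncomputable def siteLetter (f : ℂ → ℂ) (h : ℂ) (Λ p : ℕ → ℂ) (v : ℂ) (m : ℕ) (c ℓ u : ℂ) : ℂ :=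
  sitePrefix f h Λ p m u * (1 / f (u - p m) * (1 / f (u - v))) *
    (f (u - c) * f (ℓ + h + p m + v - c - u))

theorem Mer.sitePrefix_mul (hf : SigmaLike f) (hD : IsCell f D) (hpD : ∀ j, p j ∈ D)
    (hp : ∀ j, p j ∈ P) {v : ℂ} (hvD : v ∈ D) (hv : v ∈ Q) (m : ℕ) :
    Mer D (P ∪ Q) fun u => EllipticIRF.sitePrefix f h Λ p m u *
      (1 / f (u - p m) * (1 / f (u - v))) := by
  have h1 : Mer D (P ∪ Q) fun _ => (1 : ℂ) := .of_differentiable (by fun_prop)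
  exact (Mer.sitePrefix hf hD hpD hp m).mul
    ((h1.div hf hD fun s hs h0 => Or.inl (hD.inj s hs _ (hpD m) h0 ▸ hp m)).mul
      (h1.div hf hD fun s hs h0 => Or.inr (hD.inj s hs _ hvD h0 ▸ hv)))

theorem Mer.siteLetter (hf : SigmaLike f) (hD : IsCell f D) (hpD : ∀ j, p j ∈ D)
    (hp : ∀ j, p j ∈ P) {v : ℂ} (hvD : v ∈ D) (hv : v ∈ Q) (m : ℕ) (c ℓ : ℂ) :
    Mer D (P ∪ Q) (siteLetter f h Λ p v m c ℓ) :=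
  (Mer.sitePrefix_mul hf hD hpD hp hvD hv m).mul
    ((Mer.f_comp hf (by fun_prop)).mul (Mer.f_comp hf (by fun_prop)))

theorem IsTower.f_sub_ne_zero (hD : IsCell f D) (H : IsTower h D P Q Γ) {b : ℂ} (hbD : b ∈ D)
    (hb : b ∈ P ∪ Q) (hγ : γ ∈ Γ) {u : ℂ} (hu : u ∈ γ.trace) : f (u - b) ≠ 0 := by
  intro h0
  have := hD.inj u (H.trace_subset γ hγ hu) b hbD h0
  subst this
  rcases hb with hb | hb
  · exact (H.inside γ hγ hb).1 hu
  · exact (H.outside γ hγ hb).1 hu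

/-- On the contours, `Z_v` is the weight function. -/
theorem siteLetter_self_eq (hD : IsCell f D) (H : IsTower h D P Q Γ) {v : ℂ} (hvD : v ∈ D)
    (hv : v ∈ Q) (m : ℕ) (ℓ : ℂ) (hγ : γ ∈ Γ) {u : ℂ} (hu : u ∈ γ.trace) :
    siteLetter f h Λ p v m v ℓ u = weightLetter f h Λ p m ℓ u := by
  have := H.f_sub_ne_zero hD hvD (Or.inr hv) hγ hu
  rw [siteLetter, weightLetter, show ℓ + h + p m + v - v - u = ℓ + h + p m - u by ring]
  field_simp

/-- The letter `Z_{q_m}` at the site `m` is the letter `Z_{p_{m+1}}` at the site `m + 1`. -/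
theorem siteLetter_succ (hD : IsCell f D) (hpD : ∀ j, p j ∈ D) (hp : ∀ j, p j ∈ P)
    (H : IsTower h D P Q Γ) {v : ℂ} (m : ℕ) (ℓ : ℂ) (hγ : γ ∈ Γ) {u : ℂ} (hu : u ∈ γ.trace) :
    siteLetter f h Λ p v (m + 1) (p (m + 1)) ℓ u =
      siteLetter f h Λ p v m (p m + h * Λ m) (ℓ + h * Λ m) u := by
  have h1 := H.f_sub_ne_zero hD (hpD (m + 1)) (Or.inl (hp _)) hγ hu
  rw [siteLetter, siteLetter, sitePrefix, Finset.prod_range_succ, ← sitePrefix,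
    show ℓ + h + p (m + 1) + v - p (m + 1) - u = ℓ + h + v - u by ring,
    show ℓ + h * Λ m + h + p m + v - (p m + h * Λ m) - u = ℓ + h + v - u by ring]
  field_simp

/-- The one-body relation. -/
theorem siteLetter_eq (hf : SigmaLike f) {v ℓ : ℂ} {m : ℕ} (hpv : f (p m - v) ≠ 0)
    (hℓ : f (ℓ + h) ≠ 0) (c u : ℂ) :
    siteLetter f h Λ p v m c ℓ u =
      f (p m - c) * f (ℓ + h + v - c) / (f (ℓ + h) * f (p m - v)) *
        siteLetter f h Λ p v m v ℓ u -
      f (v - c) * f (ℓ + h + p m - c) / (f (ℓ + h) * f (p m - v)) *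
        siteLetter f h Λ p v m (p m) ℓ u := by
  have h3 := hf.three_term (u - (ℓ + h + p m + v) / 2) ((ℓ + h + p m + v) / 2 - c)
    ((ℓ + h + p m - v) / 2) ((ℓ + h + v - p m) / 2)
  rw [show u - (ℓ + h + p m + v) / 2 + ((ℓ + h + p m + v) / 2 - c) = u - c by ring,
    show u - (ℓ + h + p m + v) / 2 - ((ℓ + h + p m + v) / 2 - c) = -(ℓ + h + p m + v - c - u) by
      ring,
    show (ℓ + h + p m - v) / 2 + (ℓ + h + v - p m) / 2 = ℓ + h by ring,
    show (ℓ + h + p m - v) / 2 - (ℓ + h + v - p m) / 2 = p m - v by ring,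
    show u - (ℓ + h + p m + v) / 2 + (ℓ + h + p m - v) / 2 = u - v by ring,
    show u - (ℓ + h + p m + v) / 2 - (ℓ + h + p m - v) / 2 = -(ℓ + h + p m - u) by ring,
    show (ℓ + h + p m + v) / 2 - c + (ℓ + h + v - p m) / 2 = ℓ + h + v - c by ring,
    show (ℓ + h + p m + v) / 2 - c - (ℓ + h + v - p m) / 2 = p m - c by ring,
    show u - (ℓ + h + p m + v) / 2 + (ℓ + h + v - p m) / 2 = u - p m by ring,
    show u - (ℓ + h + p m + v) / 2 - (ℓ + h + v - p m) / 2 = -(ℓ + h + v - u) by ring,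
    show (ℓ + h + p m + v) / 2 - c + (ℓ + h + p m - v) / 2 = ℓ + h + p m - c by ring,
    show (ℓ + h + p m + v) / 2 - c - (ℓ + h + p m - v) / 2 = v - c by ring,
    hf.odd, hf.odd, hf.odd] at h3
  simp only [siteLetter]
  rw [show ℓ + h + p m + v - v - u = ℓ + h + p m - u by ring,
    show ℓ + h + p m + v - p m - u = ℓ + h + v - u by ring]
  generalize sitePrefix f h Λ p m u * (1 / f (u - p m) * (1 / f (u - v))) = K
  field_simp
  linear_combination -K * h3

/-- The two-body relation. -/
theorem siteLetter_mul_sub (hf : SigmaLike f) (v ℓ : ℂ) (m : ℕ) (c u w : ℂ) :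
    siteLetter f h Λ p v m c (ℓ + 2 * h) u * siteLetter f h Λ p v m (v - h) ℓ w -
      siteLetter f h Λ p v m v (ℓ + 2 * h) u * siteLetter f h Λ p v m (c - h) ℓ w =
    f (u - w - h) * (-(f (v - c) * f (ℓ + 3 * h + p m - c)) *
      f (ℓ + 2 * h + p m + v - u - w) *
      (sitePrefix f h Λ p m u * (1 / f (u - p m) * (1 / f (u - v))) *
        (sitePrefix f h Λ p m w * (1 / f (w - p m) * (1 / f (w - v)))))) := by
  have h3 := hf.three_term (u - (ℓ + 3 * h + p m + v) / 2) ((ℓ + 3 * h + p m + v) / 2 - c)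
    ((ℓ + 3 * h + p m + v) / 2 - v) (w + h - (ℓ + 3 * h + p m + v) / 2)
  rw [show u - (ℓ + 3 * h + p m + v) / 2 + ((ℓ + 3 * h + p m + v) / 2 - c) = u - c by ring,
    show u - (ℓ + 3 * h + p m + v) / 2 - ((ℓ + 3 * h + p m + v) / 2 - c) =
      -(ℓ + 2 * h + h + p m + v - c - u) by ring,
    show (ℓ + 3 * h + p m + v) / 2 - v + (w + h - (ℓ + 3 * h + p m + v) / 2) = w - (v - h) by ring,
    show (ℓ + 3 * h + p m + v) / 2 - v - (w + h - (ℓ + 3 * h + p m + v) / 2) =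
      ℓ + h + p m + v - (v - h) - w by ring,
    show u - (ℓ + 3 * h + p m + v) / 2 + ((ℓ + 3 * h + p m + v) / 2 - v) = u - v by ring,
    show u - (ℓ + 3 * h + p m + v) / 2 - ((ℓ + 3 * h + p m + v) / 2 - v) =
      -(ℓ + 2 * h + h + p m + v - v - u) by ring,
    show (ℓ + 3 * h + p m + v) / 2 - c + (w + h - (ℓ + 3 * h + p m + v) / 2) = w - (c - h) by ring,
    show (ℓ + 3 * h + p m + v) / 2 - c - (w + h - (ℓ + 3 * h + p m + v) / 2) =
      ℓ + h + p m + v - (c - h) - w by ring,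
    show u - (ℓ + 3 * h + p m + v) / 2 + (w + h - (ℓ + 3 * h + p m + v) / 2) =
      -(ℓ + 2 * h + p m + v - u - w) by ring,
    show u - (ℓ + 3 * h + p m + v) / 2 - (w + h - (ℓ + 3 * h + p m + v) / 2) = u - w - h by ring,
    show (ℓ + 3 * h + p m + v) / 2 - c + ((ℓ + 3 * h + p m + v) / 2 - v) = ℓ + 3 * h + p m - c by
      ring,
    show (ℓ + 3 * h + p m + v) / 2 - c - ((ℓ + 3 * h + p m + v) / 2 - v) = v - c by ring,
    hf.odd, hf.odd, hf.odd] at h3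
  simp only [siteLetter]
  generalize sitePrefix f h Λ p m u * (1 / f (u - p m) * (1 / f (u - v))) = K
  generalize sitePrefix f h Λ p m w * (1 / f (w - p m) * (1 / f (w - v))) = K'
  linear_combination -K * K' * h3
end SiteLetter

theorem Contour.integral_linear {γ : Contour} {F G : ℂ → ℂ} (hF : ContinuousOn F γ.trace)
    (hG : ContinuousOn G γ.trace) (a b : ℂ) :
    contourIntegral γ.toFun (fun u => a * F u + b * G u) =
      a * contourIntegral γ.toFun F + b * contourIntegral γ.toFun G := by
  rw [← Contour.integral_const_mul, ← Contour.integral_const_mul]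
  exact Contour.integral_add (continuousOn_const.mul hF) (continuousOn_const.mul hG)

/-! ### Moving letters inside nested integrals -/

section Exchange
variable {f : ℂ → ℂ} {h : ℂ} {Λ p : ℕ → ℂ} {D P Q : Set ℂ} {Γ : List Contour} {γ : Contour} {v : ℂ}

/-- A spectral parameter `v` outside of the contours, and points `p_j` inside. -/
structure SiteData (f : ℂ → ℂ) (D P Q : Set ℂ) (p : ℕ → ℂ) (v : ℂ) : Prop where
  sigma : SigmaLike f
  cell : IsCell f D
  p_mem : ∀ j, p j ∈ D
  p_inside : ∀ j, p j ∈ P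
  v_mem : v ∈ D
  v_outside : v ∈ Q
  p_sub_v : ∀ j, f (p j - v) ≠ 0

theorem SiteData.weightLetter (S : SiteData f D P Q p v) (m : ℕ) (ℓ : ℂ) :
    Mer D (P ∪ Q) (weightLetter f h Λ p m ℓ) :=
  Mer.weightLetter S.sigma S.cell S.p_mem S.p_inside m ℓ

theorem SiteData.siteLetter (S : SiteData f D P Q p v) (m : ℕ) (c ℓ : ℂ) :
    Mer D (P ∪ Q) (siteLetter f h Λ p v m c ℓ) :=
  Mer.siteLetter S.sigma S.cell S.p_mem S.p_inside S.v_mem S.v_outside m c ℓ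

theorem SiteData.row_siteLetter (S : SiteData f D P Q p v) {m k : ℕ} {c ℓ : ℂ} :
    ∀ g ∈ row h (EllipticIRF.siteLetter f h Λ p v m c) k ℓ, Mer D (P ∪ Q) g := by
  intro g hg
  obtain ⟨ℓ', rfl⟩ := mem_row hg
  exact S.siteLetter m c ℓ'

theorem SiteData.row_weightLetter (S : SiteData f D P Q p v) {m k : ℕ} {ℓ : ℂ} :
    ∀ g ∈ row h (EllipticIRF.weightLetter f h Λ p m) k ℓ, Mer D (P ∪ Q) g := by
  intro g hg
  obtain ⟨ℓ', rfl⟩ := mem_row hg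
  exact S.weightLetter m ℓ'

theorem SiteData.weightWord (S : SiteData f D P Q p v) {x : ℂ} {y : ℕ → ℕ} {m : ℕ} :
    ∀ g ∈ weightWord f h Λ p x y m, Mer D (P ∪ Q) g := by
  intro g hg
  obtain ⟨i, ℓ, rfl⟩ := mem_weightWord hg
  exact S.weightLetter i ℓ

theorem forall₂_refl_of {R : (ℂ → ℂ) → (ℂ → ℂ) → Prop} (hR : ∀ k, R k k) (w : List (ℂ → ℂ)) :
    List.Forall₂ R w w :=
  List.forall₂_same.2 fun k _ => hR k

/-- On the contours, `Z_v` may be replaced by the weight function. -/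
theorem nestedIntegral_row_siteLetter_self (S : SiteData f D P Q p v) (m k : ℕ) (ℓ : ℂ)
    (w : List (ℂ → ℂ)) (φ : ℂ → ℂ) (H : IsTower h D P Q Γ) :
    nestedIntegral f h Γ (row h (siteLetter f h Λ p v m v) k ℓ ++ w) φ =
      nestedIntegral f h Γ (row h (weightLetter f h Λ p m) k ℓ ++ w) φ := by
  refine nestedIntegral_congr (List.rel_append ?_ (forall₂_refl_of (fun k _ _ _ _ => rfl) w))
  have := forall₂_row (h := h) (Z := siteLetter f h Λ p v m v) (Z' := weightLetter f h Λ p m)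
    (a := 0) (R := fun k k' => ∀ γ ∈ Γ, ∀ u ∈ γ.trace, k u * φ u = k' u * φ u)
    (fun ℓ γ hγ u hu => by
      rw [add_zero, siteLetter_self_eq S.cell H S.v_mem S.v_outside m ℓ hγ hu]) k ℓ
  rwa [add_zero] at this

/-- Moving a letter through a row. -/
theorem nestedIntegral_siteLetter_row (S : SiteData f D P Q p v) (m k : ℕ) (c ℓ : ℂ)
    (w : List (ℂ → ℂ)) (hw : ∀ g ∈ w, Mer D (P ∪ Q) g) {φ : ℂ → ℂ} (H : IsTower h D P Q Γ)
    (hφ : Mer D (outsideAll Γ) φ) :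
    nestedIntegral f h Γ (siteLetter f h Λ p v m c (ℓ + 2 * h * k) ::
      (row h (siteLetter f h Λ p v m (v - h)) k ℓ ++ w)) φ =
    nestedIntegral f h Γ (row h (weightLetter f h Λ p m) k (ℓ + 2 * h) ++
      siteLetter f h Λ p v m (c - h * k) ℓ :: w) φ := by
  rw [← nestedIntegral_row_siteLetter_self S m k _ _ φ H]
  induction k generalizing c Γ φ with
  | zero => simp [row]
  -- One exchange turns the pair Z_c, Z_{v-h} into Z_v, Z_{c-h}: the letter left behind is a weight
  -- function with parameter raised by 2h, and the moving letter continues with c - h.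
  | succ k ih =>
    rw [row, row, List.cons_append, List.cons_append,
      show ℓ + 2 * h * (k + 1 : ℕ) = ℓ + 2 * h * k + 2 * h by push_cast; ring,
      nestedIntegral_exchange S.sigma S.cell (S.siteLetter m _ _) (S.siteLetter m _ _)
        (S.siteLetter m _ _) (S.siteLetter m _ _)
        (Mer.sitePrefix_mul S.sigma S.cell S.p_mem S.p_inside S.v_mem S.v_outside m) _ _
        (siteLetter_mul_sub S.sigma v (ℓ + 2 * h * k) m c) _ (by
          intro g hg
          rcases List.mem_append.1 hg with hg | hg
          exacts [S.row_siteLetter g hg, hw g hg]) H hφ]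
    have := nestedIntegral_append_congr S.sigma S.cell (P := P) (Q := Q) (h := h)
      (w := siteLetter f h Λ p v m (c - h) (ℓ + 2 * h * k) ::
        (row h (siteLetter f h Λ p v m (v - h)) k ℓ ++ w))
      (w' := row h (siteLetter f h Λ p v m v) k (ℓ + 2 * h) ++
        siteLetter f h Λ p v m (c - h - h * k) ℓ :: w) ?_ ?_
      (fun Γ φ H hφ => ih (c - h) H hφ) [siteLetter f h Λ p v m v (ℓ + 2 * h * k + 2 * h)]
      (by simpa using S.siteLetter m _ _) H hφ
    · rw [List.singleton_append, List.singleton_append] at this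
      rw [this]
      congr 2
      · congr 1; ring
      · congr 3; push_cast; ring
    · intro g hg
      simp only [List.mem_cons, List.mem_append] at hg
      rcases hg with rfl | hg | hg
      exacts [S.siteLetter m _ _, S.row_siteLetter g hg, hw g hg]
    · intro g hg
      simp only [List.mem_cons, List.mem_append] at hg
      rcases hg with hg | rfl | hg
      exacts [S.row_siteLetter g hg, S.siteLetter m _ _, hw g hg]

/-- The one-body relation inside a nested integral. -/
theorem nestedIntegral_siteLetter_eq (S : SiteData f D P Q p v) (m : ℕ) (c : ℂ) {ℓ : ℂ}
    (hℓ : f (ℓ + h) ≠ 0) (pre w : List (ℂ → ℂ)) (hpre : ∀ g ∈ pre, Mer D (P ∪ Q) g)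
    (hw : ∀ g ∈ w, Mer D (P ∪ Q) g) {φ : ℂ → ℂ} (H : IsTower h D P Q Γ)
    (hφ : Mer D (outsideAll Γ) φ) :
    nestedIntegral f h Γ (pre ++ siteLetter f h Λ p v m c ℓ :: w) φ =
      f (p m - c) * f (ℓ + h + v - c) / (f (ℓ + h) * f (p m - v)) *
        nestedIntegral f h Γ (pre ++ weightLetter f h Λ p m ℓ :: w) φ -
      f (v - c) * f (ℓ + h + p m - c) / (f (ℓ + h) * f (p m - v)) *
        nestedIntegral f h Γ (pre ++ siteLetter f h Λ p v m (p m) ℓ :: w) φ := by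
  have key := sum_nestedIntegral_append S.sigma S.cell (P := P) (Q := Q) (h := h)
    (Finset.univ : Finset Unit) (Finset.univ : Finset (Fin 2)) (fun _ => 1)
    ![f (p m - c) * f (ℓ + h + v - c) / (f (ℓ + h) * f (p m - v)),
      -(f (v - c) * f (ℓ + h + p m - c) / (f (ℓ + h) * f (p m - v)))]
    (fun _ => siteLetter f h Λ p v m c ℓ :: w)
    ![weightLetter f h Λ p m ℓ :: w, siteLetter f h Λ p v m (p m) ℓ :: w] ?_ ?_ ?_ pre hpre H hφ
  · simpa [Fin.sum_univ_two, sub_eq_add_neg] using key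
  · intro _ _ g hg
    rcases List.mem_cons.1 hg with rfl | hg
    exacts [S.siteLetter m _ _, hw g hg]
  · intro i _ g hg
    fin_cases i
    · rcases List.mem_cons.1 hg with rfl | hg
      exacts [S.weightLetter m _, hw g hg]
    · rcases List.mem_cons.1 hg with rfl | hg
      exacts [S.siteLetter m _ _, hw g hg]
  · intro Γ φ H hφ
    simp only [Finset.univ_unique, Finset.sum_singleton, one_mul, Fin.sum_univ_two,
      Matrix.cons_val_zero, Matrix.cons_val_one]
    rcases Γ with _ | ⟨γ, Γ⟩
    · simp [nestedIntegral]
    have hψ : ContinuousOn (weightLetter f h Λ p m ℓ) γ.trace :=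
      H.continuousOn_letter (S.weightLetter m ℓ) (by simp)
    have hX : ContinuousOn (siteLetter f h Λ p v m (p m) ℓ) γ.trace :=
      H.continuousOn_letter (S.siteLetter m _ ℓ) (by simp)
    have hφ' : ContinuousOn φ γ.trace := hφ.continuousOn_trace (by simp) H.head_trace
    have hJ := continuousOn_nestedIntegral_cross S.sigma S.cell w H hw hφ.tail
    simp only [nestedIntegral]
    rw [mul_left_comm, mul_left_comm (-_), ← mul_add]
    refine Eq.trans ?_ (congrArg ((2 * Real.pi * I)⁻¹ * ·)
      (Contour.integral_linear ((hψ.mul hφ').mul hJ) ((hX.mul hφ').mul hJ) _ _))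
    congr 1
    refine Contour.integral_congr fun u hu => ?_
    rw [siteLetter_eq S.sigma (S.p_sub_v m) hℓ c u,
      siteLetter_self_eq S.cell H S.v_mem S.v_outside m ℓ (γ := γ) (by simp) hu]
    simp only [Pi.mul_apply]
    ring

/-- The letter `Z_{p_0}` integrates to zero. -/
theorem nestedIntegral_siteLetter_zero (S : SiteData f D P Q p v) (ℓ : ℂ) {φ : ℂ → ℂ}
    (H : IsTower h D P Q Γ) (hφ : Mer D (outsideAll Γ) φ) :
    nestedIntegral f h Γ [siteLetter f h Λ p v 0 (p 0) ℓ] φ = 0 := by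
  rcases Γ with _ | ⟨γ, _ | ⟨δ, Γ⟩⟩
  · simp only [nestedIntegral]
  · simp only [nestedIntegral, mul_one]
    -- At site 0 the numerator f(u-p_0) cancels the only pole inside the contour.
    have hm : Mer D γ.outside fun u => f (ℓ + h + v - u) / f (u - v) * φ u := by
      refine (Mer.div S.sigma S.cell (Mer.f_comp S.sigma (by fun_prop)) fun s hs h0 => ?_).mul
        (hφ.mono fun s hs => hs γ (by simp))
      rw [S.cell.inj s hs v S.v_mem h0]
      exact H.outside γ (by simp) S.v_outside
    rw [Contour.integral_congr (G := fun u => f (ℓ + h + v - u) / f (u - v) * φ u),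
      hm.integral_eq_zero S.cell.convex H.head_trace subset_rfl, mul_zero]
    intro u hu
    have h1 := H.f_sub_ne_zero S.cell (S.p_mem 0) (Or.inl (S.p_inside 0)) (γ := γ) (by simp) hu
    rw [siteLetter, sitePrefix, Finset.range_zero, Finset.prod_empty,
      show ℓ + h + p 0 + v - p 0 - u = ℓ + h + v - u by ring]
    field_simp
  · simp only [nestedIntegral, mul_zero, Contour.integral_zero]

end Exchange

/-! ### Recursions for the norm at one site -/

section Norm
variable {f : ℂ → ℂ} {h S ℓ : ℂ}

/-- Both denominators are products over consecutive arguments, so a shift of ℓ by h changes only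
their first and last factors. -/
theorem siteNorm_add (f : ℂ → ℂ) (h S : ℂ) (k : ℕ) {ℓ : ℂ}
    (h1 : ∀ j : ℕ, j ≤ 2 * k → f (ℓ + h * j - h * S) ≠ 0)
    (h2 : ∀ j : ℕ, j ≤ k + 1 → f (ℓ + h * j) ≠ 0) :
    siteNorm f h S k ℓ * (f (ℓ + h * k - h * S) * f (ℓ + h)) =
      siteNorm f h S k (ℓ + h) * (f (ℓ + 2 * h * k - h * S) * f (ℓ + h + h * k)) := by
  set B : ℕ → ℂ := fun j => f (ℓ + h * (k + j : ℕ) - h * S) with hB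
  set C : ℕ → ℂ := fun j => f (ℓ + h * (1 + j : ℕ)) with hC
  have t : ∀ F : ℕ → ℂ, (∏ j ∈ Finset.range k, F (j + 1)) * F 0 =
      (∏ j ∈ Finset.range k, F j) * F k := fun F => by
    rw [← Finset.prod_range_succ', Finset.prod_range_succ]
  have e1 : siteNorm f h S k ℓ = (∏ j ∈ Finset.range k, f (h * (S - j))) /
      ((∏ j ∈ Finset.range k, B j) * ∏ j ∈ Finset.range k, C j) := by
    rw [siteNorm, Finset.prod_div_distrib, Finset.prod_mul_distrib]
    simp only [hB, hC, Nat.cast_add, Nat.cast_one]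
  have e2 : siteNorm f h S k (ℓ + h) = (∏ j ∈ Finset.range k, f (h * (S - j))) /
      ((∏ j ∈ Finset.range k, B (j + 1)) * ∏ j ∈ Finset.range k, C (j + 1)) := by
    rw [siteNorm, Finset.prod_div_distrib, Finset.prod_mul_distrib]
    congr 2
    · refine Finset.prod_congr rfl fun j _ => ?_
      simp only [hB]; congr 1; push_cast; ring
    · refine Finset.prod_congr rfl fun j _ => ?_
      simp only [hC]; congr 1; push_cast; ring
  have b0 : f (ℓ + h * k - h * S) = B 0 := by simp [hB]
  have c0 : f (ℓ + h) = C 0 := by simp [hC]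
  have bk : f (ℓ + 2 * h * k - h * S) = B k := by
    simp only [hB]; congr 1; push_cast; ring
  have ck : f (ℓ + h + h * k) = C k := by
    simp only [hC]; congr 1; push_cast; ring
  have nB : ∀ j ≤ k, B j ≠ 0 := fun j hj => h1 (k + j) (by omega)
  have nC : ∀ j ≤ k, C j ≠ 0 := fun j hj => h2 (1 + j) (by omega)
  have n1 : ∏ j ∈ Finset.range k, B j ≠ 0 := Finset.prod_ne_zero_iff.2 fun j hj =>
    nB j (Finset.mem_range.1 hj).le
  have n2 : ∏ j ∈ Finset.range k, C j ≠ 0 := Finset.prod_ne_zero_iff.2 fun j hj =>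
    nC j (Finset.mem_range.1 hj).le
  have n3 : ∏ j ∈ Finset.range k, B (j + 1) ≠ 0 := Finset.prod_ne_zero_iff.2 fun j hj =>
    nB _ (Finset.mem_range.1 hj)
  have n4 : ∏ j ∈ Finset.range k, C (j + 1) ≠ 0 := Finset.prod_ne_zero_iff.2 fun j hj =>
    nC _ (Finset.mem_range.1 hj)
  rw [e1, e2, b0, c0, bk, ck, div_mul_eq_mul_div, div_mul_eq_mul_div,
    div_eq_div_iff (mul_ne_zero n1 n2) (mul_ne_zero n3 n4)]
  linear_combination (∏ j ∈ Finset.range k, f (h * (S - j))) *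
    ((∏ j ∈ Finset.range k, C (j + 1)) * C 0 * t B + (∏ j ∈ Finset.range k, B j) * B k * t C)

/-- Adding a particle and lowering ℓ by h keeps the starting argument of one product and extends the
other by one factor at its beginning; the remaining factors agree. -/
theorem siteNorm_succ (f : ℂ → ℂ) (h S : ℂ) (k : ℕ) {ℓ : ℂ}
    (h1 : f (ℓ + 2 * h * (k + 1) - h * S) ≠ 0) (h2 : f (ℓ + 2 * h) ≠ 0) :
    f (h * (S - k)) * siteNorm f h S k (ℓ + 2 * h) =
      f (ℓ + 2 * h) * f (ℓ + 2 * h * (k + 1) - h * S) * siteNorm f h S (k + 1) (ℓ + h) := by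
  simp only [siteNorm, Finset.prod_div_distrib, Finset.prod_mul_distrib]
  rw [Finset.prod_range_succ, Finset.prod_range_succ _ k,
    Finset.prod_range_succ' (fun j : ℕ => f (ℓ + h + h * (1 + j)))]
  have e1 : ∀ j : ℕ, ℓ + h + h * ((k + 1 : ℕ) + j) - h * S = ℓ + 2 * h + h * (k + j) - h * S :=
    fun j => by push_cast; ring
  have e2 : ∀ j : ℕ, ℓ + h + h * (1 + (j + 1 : ℕ)) = ℓ + 2 * h + h * (1 + j) :=
    fun j => by push_cast; ring
  simp only [e1, e2]
  rw [show ℓ + 2 * h + h * (k + k) - h * S = ℓ + 2 * h * (k + 1) - h * S by ring,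
    show ℓ + h + h * (1 + (0 : ℕ)) = ℓ + 2 * h by push_cast; ring]
  generalize f (ℓ + 2 * h) = a at *
  generalize f (ℓ + 2 * h * (k + 1) - h * S) = b at *
  field_simp

end Norm

/-! ### Matrix elements of the transfer operators -/

section Entries
variable {f : ℂ → ℂ} {η : ℂ} {Λ z : ℕ → ℂ} {v : ℂ} {m : ℕ}

theorem qPt_eq (η : ℂ) (Λ z : ℕ → ℂ) (j : ℕ) : qPt η Λ z j = pPt η Λ z j + 2 * η * Λ j := by
  rw [qPt, pPt]; ring

theorem evalL_zero_zero (ℓ : ℂ) (k l : ℕ) :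
    evalL f η (Λ m) (z m) (f (z m - v + (-Λ m + 1) * η)) ℓ v k l 0 0 = if l = k then
      f (pPt η Λ z m + 2 * η * Λ m - v - 2 * η * k) / f (pPt η Λ z m - v) *
        (f (ℓ + 2 * η * k) / f ℓ) else 0 := by
  simp only [evalL, pPt, Matrix.of_apply, Matrix.cons_val_zero, Matrix.cons_val', ]
  congr 5 <;> ring

theorem evalL_zero_one (hf : SigmaLike f) (ℓ : ℂ) (k l : ℕ) :
    evalL f η (Λ m) (z m) (f (z m - v + (-Λ m + 1) * η)) ℓ v k l 0 1 = if l = k + 1 then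
      f (ℓ + 2 * η + v - (pPt η Λ z m + 2 * η * Λ m) + 2 * η * k) / f (pPt η Λ z m - v) *
        (f (2 * η) / f ℓ) else 0 := by
  simp only [evalL, pPt, Matrix.of_apply, Matrix.cons_val_zero, Matrix.cons_val_one,
    Matrix.cons_val']
  rw [show -ℓ + z m - v + (Λ m - 1 - 2 * k) * η =
    -(ℓ + 2 * η + v - (z m + (1 - Λ m) * η + 2 * η * Λ m) + 2 * η * k) by ring, hf.odd,
    show z m - v + (-Λ m + 1) * η = z m + (1 - Λ m) * η - v by ring]
  congr 1
  ring

theorem evalL_one_zero (hf : SigmaLike f) (ℓ : ℂ) (k l : ℕ) :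
    evalL f η (Λ m) (z m) (f (z m - v + (-Λ m + 1) * η)) ℓ v k l 1 0 = if l + 1 = k then
      f (ℓ + pPt η Λ z m - v + 2 * η * l) / f (pPt η Λ z m - v) *
        (f (2 * η * (Λ m - l)) / f ℓ) * (f (2 * η * (l + 1)) / f (2 * η)) else 0 := by
  simp only [evalL, pPt, Matrix.of_apply, Matrix.cons_val_zero, Matrix.cons_val_one,
    Matrix.cons_val']
  split_ifs with hkl
  · subst hkl
    push_cast
    rw [show -ℓ - z m + v + (Λ m + 1 - 2 * (l + 1)) * η =
      -(ℓ + (z m + (1 - Λ m) * η) - v + 2 * η * l) by ring, hf.odd,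
      show z m - v + (-Λ m + 1) * η = z m + (1 - Λ m) * η - v by ring,
      show 2 * (Λ m + 1 - (l + 1)) * η = 2 * η * (Λ m - l) by ring,
      show 2 * ((l : ℂ) + 1) * η = 2 * η * (l + 1) by ring]
    ring
  · rfl

theorem evalL_one_one (ℓ : ℂ) (k l : ℕ) :
    evalL f η (Λ m) (z m) (f (z m - v + (-Λ m + 1) * η)) ℓ v k l 1 1 = if l = k then
      f (pPt η Λ z m - v + 2 * η * k) / f (pPt η Λ z m - v) *
        (f (ℓ - 2 * η * (Λ m - k)) / f ℓ) else 0 := by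
  simp only [evalL, pPt, Matrix.of_apply, Matrix.cons_val_one, Matrix.cons_val',
    Matrix.cons_val_fin_one]
  rw [show z m - v + (-Λ m + 1 + 2 * k) * η = z m + (1 - Λ m) * η - v + 2 * η * k by ring,
    show z m - v + (-Λ m + 1) * η = z m + (1 - Λ m) * η - v by ring,
    show 2 * (Λ m - k) * η = 2 * η * (Λ m - k) by ring]

/-- The matrix elements of the transfer operators with the normalization of `D`. -/
noncomputable def transfer (f : ℂ → ℂ) (η : ℂ) (Λ z : ℕ → ℂ) (x v : ℂ) (y y' : ℕ → ℕ) (m : ℕ) :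
    Matrix (Fin 2) (Fin 2) ℂ :=
  tensorL f η Λ z (fun i => f (z i - v + (-Λ i + 1) * η)) x v y y' m

theorem transfer_succ (x : ℂ) (y y' : ℕ → ℕ) (m : ℕ) :
    transfer f η Λ z x v y y' (m + 1) =
      evalL f η (Λ m) (z m) (f (z m - v + (-Λ m + 1) * η)) (siteParam (2 * η) Λ x y' m) v
        (y m) (y' m) * transfer f η Λ z x v y y' m := by
  rw [transfer, tensorL, ← transfer]
  congr 2
  rw [siteParam, sumΛ, numBelow, Finset.sum_sub_distrib, ← Finset.mul_sum]
  push_cast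
  ring

theorem transfer_congr {x : ℂ} {y y₁ y₂ : ℕ → ℕ} {m : ℕ} (hy : ∀ i < m, y₁ i = y₂ i) :
    transfer f η Λ z x v y y₁ m = transfer f η Λ z x v y y₂ m := by
  induction m with
  | zero => rfl
  | succ m ih =>
    rw [transfer_succ, transfer_succ, ih fun i hi => hy i (by omega), hy m (by omega),
      siteParam_congr fun i hi => hy i (by omega)]

/-- Conservation of the number of particles. -/
theorem numBelow_of_transfer_ne_zero {x : ℂ} {y y' : ℕ → ℕ} (m : ℕ) :
    (transfer f η Λ z x v y y' m 0 1 ≠ 0 → numBelow y' m = numBelow y m + 1) ∧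
    (transfer f η Λ z x v y y' m 1 1 ≠ 0 → numBelow y' m = numBelow y m) := by
  induction m with
  | zero => simp [transfer, tensorL, numBelow]
  | succ m ih =>
    have hs : ∀ w : ℕ → ℕ, numBelow w (m + 1) = numBelow w m + w m := fun w =>
      Finset.sum_range_succ _ _
    rw [transfer_succ, Matrix.mul_apply, Matrix.mul_apply, Fin.sum_univ_two, Fin.sum_univ_two,
      hs, hs]
    constructor
    · intro h0
      by_cases h1 : transfer f η Λ z x v y y' m 0 1 = 0
      · rw [h1, mul_zero, zero_add] at h0
        have h2 := ih.2 (right_ne_zero_of_mul h0)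
        have h3 : y' m = y m + 1 := by
          by_contra hne
          simp [evalL, hne] at h0
        omega
      · have h2 := ih.1 h1
        by_cases h3 : y' m = y m
        · omega
        · have h4 : transfer f η Λ z x v y y' m 1 1 ≠ 0 := by
            intro h4
            simp [evalL, h3, h4] at h0
          have := ih.2 h4
          omega
    · intro h0
      by_cases h1 : transfer f η Λ z x v y y' m 0 1 = 0
      · rw [h1, mul_zero, zero_add] at h0
        have h2 := ih.2 (right_ne_zero_of_mul h0)
        have h3 : y' m = y m := by
          by_contra hne
          simp [evalL, hne] at h0
        omega
      · have h2 := ih.1 h1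
        by_cases h3 : y' m + 1 = y m
        · omega
        · have h4 : transfer f η Λ z x v y y' m 1 1 ≠ 0 := by
            intro h4
            simp [evalL, h3, h4] at h0
          have := ih.2 h4
          omega

end Entries

/-! ### Finite sets of configurations -/

section Configurations

/-- The configurations on the sites `< m` with occupation numbers `< B`. -/
def configs (B : ℕ) : ℕ → Finset (Multiset ℕ)
  | 0 => {0}
  | m + 1 => (configs B m ×ˢ Finset.range B).image fun r => r.1 + Multiset.replicate r.2 m

theorem mem_configs {B : ℕ} (hB : 0 < B) {m : ℕ} {κ : Multiset ℕ} :
    κ ∈ configs B m ↔ (∀ i ∈ κ, i < m) ∧ ∀ i, κ.count i < B := by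
  induction m generalizing κ with
  | zero =>
    simp only [configs, Finset.mem_singleton, Nat.not_lt_zero]
    constructor
    · rintro rfl
      simpa using hB
    · intro h
      exact Multiset.eq_zero_of_forall_notMem fun i hi => h.1 i hi
  | succ m ih =>
    simp only [configs, Finset.mem_image, Finset.mem_product, Finset.mem_range, Prod.exists, ih]
    constructor
    · rintro ⟨κ', l, ⟨⟨h1, h2⟩, hl⟩, rfl⟩
      have hm : κ'.count m = 0 := Multiset.count_eq_zero.2 fun hm => lt_irrefl _ (h1 m hm)
      refine ⟨fun i hi => ?_, fun i => ?_⟩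
      · rcases Multiset.mem_add.1 hi with hi | hi
        · exact (h1 i hi).trans (Nat.lt_succ_self m)
        · rw [Multiset.eq_of_mem_replicate hi]; exact Nat.lt_succ_self m
      · rw [Multiset.count_add, Multiset.count_replicate]
        split_ifs with h
        · subst h; omega
        · exact h2 i
    · rintro ⟨h1, h2⟩
      refine ⟨κ.filter (· ≠ m), κ.count m, ⟨⟨fun i hi => ?_, fun i => ?_⟩, h2 m⟩, ?_⟩
      · have := Multiset.mem_filter.1 hi
        have := h1 i this.1
        have : i ≠ m := (Multiset.mem_filter.1 hi).2
        omega
      · exact (Multiset.count_le_of_le i (Multiset.filter_le _ _)).trans_lt (h2 i)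
      · ext i
        rw [Multiset.count_add, Multiset.count_filter, Multiset.count_replicate]
        by_cases hi : i = m
        · simp [hi]
        · simp [hi, Ne.symm hi]

theorem count_add_replicate_of_lt {κ : Multiset ℕ} {l m i : ℕ} (hi : i < m) :
    (κ + Multiset.replicate l m).count i = κ.count i := by
  rw [Multiset.count_add, Multiset.count_replicate, if_neg (by omega), add_zero]

theorem count_add_replicate_self {B : ℕ} (hB : 0 < B) {κ : Multiset ℕ} {l m : ℕ}
    (hκ : κ ∈ configs B m) : (κ + Multiset.replicate l m).count m = l := by
  rw [Multiset.count_add, Multiset.count_replicate_self,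
    Multiset.count_eq_zero.2 fun hm => lt_irrefl _ (((mem_configs hB).1 hκ).1 m hm), zero_add]

theorem sum_configs_succ {B : ℕ} (hB : 0 < B) (m : ℕ) (g : Multiset ℕ → ℂ) :
    ∑ κ ∈ configs B (m + 1), g κ =
      ∑ κ ∈ configs B m, ∑ l ∈ Finset.range B, g (κ + Multiset.replicate l m) := by
  rw [configs, Finset.sum_image, Finset.sum_product]
  rintro ⟨κ, l⟩ hκ ⟨κ', l'⟩ hκ' he
  simp only [Finset.coe_product, Set.mem_prod, Finset.mem_coe] at hκ hκ'
  have h1 : l = l' := by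
    have := congrArg (Multiset.count m) he
    simpa only [count_add_replicate_self hB hκ.1, count_add_replicate_self hB hκ'.1] using this
  subst h1
  exact Prod.ext (add_right_cancel he) rfl

end Configurations

/-! ### The transfer operators on weight functions -/

section Transfer
variable {f : ℂ → ℂ} {η : ℂ} {Λ z : ℕ → ℂ} {D P Q : Set ℂ} {Γ : List Contour} {v : ℂ}

/-- The word of the configuration `y` after the action of the transfer operator. -/
noncomputable def shiftWord (f : ℂ → ℂ) (h : ℂ) (Λ p : ℕ → ℂ) (v x : ℂ) (y : ℕ → ℕ) :
    ℕ → List (ℂ → ℂ)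
  | 0 => []
  | m + 1 => row h (siteLetter f h Λ p v m (v - h)) (y m) (siteParam h Λ x y m) ++
      shiftWord f h Λ p v x y m

theorem SiteData.shiftWord {h : ℂ} {p : ℕ → ℂ} (S : SiteData f D P Q p v) {x : ℂ} {y : ℕ → ℕ}
    {m : ℕ} : ∀ g ∈ shiftWord f h Λ p v x y m, Mer D (P ∪ Q) g := by
  induction m with
  | zero => simp [EllipticIRF.shiftWord]
  | succ m ih =>
    intro g hg
    rcases List.mem_append.1 hg with hg | hg
    exacts [S.row_siteLetter g hg, ih g hg]

theorem sum_nestedIntegral_append_single {h : ℂ} (hf : SigmaLike f) (hD : IsCell f D) {ι : Type*}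
    (s : Finset ι) (c : ι → ℂ) (d : ℂ) (w : ι → List (ℂ → ℂ)) (w' : List (ℂ → ℂ))
    (hw : ∀ i ∈ s, ∀ k ∈ w i, Mer D (P ∪ Q) k) (hw' : ∀ k ∈ w', Mer D (P ∪ Q) k)
    (hrel : ∀ Γ φ, IsTower h D P Q Γ → Mer D (outsideAll Γ) φ →
      ∑ i ∈ s, c i * nestedIntegral f h Γ (w i) φ = d * nestedIntegral f h Γ w' φ)
    (pre : List (ℂ → ℂ)) (hpre : ∀ k ∈ pre, Mer D (P ∪ Q) k) {φ : ℂ → ℂ}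
    (H : IsTower h D P Q Γ) (hφ : Mer D (outsideAll Γ) φ) :
    ∑ i ∈ s, c i * nestedIntegral f h Γ (pre ++ w i) φ =
      d * nestedIntegral f h Γ (pre ++ w') φ := by
  simpa using sum_nestedIntegral_append hf hD s (Finset.univ : Finset Unit) c (fun _ => d) w
    (fun _ => w') hw (fun _ _ => hw') (fun Γ φ H hφ => by simpa using hrel Γ φ H hφ) pre hpre H hφ

/-- Here t is a transfer coefficient and s the actual dynamical parameter. Either t = 0 or particle
conservation fixes s = ℓ, so the common value ℓ may be used in every term. -/
theorem sum_ite_mul_eq {B k : ℕ} (hk : k < B) (c G : ℕ → ℂ → ℂ) {t s ℓ : ℂ} (ht : t ≠ 0 → s = ℓ) :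
    ∑ l ∈ Finset.range B, (if l = k then c l s else 0) * t * G l s = c k ℓ * (t * G k ℓ) := by
  rw [Finset.sum_eq_single k]
  · by_cases h0 : t = 0
    · simp [h0]
    · rw [if_pos rfl, ht h0, mul_assoc]
  · intro l _ hl
    rw [if_neg hl, zero_mul, zero_mul]
  · intro hk'
    exact absurd (Finset.mem_range.2 hk) hk'

section Scalars
variable {a b c e g r q s s' fl fx fh lh pv l₂ : ℂ}

/-- This and the next three lemmas compare coefficients, one for each entry of the local matrix. The
hypothesis W is a norm recursion, s and s' are norms at the site, and c is the norm of the lower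
sites. -/
theorem scalar_one_one (h1 : fl ≠ 0) (h2 : lh ≠ 0) (W : s * (b * lh) = s' * (e * g)) :
    a / pv * (b / fl) * s * (fl / fx * c) = e / fx * (c * s') * (a * g / (lh * pv)) := by
  have : b * s = s' * e * g / lh := by
    rw [eq_div_iff h2]; linear_combination W
  calc _ = a / pv / fx * c * (b * s) * (fl / fl) := by ring
    _ = _ := by rw [this, div_self h1]; ring

theorem scalar_one_zero (h1 : l₂ ≠ 0) (h2 : fh ≠ 0) (W : r * s = l₂ * e * s') :
    a / pv * (r / l₂) * (q / fh) * s * (fh / (fx * lh) * c) =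
      e / fx * (c * s') * (q * a / (lh * pv)) := by
  calc _ = a / pv * q * (r * s) / l₂ / (fx * lh) * c * (fh / fh) := by ring
    _ = a / pv * q * (e * s') / (fx * lh) * c * (l₂ / l₂) := by rw [W, div_self h2]; ring
    _ = _ := by rw [div_self h1]; ring

theorem scalar_zero_one (h1 : fl ≠ 0) (h2 : lh ≠ 0) (h3 : e ≠ 0) (W : r * s' = lh * e * s) :
    a / pv * (fh / fl) * s * (fl / fx * c) =
      -(fh / (fx * e)) * (c * s') * (-r * a / (lh * pv)) := by
  have : s = r * s' / (lh * e) := by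
    rw [eq_div_iff (mul_ne_zero h2 h3)]; linear_combination -W
  calc _ = a / pv * fh * s / fx * c * (fl / fl) := by ring
    _ = _ := by rw [this, div_self h1]; ring

theorem scalar_zero_zero (h1 : l₂ ≠ 0) (h2 : e ≠ 0) (W : s' * (g * l₂) = s * (e * b)) :
    a / pv * (b / l₂) * s * (-(fh / (fx * lh)) * c) =
      -(fh / (fx * e)) * (c * s') * (-(-a * g / (lh * pv))) := by
  have : b * s = s' * g * l₂ / e := by
    rw [eq_div_iff h2]; linear_combination -W
  calc _ = a / pv * (b * s) / l₂ * (-(fh / (fx * lh)) * c) := by ring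
    _ = a / pv * (s' * g / e) * (-(fh / (fx * lh)) * c) * (l₂ / l₂) := by rw [this]; ring
    _ = _ := by rw [div_self h1]; ring

end Scalars

theorem numBelow_succ (y : ℕ → ℕ) (m : ℕ) : numBelow y (m + 1) = numBelow y m + y m :=
  Finset.sum_range_succ _ _

theorem siteParam_succ (h x : ℂ) (y : ℕ → ℕ) (m : ℕ) :
    siteParam h Λ x y (m + 1) = siteParam h Λ x y m + 2 * h * y m - h * Λ m := by
  rw [siteParam, siteParam, numBelow_succ, sumΛ, sumΛ, Finset.sum_range_succ]
  push_cast
  ring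

theorem siteParam_add (h x a : ℂ) (y : ℕ → ℕ) (m : ℕ) :
    siteParam h Λ (x + a) y m = siteParam h Λ x y m + a := by
  rw [siteParam, siteParam]; ring

theorem wordNorm_succ (h x : ℂ) (y : ℕ → ℕ) (m : ℕ) :
    wordNorm f h Λ x y (m + 1) =
      wordNorm f h Λ x y m * siteNorm f h (Λ m) (y m) (siteParam h Λ x y m) :=
  Finset.prod_range_succ _ _

/-- The terms of the configuration sum on one more site. -/
theorem transfer_sum_succ {B m : ℕ} (hB : 0 < B) {x : ℂ} (y : ℕ → ℕ) (r : Fin 2) (φ : ℂ → ℂ) :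
    ∑ κ ∈ configs B (m + 1), (transfer f η Λ z x v y (fun i => κ.count i) (m + 1) r 1 *
        wordNorm f (2 * η) Λ x (fun i => κ.count i) (m + 1)) * nestedIntegral f (2 * η) Γ
        (weightWord f (2 * η) Λ (pPt η Λ z) x (fun i => κ.count i) (m + 1)) φ =
    ∑ κ ∈ configs B m, ∑ a : Fin 2, ∑ l ∈ Finset.range B,
      (evalL f η (Λ m) (z m) (f (z m - v + (-Λ m + 1) * η))
        (siteParam (2 * η) Λ x (fun i => κ.count i) m) v (y m) l r a *
        transfer f η Λ z x v y (fun i => κ.count i) m a 1) *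
      (wordNorm f (2 * η) Λ x (fun i => κ.count i) m *
        siteNorm f (2 * η) (Λ m) l (siteParam (2 * η) Λ x (fun i => κ.count i) m) *
        nestedIntegral f (2 * η) Γ
          (row (2 * η) (weightLetter f (2 * η) Λ (pPt η Λ z) m) l
            (siteParam (2 * η) Λ x (fun i => κ.count i) m) ++
          weightWord f (2 * η) Λ (pPt η Λ z) x (fun i => κ.count i) m) φ) := by
  rw [sum_configs_succ hB]
  refine Finset.sum_congr rfl fun κ hκ => ?_
  rw [Finset.sum_comm]
  refine Finset.sum_congr rfl fun l _ => ?_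
  have hc : ∀ i < m, (κ + Multiset.replicate l m).count i = κ.count i :=
    fun i hi => count_add_replicate_of_lt hi
  rw [transfer_succ, wordNorm_succ, weightWord, transfer_congr hc, wordNorm_congr hc,
    weightWord_congr hc, siteParam_congr hc, count_add_replicate_self hB hκ, Matrix.mul_apply,
    ← Finset.sum_mul]
  ring

variable {x : ℂ} {N B : ℕ}

/-- The action of the transfer operators on nested integrals. -/
theorem transfer_relations (S : SiteData f D P Q (pPt η Λ z) v) (hη : f (2 * η) ≠ 0)
    (hB : N + 1 < B) (hgen : ∀ k i : ℕ, i ≤ 2 * N → f (x + 2 * η * (i - sumΛ Λ k)) ≠ 0)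
    (y : ℕ → ℕ) (m : ℕ) :
    (numBelow y m ≤ N → ∀ Γ φ, IsTower (2 * η) D P Q Γ → Mer D (outsideAll Γ) φ →
      ∑ κ ∈ configs B m, (transfer f η Λ z x v y (fun i => κ.count i) m 1 1 *
        wordNorm f (2 * η) Λ x (fun i => κ.count i) m) * nestedIntegral f (2 * η) Γ
        (weightWord f (2 * η) Λ (pPt η Λ z) x (fun i => κ.count i) m) φ =
      f (siteParam (2 * η) Λ x y m) / f x * wordNorm f (2 * η) Λ (x + 2 * η) y m *
        nestedIntegral f (2 * η) Γ (shiftWord f (2 * η) Λ (pPt η Λ z) v x y m) φ) ∧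
    (numBelow y m + 1 ≤ N → ∀ Γ φ, IsTower (2 * η) D P Q Γ → Mer D (outsideAll Γ) φ →
      ∑ κ ∈ configs B m, (transfer f η Λ z x v y (fun i => κ.count i) m 0 1 *
        wordNorm f (2 * η) Λ x (fun i => κ.count i) m) * nestedIntegral f (2 * η) Γ
        (weightWord f (2 * η) Λ (pPt η Λ z) x (fun i => κ.count i) m) φ =
      -(f (2 * η) / (f x * f (siteParam (2 * η) Λ x y m + 2 * η))) *
        wordNorm f (2 * η) Λ (x + 2 * η) y m *
        nestedIntegral f (2 * η) Γ
          (siteLetter f (2 * η) Λ (pPt η Λ z) v m (pPt η Λ z m) (siteParam (2 * η) Λ x y m) ::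
            shiftWord f (2 * η) Λ (pPt η Λ z) v x y m) φ) := by
  induction m with
  -- Without sites the entry b is zero, and on the other side the letter Z_{p_0} integrates to zero.
  | zero =>
    have hx : f x ≠ 0 := by simpa [sumΛ] using hgen 0 0 (by omega)
    constructor
    · intro _ Γ φ _ _
      simp [configs, transfer, tensorL, wordNorm, weightWord, shiftWord, siteParam, sumΛ,
        numBelow, hx]
    · intro _ Γ φ H hφ
      rw [shiftWord, nestedIntegral_siteLetter_zero S _ H hφ]
      simp [configs, transfer, tensorL]
  | succ m ih =>
    set ℓ := siteParam (2 * η) Λ x y m with hℓ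
    set C := wordNorm f (2 * η) Λ (x + 2 * η) y m with hC
    set p := pPt η Λ z with hp
    set Ξ := shiftWord f (2 * η) Λ p v x y m with hΞ
    have hΞm : ∀ g ∈ Ξ, Mer D (P ∪ Q) g := S.shiftWord
    have hx : f x ≠ 0 := by simpa [sumΛ] using hgen 0 0 (by omega)
    -- The parameter ℓ contains 2h for each particle below the site, so genericity up to 2N leaves
    -- exactly this range for i.
    have g1 : ∀ i : ℕ, 2 * numBelow y m + i ≤ 2 * N → f (ℓ + 2 * η * i) ≠ 0 := fun i hi => by
      have := hgen m _ hi
      rwa [show x + 2 * η * ((2 * numBelow y m + i : ℕ) - sumΛ Λ m) = ℓ + 2 * η * i by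
        rw [hℓ, siteParam]; push_cast; ring] at this
    have g2 : ∀ i : ℕ, 2 * numBelow y m + i ≤ 2 * N →
        f (ℓ + 2 * η * i - 2 * η * Λ m) ≠ 0 := fun i hi => by
      have := hgen (m + 1) _ hi
      rwa [show x + 2 * η * ((2 * numBelow y m + i : ℕ) - sumΛ Λ (m + 1)) =
        ℓ + 2 * η * i - 2 * η * Λ m by
          rw [hℓ, siteParam, sumΛ, sumΛ, Finset.sum_range_succ]; push_cast; ring] at this
    have s11 : ∀ κ : Multiset ℕ, transfer f η Λ z x v y (fun i => κ.count i) m 1 1 ≠ 0 →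
        siteParam (2 * η) Λ x (fun i => κ.count i) m = ℓ := fun κ h0 => by
      rw [hℓ, siteParam, siteParam, (numBelow_of_transfer_ne_zero m).2 h0]
    have s01 : ∀ κ : Multiset ℕ, transfer f η Λ z x v y (fun i => κ.count i) m 0 1 ≠ 0 →
        siteParam (2 * η) Λ x (fun i => κ.count i) m = ℓ + 2 * (2 * η) := fun κ h0 => by
      rw [hℓ, siteParam, siteParam, (numBelow_of_transfer_ne_zero m).1 h0]
      push_cast; ring
    -- A relation on the lower sites survives when a row of letters at site m is put in front, and
    -- conservation makes the row the same in all nonzero terms. The four uses below correspond to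
    -- the entries a, b, c, d at site m.
    have lift : ∀ (T : Multiset ℕ → ℂ) (ℓ' : ℂ),
        (∀ κ, T κ ≠ 0 → siteParam (2 * η) Λ x (fun i => κ.count i) m = ℓ') →
        ∀ (d : ℂ) (w : List (ℂ → ℂ)), (∀ g ∈ w, Mer D (P ∪ Q) g) →
        (∀ Γ φ, IsTower (2 * η) D P Q Γ → Mer D (outsideAll Γ) φ →
          ∑ κ ∈ configs B m, (T κ * wordNorm f (2 * η) Λ x (fun i => κ.count i) m) *
          nestedIntegral f (2 * η) Γ (weightWord f (2 * η) Λ p x (fun i => κ.count i) m) φ =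
          d * nestedIntegral f (2 * η) Γ w φ) →
        ∀ (c : ℕ → ℂ → ℂ) (k : ℕ), k < B → ∀ (Γ : List Contour) (φ : ℂ → ℂ),
        IsTower (2 * η) D P Q Γ → Mer D (outsideAll Γ) φ →
        ∑ κ ∈ configs B m, ∑ l ∈ Finset.range B,
          (if l = k then c l (siteParam (2 * η) Λ x (fun i => κ.count i) m) else 0) * T κ *
          (wordNorm f (2 * η) Λ x (fun i => κ.count i) m *
          siteNorm f (2 * η) (Λ m) l (siteParam (2 * η) Λ x (fun i => κ.count i) m) *
          nestedIntegral f (2 * η) Γ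
          (row (2 * η) (weightLetter f (2 * η) Λ p m) l
            (siteParam (2 * η) Λ x (fun i => κ.count i) m) ++
            weightWord f (2 * η) Λ p x (fun i => κ.count i) m) φ) =
        c k ℓ' * siteNorm f (2 * η) (Λ m) k ℓ' * (d * nestedIntegral f (2 * η) Γ
          (row (2 * η) (weightLetter f (2 * η) Λ p m) k ℓ' ++ w) φ) := by
      intro T ℓ' hT d w hw hrel c k hk Γ φ H hφ
      rw [← sum_nestedIntegral_append_single S.sigma S.cell (configs B m) _ d _ w
        (fun _ _ => S.weightWord) hw hrel _ S.row_weightLetter H hφ, Finset.mul_sum]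
      refine Finset.sum_congr rfl fun κ _ => ?_
      refine (sum_ite_mul_eq hk c (fun l s => wordNorm f (2 * η) Λ x (fun i => κ.count i) m *
          siteNorm f (2 * η) (Λ m) l s * nestedIntegral f (2 * η) Γ
          (row (2 * η) (weightLetter f (2 * η) Λ p m) l s ++
            weightWord f (2 * η) Λ p x (fun i => κ.count i) m) φ) (hT κ)).trans ?_
      ring
    constructor
    · intro hN Γ φ H hφ
      rw [numBelow_succ] at hN
      rw [transfer_sum_succ (by omega), wordNorm_succ, siteParam_add, ← hℓ, ← hC, shiftWord, ← hΞ,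
        ← hℓ, siteParam_succ, ← hℓ]
      simp only [Fin.sum_univ_two, evalL_one_zero S.sigma, evalL_one_one]
      simp only [Finset.sum_add_distrib]
      have hA := lift (fun κ => transfer f η Λ z x v y (fun i => κ.count i) m 1 1) ℓ s11 _ Ξ hΞm
        (ih.1 (by omega)) (fun _ ℓ => f (p m - v + 2 * η * (y m)) / f (p m - v) *
          (f (ℓ - 2 * η * (Λ m - y m)) / f ℓ)) (y m) (by omega) Γ φ H hφ
      cases hk : y m with
      | zero =>
        rw [hk] at hA
        -- An empty site admits no annihilation by c, so only the term with d remains.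
        simp only [Nat.add_eq_zero_iff, one_ne_zero, and_false, if_false, zero_mul,
          Finset.sum_const_zero, zero_add]
        refine hA.trans ?_
        have := S.p_sub_v m
        have := g1 0 (by omega)
        simp only [row, siteNorm, Finset.range_zero, Finset.prod_empty, List.nil_append,
          Nat.cast_zero, mul_zero, add_zero, sub_zero, mul_one] at this ⊢
        field_simp
      | succ k =>
        rw [hk] at hA hN
        simp only [Nat.add_right_cancel_iff]
        have hBm := lift (fun κ => transfer f η Λ z x v y (fun i => κ.count i) m 0 1)
          (ℓ + 2 * (2 * η)) s01 _ _ (by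
            intro g hg
            rcases List.mem_cons.1 hg with rfl | hg
            exacts [S.siteLetter m _ _, hΞm g hg]) (ih.2 (by omega))
          (fun l ℓ => f (ℓ + p m - v + 2 * η * l) / f (p m - v) *
            (f (2 * η * (Λ m - l)) / f ℓ) * (f (2 * η * (l + 1)) / f (2 * η))) k (by omega) Γ φ H hφ
        refine (congrArg₂ (· + ·) hBm hA).trans ?_
        have hl1 : f (ℓ + 2 * η) ≠ 0 := by simpa using g1 1 (by omega)
        have hl2 : f (ℓ + 2 * (2 * η)) ≠ 0 := by
          have := g1 2 (by omega)
          rwa [show ℓ + 2 * η * (2 : ℕ) = ℓ + 2 * (2 * η) by push_cast; ring] at this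
        have hl0 : f ℓ ≠ 0 := by simpa using g1 0 (by omega)
        -- The outermost of the k+1 letters Z_{v-h} is moved through the other k and arrives as
        -- Z_{v-h-hk}. The one-body relation splits it into a weight function, matching d at the
        -- site times d below, and Z_{p_m}, matching c at the site times b below.
        rw [show row (2 * η) (siteLetter f (2 * η) Λ p v m (v - 2 * η)) (k + 1) ℓ =
            siteLetter f (2 * η) Λ p v m (v - 2 * η) (ℓ + 2 * (2 * η) * k) ::
              row (2 * η) (siteLetter f (2 * η) Λ p v m (v - 2 * η)) k ℓ from rfl,
          List.cons_append, nestedIntegral_siteLetter_row S m k _ ℓ Ξ hΞm H hφ,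
          nestedIntegral_siteLetter_eq S m (v - 2 * η - 2 * η * k) hl1 _ Ξ S.row_weightLetter hΞm H hφ,
          List.append_cons _ (weightLetter f (2 * η) Λ p m ℓ), ← row_succ']
        have W1 := siteNorm_add f (2 * η) (Λ m) (k + 1) (fun j hj => g2 j (by omega))
          (fun j hj => g1 j (by omega))
        have W2 := siteNorm_succ f (2 * η) (Λ m) k (ℓ := ℓ) (by
          have := g2 (2 * (k + 1)) (by omega)
          rwa [show ℓ + 2 * η * (2 * (k + 1) : ℕ) = ℓ + 2 * (2 * η) * (k + 1) by
            push_cast; ring] at this) hl2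
        have c1 := scalar_one_one (a := f (p m - v + 2 * η * (k + 1 : ℕ))) (pv := f (p m - v))
          (fx := f x) (c := C) hl0 hl1 W1
        have c2 := scalar_one_zero (a := f (ℓ + 2 * (2 * η) + p m - v + 2 * η * k))
          (pv := f (p m - v)) (q := f (2 * η * (k + 1))) (fx := f x) (lh := f (ℓ + 2 * η))
          (c := C) hl2 hη W2
        rw [show p m - (v - 2 * η - 2 * η * k) = p m - v + 2 * η * (k + 1 : ℕ) by push_cast; ring,
          show ℓ + 2 * η + v - (v - 2 * η - 2 * η * k) = ℓ + 2 * η + 2 * η * (k + 1 : ℕ) by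
            push_cast; ring,
          show v - (v - 2 * η - 2 * η * k) = 2 * η * (k + 1) by ring,
          show ℓ + 2 * η + p m - (v - 2 * η - 2 * η * k) =
            ℓ + 2 * (2 * η) + p m - v + 2 * η * k by ring]
        rw [show ℓ + 2 * η * (k + 1 : ℕ) - 2 * η * Λ m = ℓ - 2 * η * (Λ m - (k + 1 : ℕ)) by ring]
          at c1
        rw [show ℓ + 2 * (2 * η) * ((k : ℂ) + 1) - 2 * η * Λ m =
          ℓ + 2 * (2 * η) * (k + 1 : ℕ) - 2 * η * Λ m by push_cast; ring] at c2
        linear_combination nestedIntegral f (2 * η) Γ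
          (row (2 * η) (weightLetter f (2 * η) Λ p m) (k + 1) ℓ ++ Ξ) φ * c1 -
          nestedIntegral f (2 * η) Γ (row (2 * η) (weightLetter f (2 * η) Λ p m) k
            (ℓ + 2 * (2 * η)) ++ siteLetter f (2 * η) Λ p v m (p m) ℓ :: Ξ) φ * c2
    · intro hN Γ φ H hφ
      rw [numBelow_succ] at hN
      rw [transfer_sum_succ (by omega), wordNorm_succ, siteParam_add, ← hℓ, ← hC, shiftWord, ← hΞ,
        ← hℓ, siteParam_succ, ← hℓ]
      simp only [Fin.sum_univ_two, evalL_zero_zero, evalL_zero_one S.sigma]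
      simp only [Finset.sum_add_distrib]
      set k := y m with hk
      have hA := lift (fun κ => transfer f η Λ z x v y (fun i => κ.count i) m 1 1) ℓ s11 _ Ξ hΞm
        (ih.1 (by omega)) (fun _ ℓ => f (ℓ + 2 * η + v - (p m + 2 * η * Λ m) + 2 * η * k) /
          f (p m - v) * (f (2 * η) / f ℓ)) (k + 1) (by omega) Γ φ H hφ
      have hBm := lift (fun κ => transfer f η Λ z x v y (fun i => κ.count i) m 0 1)
          (ℓ + 2 * (2 * η)) s01 _ _ (by
            intro g hg
            rcases List.mem_cons.1 hg with rfl | hg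
            exacts [S.siteLetter m _ _, hΞm g hg]) (ih.2 (by omega))
          (fun _ ℓ => f (p m + 2 * η * Λ m - v - 2 * η * k) / f (p m - v) *
            (f (ℓ + 2 * η * k) / f ℓ)) k (by omega) Γ φ H hφ
      refine (congrArg₂ (· + ·) hBm hA).trans ?_
      have hl1 : f (ℓ + 2 * η) ≠ 0 := by simpa using g1 1 (by omega)
      have hl2 : f (ℓ + 2 * η + 2 * η) ≠ 0 := by
        have := g1 2 (by omega)
        rwa [show ℓ + 2 * η * (2 : ℕ) = ℓ + 2 * η + 2 * η by push_cast; ring] at this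
      have hl0 : f ℓ ≠ 0 := by simpa using g1 0 (by omega)
      have he : f (ℓ + 2 * (2 * η) * k - 2 * η * Λ m + 2 * η) ≠ 0 := by
        have := g2 (2 * k + 1) (by omega)
        rwa [show ℓ + 2 * η * (2 * k + 1 : ℕ) - 2 * η * Λ m =
          ℓ + 2 * (2 * η) * k - 2 * η * Λ m + 2 * η by push_cast; ring] at this
      -- The leading letter Z_{p_{m+1}} of site m+1 is Z_{q_m} of site m, so it can be moved through
      -- the row. Splitting it afterwards gives b at the site times d below, with k+1 particles, and
      -- a at the site times b below.
      have hX : nestedIntegral f (2 * η) Γ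
          (siteLetter f (2 * η) Λ p v (m + 1) (p (m + 1)) (ℓ + 2 * (2 * η) * k - 2 * η * Λ m) ::
            (row (2 * η) (siteLetter f (2 * η) Λ p v m (v - 2 * η)) k ℓ ++ Ξ)) φ =
          nestedIntegral f (2 * η) Γ
          (siteLetter f (2 * η) Λ p v m (p m + 2 * η * Λ m) (ℓ + 2 * (2 * η) * k) ::
            (row (2 * η) (siteLetter f (2 * η) Λ p v m (v - 2 * η)) k ℓ ++ Ξ)) φ := by
        refine nestedIntegral_congr (.cons (fun γ hγ u hu => ?_)
          (forall₂_refl_of (fun k _ _ _ _ => rfl) _))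
        rw [siteLetter_succ S.cell S.p_mem S.p_inside H m _ hγ hu, sub_add_cancel]
      rw [hX, nestedIntegral_siteLetter_row S m k _ ℓ Ξ hΞm H hφ,
        nestedIntegral_siteLetter_eq S m (p m + 2 * η * Λ m - 2 * η * k) hl1 _ Ξ S.row_weightLetter hΞm H hφ,
        List.append_cons _ (weightLetter f (2 * η) Λ p m ℓ), ← row_succ']
      have W1 := siteNorm_add f (2 * η) (Λ m) k (ℓ := ℓ + 2 * η) (fun j hj => by
          have := g2 (j + 1) (by omega)
          rwa [show ℓ + 2 * η * (j + 1 : ℕ) = ℓ + 2 * η + 2 * η * j by push_cast; ring] at this)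
        (fun j hj => by
          have := g1 (j + 1) (by omega)
          rwa [show ℓ + 2 * η * (j + 1 : ℕ) = ℓ + 2 * η + 2 * η * j by push_cast; ring] at this)
      have W2 := siteNorm_succ f (2 * η) (Λ m) k (ℓ := ℓ - 2 * η) (by
          rwa [show ℓ - 2 * η + 2 * (2 * η) * (k + 1) - 2 * η * Λ m =
            ℓ + 2 * (2 * η) * k - 2 * η * Λ m + 2 * η by ring]) (by
          rwa [show ℓ - 2 * η + 2 * (2 * η) = ℓ + 2 * η by ring])
      rw [show ℓ - 2 * η + 2 * (2 * η) = ℓ + 2 * η by ring, sub_add_cancel,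
        show ℓ - 2 * η + 2 * (2 * η) * (k + 1) - 2 * η * Λ m =
            ℓ + 2 * (2 * η) * k - 2 * η * Λ m + 2 * η by ring] at W2
      rw [show ℓ + 2 * η + 2 * (2 * η) * k - 2 * η * Λ m =
            ℓ + 2 * (2 * η) * k - 2 * η * Λ m + 2 * η by ring] at W1
      have c1 := scalar_zero_one (fh := f (2 * η))
        (a := f (ℓ + 2 * η + v - (p m + 2 * η * Λ m) + 2 * η * k)) (pv := f (p m - v))
        (fx := f x) (c := C) hl0 hl1 he W2
      have c2 := scalar_zero_zero (fh := f (2 * η)) (a := f (p m + 2 * η * Λ m - v - 2 * η * k))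
        (pv := f (p m - v)) (fx := f x) (lh := f (ℓ + 2 * η)) (c := C) hl2 he W1
      rw [show p m - (p m + 2 * η * Λ m - 2 * η * k) = -(2 * η * (Λ m - k)) by ring, S.sigma.odd,
        show ℓ + 2 * η + v - (p m + 2 * η * Λ m - 2 * η * k) =
          ℓ + 2 * η + v - (p m + 2 * η * Λ m) + 2 * η * k by ring,
        show v - (p m + 2 * η * Λ m - 2 * η * k) = -(p m + 2 * η * Λ m - v - 2 * η * k) by ring,
        S.sigma.odd (p m + 2 * η * Λ m - v - 2 * η * k),
        show ℓ + 2 * η + p m - (p m + 2 * η * Λ m - 2 * η * k) =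
          ℓ + 2 * η + 2 * η * k - 2 * η * Λ m by ring]
      rw [show ℓ + 2 * (2 * η) = ℓ + 2 * η + 2 * η by ring]
      linear_combination nestedIntegral f (2 * η) Γ
          (row (2 * η) (weightLetter f (2 * η) Λ p m) (k + 1) ℓ ++ Ξ) φ * c1 +
          nestedIntegral f (2 * η) Γ (row (2 * η) (weightLetter f (2 * η) Λ p m) k
            (ℓ + 2 * η + 2 * η) ++ siteLetter f (2 * η) Λ p v m (p m) ℓ :: Ξ) φ * c2

end Transfer

/-! ### The infinite volume limit and the branching rule -/

section Branching
variable {f : ℂ → ℂ} {η : ℂ} {Λ z : ℕ → ℂ} {D P Q : Set ℂ} {Γ : List Contour} {v x : ℂ}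
  {κ μ ν : Multiset ℕ} {L N : ℕ}

theorem numBelow_count (hκ : ∀ i ∈ κ, i < L) : numBelow (fun i => κ.count i) L = κ.card :=
  Multiset.sum_count_eq_card fun i hi => Finset.mem_range.2 (hκ i hi)

/-- An empty incoming site cannot lose a particle, so c drops out and only the diagonal entry d
contributes. -/
theorem transfer_succ_of_count_eq_zero (hpv : ∀ j, f (pPt η Λ z j - v) ≠ 0) {m : ℕ}
    (hκ : κ.count m = 0) :
    transfer f η Λ z x v (fun i => κ.count i) (fun i => μ.count i) (m + 1) 1 1 =
      if μ.count m = 0 then f (siteParam (2 * η) Λ x (fun i => μ.count i) m - 2 * η * Λ m) /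
        f (siteParam (2 * η) Λ x (fun i => μ.count i) m) *
        transfer f η Λ z x v (fun i => κ.count i) (fun i => μ.count i) m 1 1 else 0 := by
  rw [transfer_succ, Matrix.mul_apply, Fin.sum_univ_two, evalL_one_one, hκ]
  have h0 : evalL f η (Λ m) (z m) (f (z m - v + (-Λ m + 1) * η))
      (siteParam (2 * η) Λ x (fun i => μ.count i) m) v 0 (μ.count m) 1 0 = 0 := by
    simp [evalL]
  rw [h0, zero_mul, zero_add, Nat.cast_zero, mul_zero, add_zero, div_self (hpv m), one_mul,
    sub_zero, ite_mul, zero_mul]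

/-- Each additional empty site contributes a ratio of two values of f that is exactly the change of
the normalizing factor. The sequence defining the limit is therefore eventually constant. -/
theorem transfer_stable (hpv : ∀ j, f (pPt η Λ z j - v) ≠ 0)
    (hgen : ∀ k : ℕ, f (x + 2 * η * ((2 * κ.card : ℕ) - sumΛ Λ k)) ≠ 0)
    (hκ : ∀ i ∈ κ, i < L) (hμ : ∀ i ∈ μ, i < L) {m : ℕ} (hm : L ≤ m) :
    1 / f (x - 2 * η * (sumΛ Λ m - 2 * κ.card)) *
      transfer f η Λ z x v (fun i => κ.count i) (fun i => μ.count i) m 1 1 =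
    1 / f (x - 2 * η * (sumΛ Λ L - 2 * κ.card)) *
      transfer f η Λ z x v (fun i => κ.count i) (fun i => μ.count i) L 1 1 := by
  induction m, hm using Nat.le_induction with
  | base => rfl
  | succ m hm ih =>
    rw [← ih, transfer_succ_of_count_eq_zero hpv
      (Multiset.count_eq_zero.2 fun h => absurd (hκ m h) (by omega)),
      if_pos (Multiset.count_eq_zero.2 fun h => absurd (hμ m h) (by omega))]
    by_cases h0 : transfer f η Λ z x v (fun i => κ.count i) (fun i => μ.count i) m 1 1 = 0
    · rw [h0, mul_zero, mul_zero, mul_zero]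
    · have h1 := (numBelow_of_transfer_ne_zero m).2 h0
      rw [numBelow_count fun i hi => (hκ i hi).trans_le hm] at h1
      have h2 := hgen (m + 1)
      rw [show x + 2 * η * ((2 * κ.card : ℕ) - sumΛ Λ (m + 1)) =
        x - 2 * η * (sumΛ Λ (m + 1) - 2 * κ.card) by push_cast; ring] at h2
      rw [siteParam, h1, show x - 2 * η * sumΛ Λ m + 2 * (2 * η) * κ.card - 2 * η * Λ m =
          x - 2 * η * (sumΛ Λ (m + 1) - 2 * κ.card) by
            rw [sumΛ, sumΛ, Finset.sum_range_succ]; ring,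
        show x - 2 * η * sumΛ Λ m + 2 * (2 * η) * κ.card =
          x - 2 * η * (sumΛ Λ m - 2 * κ.card) by ring, ← mul_assoc]
      congr 1
      generalize f (x - 2 * η * (sumΛ Λ (m + 1) - 2 * κ.card)) = A at h2 ⊢
      field_simp

theorem D₁_eq (hpv : ∀ j, f (pPt η Λ z j - v) ≠ 0)
    (hgen : ∀ k : ℕ, f (x + 2 * η * ((2 * κ.card : ℕ) - sumΛ Λ k)) ≠ 0)
    (hκ : ∀ i ∈ κ, i < L) (hμ : ∀ i ∈ μ, i < L) :
    D₁ f η Λ z κ μ x v = 1 / f (x - 2 * η * (sumΛ Λ L - 2 * κ.card)) *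
      transfer f η Λ z x v (fun i => κ.count i) (fun i => μ.count i) L 1 1 := by
  refine (tendsto_const_nhds.congr' ?_).limUnder_eq
  filter_upwards [eventually_ge_atTop L] with m hm
  exact (transfer_stable hpv hgen hκ hμ (hm.trans (Nat.le_succ m))).symm

/-- A part of μ beyond L would have to be created at a site empty in κ. The diagonal entry there
forbids this, and the zero persists on all later sites. -/
theorem D₁_eq_zero (hpv : ∀ j, f (pPt η Λ z j - v) ≠ 0) (hκ : ∀ i ∈ κ, i < L)
    (hμ : ¬ ∀ i ∈ μ, i < L) : D₁ f η Λ z κ μ x v = 0 := by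
  push Not at hμ
  obtain ⟨i, hi, hLi⟩ := hμ
  have key : ∀ m, i + 1 ≤ m →
      transfer f η Λ z x v (fun i => κ.count i) (fun i => μ.count i) m 1 1 = 0 := by
    intro m hm
    induction m, hm using Nat.le_induction with
    | base =>
      rw [transfer_succ_of_count_eq_zero hpv
        (Multiset.count_eq_zero.2 fun h => absurd (hκ i h) (by omega)), if_neg]
      exact Multiset.count_ne_zero.2 hi
    | succ m hm ih =>
      rw [transfer_succ_of_count_eq_zero hpv
        (Multiset.count_eq_zero.2 fun h => absurd (hκ m h) (by omega)), ih, mul_zero, ite_self]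
  refine (tendsto_const_nhds.congr' ?_).limUnder_eq
  filter_upwards [eventually_ge_atTop i] with m hm
  have := key (m + 1) (by omega)
  rw [transfer] at this
  rw [dNormalized, this, mul_zero]

/-- The weight function of the configuration `κ`, integrated against `φ`. -/
noncomputable def weightIntegral (f : ℂ → ℂ) (η : ℂ) (Λ z : ℕ → ℂ) (Γ : List Contour) (L : ℕ)
    (x : ℂ) (φ : ℂ → ℂ) (κ : Multiset ℕ) : ℂ :=
  wordNorm f (2 * η) Λ x (fun i => κ.count i) L * nestedIntegral f (2 * η) Γ
    (weightWord f (2 * η) Λ (pPt η Λ z) x (fun i => κ.count i) L) φ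

/-- The letter Z_{v-h} at ℓ is the weight function at ℓ + h times f(u-v+h)/f(u-v); the shift goes
into x and the quotient into φ. -/
theorem nestedIntegral_shiftWord {h : ℂ} {p : ℕ → ℂ} (y : ℕ → ℕ) (m : ℕ) (φ : ℂ → ℂ) :
    nestedIntegral f h Γ (shiftWord f h Λ p v x y m) φ =
      nestedIntegral f h Γ (weightWord f h Λ p (x + h) y m)
        fun u => φ u * (f (u - v + h) / f (u - v)) := by
  refine nestedIntegral_congr ?_
  induction m with
  | zero => exact .nil
  | succ m ih =>
    rw [shiftWord, weightWord, siteParam_add]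
    refine List.rel_append (forall₂_row (fun ℓ γ _ u _ => ?_) _ _) ih
    rw [siteLetter, weightLetter, show u - (v - h) = u - v + h by ring,
      show ℓ + h + p m + v - (v - h) - u = ℓ + h + h + p m - u by ring]
    ring

/-- One step of the branching rule. -/
theorem sum_D₁_mul (S : SiteData f D P Q (pPt η Λ z) v) (hη : f (2 * η) ≠ 0)
    (hgen : ∀ k i : ℕ, i ≤ 2 * N → f (x + 2 * η * (i - sumΛ Λ k)) ≠ 0)
    (hκ : ∀ i ∈ κ, i < L) (hκN : κ.card = N) {φ : ℂ → ℂ} (H : IsTower (2 * η) D P Q Γ)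
    (hφ : Mer D (outsideAll Γ) φ) :
    ∑ μ ∈ configs (N + 2) L, D₁ f η Λ z κ μ x v * weightIntegral f η Λ z Γ L x φ μ =
      1 / f x * weightIntegral f η Λ z Γ L (x + 2 * η)
        (fun u => φ u * (f (u - v + 2 * η) / f (u - v))) κ := by
  have key := (transfer_relations S hη (B := N + 2) (by omega) hgen (fun i => κ.count i) L).1
    (by rw [numBelow_count hκ, hκN]) Γ φ H hφ
  have hgen' : ∀ k : ℕ, f (x + 2 * η * ((2 * κ.card : ℕ) - sumΛ Λ k)) ≠ 0 := fun k =>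
    hgen k _ (by rw [hκN])
  have hne := hgen' L
  have e : x + 2 * η * ((2 * κ.card : ℕ) - sumΛ Λ L) =
      x - 2 * η * (sumΛ Λ L - 2 * κ.card) := by push_cast; ring
  rw [e] at hne
  rw [siteParam, numBelow_count hκ, show x - 2 * η * sumΛ Λ L + 2 * (2 * η) * κ.card =
    x - 2 * η * (sumΛ Λ L - 2 * κ.card) by ring, nestedIntegral_shiftWord] at key
  have e2 : ∀ μ ∈ configs (N + 2) L, D₁ f η Λ z κ μ x v * weightIntegral f η Λ z Γ L x φ μ =
      1 / f (x - 2 * η * (sumΛ Λ L - 2 * κ.card)) *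
      ((transfer f η Λ z x v (fun i => κ.count i) (fun i => μ.count i) L 1 1 *
        wordNorm f (2 * η) Λ x (fun i => μ.count i) L) * nestedIntegral f (2 * η) Γ
        (weightWord f (2 * η) Λ (pPt η Λ z) x (fun i => μ.count i) L) φ) := by
    intro μ hμ
    rw [D₁_eq S.p_sub_v hgen' hκ ((mem_configs (by omega)).1 hμ).1, weightIntegral]
    ring
  rw [Finset.sum_congr rfl e2, ← Finset.mul_sum, key, weightIntegral]
  field_simp

/-- The functions `D_{ν/μ}` are the transition coefficients of the integrals of the weight
functions. -/
theorem sum_DSkew_mul (hη : f (2 * η) ≠ 0) (hν : ∀ i ∈ ν, i < L) (hνN : ν.card = N)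
    (H : IsTower (2 * η) D P Q Γ) (n : ℕ) (v : Fin n → ℂ)
    (S : ∀ j, SiteData f D P Q (pPt η Λ z) (v j)) (x : ℂ)
    (hgen : ∀ j < n, ∀ k i : ℕ, i ≤ 2 * N → f (x + 2 * η * j + 2 * η * (i - sumΛ Λ k)) ≠ 0)
    (φ : ℂ → ℂ) (hφ : Mer D (outsideAll Γ) φ) :
    (∀ μ, DSkew f η Λ z ν n μ x v ≠ 0 → (∀ i ∈ μ, i < L) ∧ μ.card = N) ∧
    ∑ μ ∈ configs (N + 2) L, DSkew f η Λ z ν n μ x v * weightIntegral f η Λ z Γ L x φ μ =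
      (∏ i ∈ Finset.range n, 1 / f (x + 2 * η * i)) * weightIntegral f η Λ z Γ L (x + 2 * η * n)
        (fun u => φ u * ∏ j, (f (u - v j + 2 * η) / f (u - v j))) ν := by
  have hmem : ∀ μ : Multiset ℕ, (∀ i ∈ μ, i < L) ∧ μ.card = N → μ ∈ configs (N + 2) L :=
    fun μ hμ => (mem_configs (by omega)).2 ⟨hμ.1, fun i => by
      have := Multiset.count_le_card i μ
      omega⟩
  induction n generalizing x φ with
  | zero =>
    constructor
    · intro μ hμ
      simp only [DSkew, ne_eq, ite_eq_right_iff, one_ne_zero, imp_false, not_not] at hμ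
      exact hμ ▸ ⟨hν, hνN⟩
    · simp only [DSkew, ite_mul, one_mul, zero_mul]
      rw [Finset.sum_ite_eq, if_pos (hmem ν ⟨hν, hνN⟩)]
      simp
  | succ n ih =>
    have hg0 : ∀ k i : ℕ, i ≤ 2 * N → f (x + 2 * η * (i - sumΛ Λ k)) ≠ 0 := fun k i hi => by
      simpa using hgen 0 (by omega) k i hi
    obtain ⟨ih1, ih2⟩ := ih (Fin.tail v) (fun j => S j.succ) (x + 2 * η) (fun j hj k i hi => by
      have := hgen (j + 1) (by omega) k i hi
      rwa [show x + 2 * η * (j + 1 : ℕ) = x + 2 * η + 2 * η * j by push_cast; ring] at this)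
      (fun u => φ u * (f (u - v 0 + 2 * η) / f (u - v 0)))
      (hφ.mul (Mer.div (S 0).sigma (S 0).cell (Mer.f_comp (S 0).sigma (by fun_prop))
        fun s hs h0 γ hγ => (S 0).cell.inj s hs _ (S 0).v_mem h0 ▸ H.outside γ hγ (S 0).v_outside))
    -- By the induction hypothesis only configurations of N particles on the sites below L
    -- contribute, which makes the sum in the branching rule finite.
    have hsum : ∀ μ, DSkew f η Λ z ν (n + 1) μ x v = ∑ κ ∈ configs (N + 2) L,
        D₁ f η Λ z κ μ x (v 0) * DSkew f η Λ z ν n κ (x + 2 * η) (Fin.tail v) := by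
      intro μ
      rw [DSkew, finsum_eq_sum_of_support_subset]
      intro κ hκ
      exact hmem κ (ih1 κ (right_ne_zero_of_mul hκ))
    constructor
    · intro μ hμ
      rw [hsum] at hμ
      obtain ⟨κ, _, hκ⟩ := Finset.exists_ne_zero_of_sum_ne_zero hμ
      obtain ⟨hκL, hκN⟩ := ih1 κ (right_ne_zero_of_mul hκ)
      have hD := left_ne_zero_of_mul hκ
      have hμL : ∀ i ∈ μ, i < L := by
        by_contra hcon
        exact hD (D₁_eq_zero (S 0).p_sub_v hκL hcon)
      rw [D₁_eq (S 0).p_sub_v (fun k => hg0 k _ (by rw [hκN])) hκL hμL] at hD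
      have := (numBelow_of_transfer_ne_zero L).2 (right_ne_zero_of_mul hD)
      rw [numBelow_count hμL, numBelow_count hκL, hκN] at this
      exact ⟨hμL, this⟩
    · simp only [hsum, Finset.sum_mul]
      rw [Finset.sum_comm]
      have e : ∀ κ ∈ configs (N + 2) L, ∑ μ ∈ configs (N + 2) L,
          D₁ f η Λ z κ μ x (v 0) * DSkew f η Λ z ν n κ (x + 2 * η) (Fin.tail v) *
            weightIntegral f η Λ z Γ L x φ μ =
          1 / f x * (DSkew f η Λ z ν n κ (x + 2 * η) (Fin.tail v) *
            weightIntegral f η Λ z Γ L (x + 2 * η)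
              (fun u => φ u * (f (u - v 0 + 2 * η) / f (u - v 0))) κ) := by
        intro κ _
        by_cases h0 : DSkew f η Λ z ν n κ (x + 2 * η) (Fin.tail v) = 0
        · simp [h0]
        · obtain ⟨hκL, hκN⟩ := ih1 κ h0
          rw [mul_left_comm, ← sum_D₁_mul (S 0) hη hg0 hκL hκN H hφ, Finset.mul_sum]
          refine Finset.sum_congr rfl fun μ _ => ?_
          ring
      rw [Finset.sum_congr rfl e, ← Finset.mul_sum, ih2, Finset.prod_range_succ', ← mul_assoc]
      congr 1
      · rw [mul_comm, Nat.cast_zero, mul_zero, add_zero]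
        congr 1
        refine Finset.prod_congr rfl fun i _ => ?_
        rw [show x + 2 * η + 2 * η * i = x + 2 * η * (i + 1 : ℕ) by push_cast; ring]
      · rw [show x + 2 * η + 2 * η * n = x + 2 * η * (n + 1 : ℕ) by push_cast; ring]
        congr 1
        funext u
        rw [Fin.prod_univ_succ, mul_assoc]
        rfl

end Branching

/-! ### Signatures and norms in explicit form -/

section Words
variable {f : ℂ → ℂ} {h x : ℂ} {Λ p : ℕ → ℂ}

/-- Words list the sites in decreasing order, so a particle added at or beyond the last occupied
site becomes the outermost letter. -/
theorem weightWord_eq_cons {y y' : ℕ → ℕ} {a : ℕ} (ha : y' a = y a + 1)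
    (hne : ∀ i, i ≠ a → y' i = y i) (hz : ∀ i, a < i → y i = 0) {L : ℕ} (haL : a < L) :
    weightWord f h Λ p x y' L =
      weightLetter f h Λ p a (x - h * sumΛ Λ a + 2 * h * numBelow y (a + 1)) ::
        weightWord f h Λ p x y L := by
  induction L with
  | zero => omega
  | succ L ih =>
    rw [weightWord, weightWord]
    rcases Nat.lt_succ_iff_lt_or_eq.1 haL with h1 | rfl
    · rw [hne L (by omega), hz L h1, row, row, List.nil_append, List.nil_append, ih h1]
    · have hc : ∀ i < a, y' i = y i := fun i hi => hne i (by omega)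
      rw [ha, siteParam_congr hc, weightWord_congr hc, row, List.cons_append, siteParam,
        numBelow_succ]
      congr 2
      push_cast
      ring

/-- The word of a signature. -/
theorem weightWord_ofFn (N : ℕ) (ν : Fin N → ℕ) (hν : Antitone ν) {L : ℕ} (hL : ∀ i, ν i < L) :
    weightWord f h Λ p x (fun i => (List.ofFn ν : Multiset ℕ).count i) L =
      List.ofFn fun i : Fin N => weightLetter f h Λ p (ν i)
        (x - h * sumΛ Λ (ν i) + 2 * h * (N - ((i : ℕ) + 1))) := by
  induction N with
  | zero =>
    have : ∀ m, weightWord f h Λ p x (fun _ => 0) m = [] := fun m => by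
      induction m with
      | zero => rfl
      | succ m ih => rw [weightWord, ih, row, List.nil_append]
    simpa using this L
  | succ N ih =>
    have hs : ∀ i : Fin N, ν i.succ ≤ ν 0 := fun i => hν (Fin.zero_le _)
    rw [List.ofFn_succ, List.ofFn_succ]
    have hlt : ∀ i ∈ (List.ofFn (fun i : Fin N => ν i.succ) : Multiset ℕ), i < ν 0 + 1 := by
      intro i hi
      rw [Multiset.mem_coe, List.mem_ofFn] at hi
      obtain ⟨j, rfl⟩ := hi
      exact Nat.lt_succ_of_le (hs j)
    -- The largest part ν 0 is the particle added last; the others precede it and all have parts at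
    -- most ν 0.
    rw [weightWord_eq_cons (y := fun i =>
      (List.ofFn (fun i : Fin N => ν i.succ) : Multiset ℕ).count i) (a := ν 0) _ _ _ (hL 0),
      ih (fun i => ν i.succ) (fun i j hij => hν (Fin.succ_le_succ_iff.2 hij)) fun i => hL _,
      numBelow_count hlt]
    · congr 1
      · rw [Multiset.coe_card, List.length_ofFn]
        push_cast
        congr 1
        simp
      · congr 1
        funext i
        congr 1
        push_cast [Fin.val_succ]
        ring
    · simp
    · intro i hi
      simp [Ne.symm hi]
    · intro i hi
      exact Multiset.count_eq_zero.2 fun hm => absurd (hlt i hm) (by omega)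

theorem numBelow_eq_countP (κ : Multiset ℕ) (i : ℕ) :
    numBelow (fun j => κ.count j) i = κ.countP (· < i) := by
  rw [Multiset.countP_eq_card_filter, ← numBelow_count (L := i) (κ := κ.filter (· < i))
    fun j hj => (Multiset.mem_filter.1 hj).2]
  exact numBelow_congr fun j hj => (Multiset.count_filter_of_pos (p := (· < i)) hj).symm

/-- The squared norm in terms of the norms of the sites. -/
theorem cNorm_eq (f : ℂ → ℂ) (η : ℂ) (Λ : ℕ → ℂ) (ν : Multiset ℕ) (lam : ℂ) {L : ℕ}
    (hL : ∀ i ∈ ν, i < L) :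
    cNorm f η Λ ν lam = f (2 * η) ^ ν.card /
      (deriv f 0 ^ ν.card * ∏ i ∈ Finset.range ν.card, f (lam + 2 * η * i)) *
      (wordNorm f (2 * η) Λ lam (fun i => ν.count i) L)⁻¹ := by
  rw [cNorm, wordNorm, ← Finset.prod_inv_distrib]
  congr 1
  rw [Finset.prod_subset (s₂ := Finset.range L)]
  · refine Finset.prod_congr rfl fun i _ => ?_
    rw [siteNorm, ← Finset.prod_inv_distrib]
    refine Finset.prod_congr rfl fun j _ => ?_
    rw [inv_div, siteParam, numBelow_eq_countP, sumΛ, Finset.sum_range_succ, ← sumΛ]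
    congr 3 <;> ring
  · intro i hi
    exact Finset.mem_range.2 (hL i (Multiset.mem_toFinset.1 hi))
  · intro i _ hi
    rw [Multiset.mem_toFinset] at hi
    rw [Multiset.count_eq_zero.2 hi, Finset.prod_range_zero]

theorem prod_Ico_neg (g : ℂ → ℂ) (n N : ℕ) :
    ∏ i ∈ Finset.Ico (-(n : ℤ)) (N : ℤ), g (i : ℂ) =
      (∏ i ∈ Finset.range n, g (i - n)) * ∏ i ∈ Finset.range N, g i := by
  have h1 : ∏ i ∈ Finset.Ico (-(n : ℤ)) (N : ℤ), g (i : ℂ) =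
      ∏ k ∈ Finset.range (n + N), g (k - n) := by
    refine Finset.prod_nbij' (fun i : ℤ => (i + n).toNat) (fun k : ℕ => (k : ℤ) - n) ?_ ?_ ?_ ?_ ?_
    · intro i hi
      rw [Finset.mem_Ico] at hi
      rw [Finset.mem_range]
      omega
    · intro k hk
      rw [Finset.mem_range] at hk
      rw [Finset.mem_Ico]
      omega
    · intro i hi
      rw [Finset.mem_Ico] at hi
      omega
    · intro k _
      omega
    · intro i hi
      rw [Finset.mem_Ico] at hi
      congr 1
      have : (((i + n).toNat : ℤ) : ℂ) = ((i + n : ℤ) : ℂ) := by rw [Int.toNat_of_nonneg (by omega)]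
      rw [Int.cast_natCast] at this
      rw [this]
      push_cast
      ring
  rw [h1, Finset.prod_range_add]
  congr 1
  refine Finset.prod_congr rfl fun k _ => ?_
  congr 1
  push_cast
  ring

end Words

/-! ### From admissible data to the integral formula -/

section Main

theorem Regime.IsFundamental.isCell {R : Regime} {D : Set ℂ} (h : R.IsFundamental D) :
    IsCell R.f D :=
  ⟨h.convex, fun _ hx _ hy => h.eq_of_f_sub_eq_zero hx hy⟩

variable {R : Regime} {η : ℂ} {Λ z : ℕ → ℂ} {D : Set ℂ} {N : ℕ} {γ : Fin N → Contour}

theorem Admissible.nest (H : Admissible R η Λ z D γ) {i j : Fin N} (hij : i < j) :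
    Contour.Nest (2 * η) (γ i) (γ j) := by
  obtain ⟨i, hi⟩ := i
  obtain ⟨j, hj⟩ := j
  rw [Fin.mk_lt_mk] at hij
  induction j, hij using Nat.le_induction with
  | base => exact Contour.nest_of_trace (H.nested _ _ rfl)
  | succ j hij ih =>
    exact (ih (by omega)).trans (Contour.nest_of_trace (H.nested ⟨j, by omega⟩ _ rfl))

theorem Admissible.p_mem_inside (H : Admissible R η Λ z D γ) (i : Fin N) (j : ℕ) :
    pPt η Λ z j ∈ (γ i).inside := by
  have hN := i.pos
  have hl := H.p_inside ⟨N - 1, by omega⟩ (by simp only; omega) j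
  rcases lt_or_eq_of_le (show i ≤ ⟨N - 1, by omega⟩ from by
    rw [Fin.le_def]; have := i.isLt; simp only; omega) with h | h
  · exact (H.nest h _ (Or.inl hl)).1
  · rw [h]; exact hl

/-- The contours of admissible parameters form a tower. -/
theorem Admissible.isTower (H : Admissible R η Λ z D γ) {n : ℕ} (v : Fin n → ℂ) (hN : 1 ≤ N)
    (hv : ∀ j, v j ∈ (γ ⟨0, hN⟩).outside) :
    IsTower (2 * η) D (Set.range (pPt η Λ z)) (Set.range (qPt η Λ z) ∪ Set.range v)
      (List.ofFn γ) := by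
  refine ⟨List.pairwise_ofFn.2 fun i j hij => H.nest hij, ?_, ?_, ?_⟩
  · intro δ hδ
    obtain ⟨i, rfl⟩ := (List.mem_ofFn' _ _).1 hδ
    exact H.trace_subset i
  · intro δ hδ
    obtain ⟨i, rfl⟩ := (List.mem_ofFn' _ _).1 hδ
    rintro _ ⟨j, rfl⟩
    exact H.p_mem_inside i j
  · intro δ hδ
    obtain ⟨i, rfl⟩ := (List.mem_ofFn' _ _).1 hδ
    rintro _ (⟨j, rfl⟩ | ⟨j, rfl⟩)
    · exact H.q_outside i j
    · rw [Contour.mem_outside_iff]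
      intro hi
      have h0 := Contour.mem_outside_iff.1 (hv j)
      rcases lt_or_eq_of_le (show (⟨0, hN⟩ : Fin N) ≤ i from Nat.zero_le _) with h | h
      · exact h0 (Or.inl (H.nest h _ hi).1)
      · exact h0 (h ▸ hi)

theorem Admissible.siteData (H : Admissible R η Λ z D γ) {n : ℕ} (v : Fin n → ℂ) (hN : 1 ≤ N)
    (hvD : ∀ j, v j ∈ D) (hv : ∀ j, v j ∈ (γ ⟨0, hN⟩).outside) (j : Fin n) :
    SiteData R.f D (Set.range (pPt η Λ z)) (Set.range (qPt η Λ z) ∪ Set.range v)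
      (pPt η Λ z) (v j) where
  sigma := R.sigmaLike
  cell := H.fundamental.isCell
  p_mem := H.p_mem
  p_inside j := ⟨j, rfl⟩
  v_mem := hvD j
  v_outside := Or.inr ⟨j, rfl⟩
  p_sub_v i h0 := by
    have h1 := H.fundamental.eq_of_f_sub_eq_zero (H.p_mem i) (hvD j) h0
    have h2 := H.p_mem_inside ⟨0, hN⟩ i
    rw [h1] at h2
    exact Set.disjoint_left.1 Contour.disjoint_inside_outside h2 (hv j)

/-- The functions `D_ν` as nested integrals. -/
theorem DFun_eq_weightIntegral (H : Admissible R η Λ z D γ) {n : ℕ} {v : Fin n → ℂ} (hN : 1 ≤ N)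
    (hη : R.f (2 * η) ≠ 0) (hvD : ∀ j, v j ∈ D) (hv : ∀ j, v j ∈ (γ ⟨0, hN⟩).outside) {x : ℂ}
    (hgen : ∀ k i : ℕ, i < 2 * N + n → R.f (x + 2 * η * (i - sumΛ Λ k)) ≠ 0)
    {ν : Multiset ℕ} (hνN : ν.card = N) {L : ℕ} (hL : ∀ i ∈ ν, i < L + 1) :
    DFun R.f η Λ z ν x v = (-deriv R.f 0) ^ N * ((∏ i ∈ Finset.range n, 1 / R.f (x + 2 * η * i)) *
      weightIntegral R.f η Λ z (List.ofFn γ) (L + 1) (x + 2 * η * n)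
        (fun u => vacuumFactor R.f (2 * η) x (qPt η Λ z 0) N u *
          ∏ j, (R.f (u - v j + 2 * η) / R.f (u - v j))) ν) := by
  have hf := R.sigmaLike
  have hD := H.fundamental.isCell
  have hT := H.isTower v hN hv
  have hq : qPt η Λ z 0 = pPt η Λ z 0 + 2 * η * Λ 0 := qPt_eq η Λ z 0
  have hc : ∀ δ ∈ List.ofFn γ, ∀ u ∈ δ.closedRegion, R.f (u - qPt η Λ z 0) ≠ 0 := by
    intro δ hδ u hu h0
    have h1 := H.fundamental.eq_of_f_sub_eq_zero
      (Contour.closedRegion_subset hD.convex (hT.trace_subset δ hδ) hu) (H.q_mem 0) h0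
    exact Contour.mem_outside_iff.1 (hT.outside δ hδ (Or.inl ⟨0, h1.symm⟩)) hu
  have hlen : (List.ofFn γ).length = N := List.length_ofFn
  have hp : ∀ j, pPt η Λ z j ∈ Set.range (pPt η Λ z) := fun j => ⟨j, rfl⟩
  -- The j-th of the n branching steps, j < n, needs genericity for i ≤ 2N at x + hj, that is, up to
  -- i + j = 2N + n - 1.
  obtain ⟨h1, h2⟩ := sum_DSkew_mul hη hL hνN hT n v (H.siteData v hN hvD hv) x
    (fun j hj k i hi => by
      have := hgen k (i + j) (by omega)
      rwa [show x + 2 * η * ((i + j : ℕ) - sumΛ Λ k) =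
        x + 2 * η * j + 2 * η * (i - sumΛ Λ k) by push_cast; ring] at this)
    (vacuumFactor R.f (2 * η) x (qPt η Λ z 0) N)
    (Mer.vacuumFactor hf hD fun s _ h0 => mem_outsideAll_of_ne_zero hc h0)
  rw [hq] at hc
  have hmem : Multiset.replicate N 0 ∈ configs (N + 2) (L + 1) := by
    refine (mem_configs (by omega)).2 ⟨fun i hi => ?_, fun i => ?_⟩
    · rw [Multiset.eq_of_mem_replicate hi]
      omega
    · have := Multiset.count_le_card i (Multiset.replicate N 0)
      rw [Multiset.card_replicate] at this
      omega
  -- With the vacuum factor as φ only the configuration with all particles at site 0 survives, and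
  -- its coefficient is D_ν.
  rw [Finset.sum_eq_single (Multiset.replicate N 0)] at h2
  · have hw : weightIntegral R.f η Λ z (List.ofFn γ) (L + 1) x
        (vacuumFactor R.f (2 * η) x (qPt η Λ z 0) N) (Multiset.replicate N 0) =
        (-1 / deriv R.f 0) ^ N := by
      have hz : ∀ i ≤ L, 0 < i → (fun i => (Multiset.replicate N 0).count i) i = 0 :=
        fun i _ hi => by simp only [Multiset.count_replicate, if_neg hi.ne]
      have h0 : (Multiset.replicate N 0).count 0 = N := Multiset.count_replicate_self 0 N
      have key := siteNorm_mul_nestedIntegral_row hf hD H.p_mem hp x hT hc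
        (fun j hj => by
          have := hgen 0 (1 + j) (by omega)
          simpa [sumΛ] using this)
        (fun j hj => by
          have := hgen 1 (N + j) (by omega)
          rw [hlen]
          rwa [show x + 2 * η * ((N + j : ℕ) - sumΛ Λ 1) = x + 2 * η * (N + j) - 2 * η * Λ 0 by
            rw [sumΛ, Finset.sum_range_one]; push_cast; ring] at this)
      rw [hlen] at key
      rw [weightIntegral, weightWord_eq_row hz, wordNorm_eq_siteNorm hz, h0, hq, key]
    rw [hw] at h2
    have hd := hf.deriv_zero
    rw [DFun, hνN, ← h2, mul_left_comm, ← mul_pow, show -deriv R.f 0 * (-1 / deriv R.f 0) = 1 by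
      field_simp, one_pow, mul_one]
  · intro μ hμ hμ0
    by_cases hS : DSkew R.f η Λ z ν n μ x v = 0
    · rw [hS, zero_mul]
    obtain ⟨hμL, hμN⟩ := h1 μ hS
    have hex : ¬ ∀ i < L + 1, 0 < i → (fun i => μ.count i) i = 0 := by
      intro hall
      refine hμ0 (Multiset.eq_replicate.2 ⟨hμN, fun b hb => ?_⟩)
      by_contra hb0
      exact Multiset.count_ne_zero.2 hb (hall b (hμL b hb) (Nat.pos_of_ne_zero hb0))
    have := nestedIntegral_weightWord_eq_zero hf hD H.p_mem hp x hex hT hc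
    rw [hlen, ← hq] at this
    rw [weightIntegral, this, mul_zero, mul_zero]
  · exact fun hn => absurd hmem hn

/-- The integral representation of the functions `D_ν`. -/
theorem DFun_eq_iteratedIntegral (H : Admissible R η Λ z D γ) {n : ℕ} {v : Fin n → ℂ} (hN : 1 ≤ N)
    (hη : R.f (2 * η) ≠ 0) (hvD : ∀ j, v j ∈ D) (hv : ∀ j, v j ∈ (γ ⟨0, hN⟩).outside) (lam : ℂ)
    (hlam : ∀ (k : ℕ) (i : ℤ), -(n : ℤ) ≤ i → i ≤ 2 * (N : ℤ) - 1 →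
      R.f (lam + 2 * η * ((i : ℂ) - sumΛ Λ k)) ≠ 0) (ν : Fin N → ℕ) (hν : Antitone ν) :
    DFun R.f η Λ z (Finset.univ.val.map ν) (lam - 2 * η * n) v =
      (-1) ^ N * R.f (2 * η) ^ N /
          ((∏ i ∈ Finset.Ico (-(n : ℤ)) (N : ℤ), R.f (lam + 2 * η * (i : ℂ))) *
            cNorm R.f η Λ (Finset.univ.val.map ν) lam) *
        iteratedIntegral N γ fun u =>
          (∏ i : Fin N, ∏ j ∈ Finset.Ioi i, R.f (u i - u j) / R.f (u i - u j - 2 * η)) *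
          ∏ i : Fin N,
            (psi R.f η Λ z (ν i) (u i) *
              R.f (lam - u i + pPt η Λ z (ν i) + 2 * η + 4 * η * ((N : ℂ) - ((i : ℕ) + 1)) -
                2 * η * sumΛ Λ (ν i)) *
              (R.f (lam + u i - qPt η Λ z 0 + 2 * η * ((N : ℂ) - n)) /
                R.f (u i - qPt η Λ z 0)) *
              ∏ j : Fin n, R.f (u i - v j + 2 * η) / R.f (u i - v j)) := by
  have hcard : (Finset.univ.val.map ν).card = N := by simp
  have hL : ∀ i ∈ Finset.univ.val.map ν, i < ν ⟨0, hN⟩ + 1 := by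
    intro i hi
    obtain ⟨j, _, rfl⟩ := Multiset.mem_map.1 hi
    exact Nat.lt_succ_of_le (hν (Nat.zero_le _))
  have hgen : ∀ k i : ℕ, i < 2 * N + n →
      R.f (lam - 2 * η * n + 2 * η * (i - sumΛ Λ k)) ≠ 0 := fun k i hi => by
    have := hlam k (i - n) (by omega) (by omega)
    rwa [show lam + 2 * η * (((i - n : ℤ) : ℂ) - sumΛ Λ k) =
      lam - 2 * η * n + 2 * η * (i - sumΛ Λ k) by push_cast; ring] at this
  have hword : weightWord R.f (2 * η) Λ (pPt η Λ z) lam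
      (fun i => (Finset.univ.val.map ν).count i) (ν ⟨0, hN⟩ + 1) =
      List.ofFn fun i : Fin N => weightLetter R.f (2 * η) Λ (pPt η Λ z) (ν i)
        (lam - 2 * η * sumΛ Λ (ν i) + 2 * (2 * η) * (N - ((i : ℕ) + 1))) := by
    rw [Fin.univ_val_map]
    exact weightWord_ofFn N ν hν fun i => Nat.lt_succ_of_le (hν (Nat.zero_le _))
  rw [DFun_eq_weightIntegral H hN hη hvD hv hgen hcard hL, weightIntegral, sub_add_cancel, hword,
    ← iteratedIntegral_eq_nestedIntegral, cNorm_eq R.f η Λ _ lam hL, hcard,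
    prod_Ico_neg (fun i => R.f (lam + 2 * η * i)), ← mul_assoc, ← mul_assoc]
  congr 1
  · have hY : ∏ i ∈ Finset.range N, R.f (lam + 2 * η * i) ≠ 0 := Finset.prod_ne_zero_iff.2
      fun i hi => by
        have := hlam 0 i (by omega) (by have := Finset.mem_range.1 hi; omega)
        simpa [sumΛ] using this
    have hd := pow_ne_zero N R.sigmaLike.deriv_zero
    have hh := pow_ne_zero N hη
    have hX : ∏ i ∈ Finset.range n, 1 / R.f (lam - 2 * η * n + 2 * η * i) =
        (∏ i ∈ Finset.range n, R.f (lam + 2 * η * (i - n)))⁻¹ := by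
      rw [← Finset.prod_inv_distrib]
      refine Finset.prod_congr rfl fun i _ => ?_
      rw [one_div, show lam - 2 * η * n + 2 * η * i = lam + 2 * η * (i - n) by ring]
    rw [hX, neg_pow (deriv R.f 0)]
    generalize wordNorm R.f (2 * η) Λ lam
      (fun i => (Finset.univ.val.map ν).count i) (ν ⟨0, hN⟩ + 1) = W
    generalize ∏ i ∈ Finset.range N, R.f (lam + 2 * η * i) = Y at hY ⊢
    generalize ∏ i ∈ Finset.range n, R.f (lam + 2 * η * (i - n)) = X
    generalize R.f (2 * η) ^ N = A at hh ⊢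
    generalize deriv R.f 0 ^ N = d at hd ⊢
    -- If X or W were zero, both sides would vanish by the convention for division by zero.
    by_cases hX0 : X = 0
    · simp [hX0]
    by_cases hW0 : W = 0
    · simp [hW0]
    field_simp
  · congr 1
    funext u
    congr 1
    refine Finset.prod_congr rfl fun i _ => ?_
    rw [weightLetter, sitePrefix, psi, vacuumFactor,
      show lam - 2 * η * sumΛ Λ (ν i) + 2 * (2 * η) * (N - ((i : ℕ) + 1)) + 2 * η +
        pPt η Λ z (ν i) - u i = lam - u i + pPt η Λ z (ν i) + 2 * η +
          4 * η * ((N : ℂ) - ((i : ℕ) + 1)) - 2 * η * sumΛ Λ (ν i) by ring,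
      show lam - 2 * η * n + u i - qPt η Λ z 0 + 2 * η * N =
        lam + u i - qPt η Λ z 0 + 2 * η * ((N : ℂ) - n) by ring]
    simp only [qPt_eq]
    ring

end Main
end EllipticIRF

theorem mainTheorem9 (R : Regime) (η lam : ℂ) (Λ z : ℕ → ℂ)
    (N n : ℕ) (hN : 1 ≤ N) (hn : 1 ≤ n)
    (hη : R.f (2 * η) ≠ 0)
    (hlam : ∀ (k : ℕ) (i : ℤ), -(n : ℤ) ≤ i → i ≤ 2 * (N : ℤ) - 1 →
      R.f (lam + 2 * η * ((i : ℂ) - sumΛ Λ k)) ≠ 0)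
    (D : Set ℂ) (γ : Fin N → Contour) (hadm : Admissible R η Λ z D γ)
    (v : Fin n → ℂ) (hvD : ∀ j, v j ∈ D) (hvγ : ∀ j, v j ∈ (γ ⟨0, hN⟩).outside)
    (ν : Fin N → ℕ) (hν : Antitone ν) :
    DFun R.f η Λ z (Finset.univ.val.map ν) (lam - 2 * η * n) v =
      (-1) ^ N * R.f (2 * η) ^ N /
          ((∏ i ∈ Finset.Ico (-(n : ℤ)) (N : ℤ), R.f (lam + 2 * η * (i : ℂ))) *
            cNorm R.f η Λ (Finset.univ.val.map ν) lam) *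
        iteratedIntegral N γ fun u =>
          (∏ i : Fin N, ∏ j ∈ Finset.Ioi i, R.f (u i - u j) / R.f (u i - u j - 2 * η)) *
          ∏ i : Fin N,
            (psi R.f η Λ z (ν i) (u i) *
              R.f (lam - u i + pPt η Λ z (ν i) + 2 * η + 4 * η * ((N : ℂ) - ((i : ℕ) + 1)) -
                2 * η * sumΛ Λ (ν i)) *
              (R.f (lam + u i - qPt η Λ z 0 + 2 * η * ((N : ℂ) - n)) /
                R.f (u i - qPt η Λ z 0)) *
              ∏ j : Fin n, R.f (u i - v j + 2 * η) / R.f (u i - v j)) := by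
  exact DFun_eq_iteratedIntegral hadm hN hη hvD hvγ lam hlam ν hν
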